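/- Let $p>2$ and let $\mathcal G$ be a regular single-knot metric graph of length $\ell>0$, that is, a metric graph made of $H\ge 1$ half-lines, $P\ge 0$ pendants of length $\ell$ and $L\ge 0$ loops of length $2\ell$, all attached at a single vertex. Let $H^1(\mathcal G)$ be the space of continuous functions $u:\mathcal G\to\mathbb R$ whose restriction to each edge $e$ belongs to $H^1(e)$. A bound-state on $\mathcal G$ is a function $u\in H^1(\mathcal G)\setminus\{0\}$ such that $$\int_{\mathcal G} u'\eta'+u\eta-|u|^{p-2}u\,\eta\,dx=0\qquad\text{for all }\eta\in H^1(\mathcal G),$$ and an action ground-state is a bound-state that attains the least action level $$\mathcal S_{\mathcal G}=\inf\{S(u):u\text{ is a bound-state on }\mathcal G\},\qquad S(u)=\frac12\int_{\mathcal G}|u'|^2+|u|^2\,dx-\frac1p\int_{\mathcal G}|u|^p\,dx .$$ Then there exists an action ground-state on $\mathcal G$. -/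

import Mathlib

open MeasureTheory Set

open scoped ContDiff

/-- A single-knot metric graph: `H ≥ 1` half-lines, `P ≥ 0` pendants and `L ≥ 0` loops of positive
finite lengths, all attached at one vertex (the knot). -/
structure SingleKnotGraph where
  H : ℕ
  P : ℕ
  L : ℕ
  pendantLength : Fin P → ℝ
  loopLength : Fin L → ℝ
  one_le_H : 1 ≤ H
  pendantLength_pos : ∀ i, 0 < pendantLength i
  loopLength_pos : ∀ j, 0 < loopLength j

/-- `g` is a weak derivative of `u` on the interior of `I` (both functions locally integrable there,
tested against smooth functions with compact support in the interior). -/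
def HasWeakDerivOn (u g : ℝ → ℝ) (I : Set ℝ) : Prop :=
  LocallyIntegrableOn u (interior I) ∧ LocallyIntegrableOn g (interior I) ∧
    ∀ φ : ℝ → ℝ, ContDiff ℝ ∞ φ → HasCompactSupport φ → tsupport φ ⊆ interior I →
      ∫ x in I, u x * deriv φ x = - ∫ x in I, g x * φ x

/-- The Sobolev space `H¹(I)`: `u ∈ L²(I)` with a weak derivative in `L²(I)`. -/
def MemH1On (u : ℝ → ℝ) (I : Set ℝ) : Prop :=
  MemLp u 2 (volume.restrict I) ∧
    ∃ g : ℝ → ℝ, HasWeakDerivOn u g I ∧ MemLp g 2 (volume.restrict I)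

open Classical in
/-- The weak derivative of `u` on `I` (it is unique almost everywhere on `I`). It takes the value
zero when no weak derivative exists, which never happens for the functions considered below. -/
noncomputable def weakDeriv (u : ℝ → ℝ) (I : Set ℝ) : ℝ → ℝ :=
  if h : ∃ g : ℝ → ℝ, HasWeakDerivOn u g I then Classical.choose h else 0

namespace SingleKnotGraph

/-- A single-knot graph is regular of length `ℓ` if its pendants have length `ℓ` and its loops have
length `2 ℓ`. -/
def IsRegular (G : SingleKnotGraph) (ℓ : ℝ) : Prop :=
  (∀ i, G.pendantLength i = ℓ) ∧ ∀ j, G.loopLength j = 2 * ℓ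

/-- The edges: half-lines, pendants and loops, in this order. -/
abbrev Edge (G : SingleKnotGraph) : Type := Fin G.H ⊕ (Fin G.P ⊕ Fin G.L)

/-- The interval with which an edge is identified. The knot is the point `0` of each edge and, on a
loop, also the other end point. -/
def interval (G : SingleKnotGraph) : G.Edge → Set ℝ
  | .inl _ => Ici 0
  | .inr (.inl i) => Icc 0 (G.pendantLength i)
  | .inr (.inr j) => Icc 0 (G.loopLength j)

/-- A function on the graph, given by its restrictions `u e` to the edges (only the values on
`G.interval e` matter), is continuous: it is so on each edge and takes one value at the knot. -/
def IsContinuous (G : SingleKnotGraph) (u : G.Edge → ℝ → ℝ) : Prop :=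
  (∀ e, ContinuousOn (u e) (G.interval e)) ∧
    (∀ e e', u e 0 = u e' 0) ∧
    ∀ j : Fin G.L, u (.inr (.inr j)) (G.loopLength j) = u (.inr (.inr j)) 0

/-- The space `H¹(G)`: continuous functions on `G` that are in `H¹` of each edge. -/
def MemH1 (G : SingleKnotGraph) (u : G.Edge → ℝ → ℝ) : Prop :=
  G.IsContinuous u ∧ ∀ e, MemH1On (u e) (G.interval e)

/-- The action functional `S(u) = ½ ∫_G (|u'|² + |u|²) - (1/p) ∫_G |u|^p`. -/
noncomputable def action (G : SingleKnotGraph) (p : ℝ) (u : G.Edge → ℝ → ℝ) : ℝ :=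
  (1 / 2) * (∑ e, ∫ x in G.interval e, (weakDeriv (u e) (G.interval e) x ^ 2 + u e x ^ 2)) -
    (1 / p) * ∑ e, ∫ x in G.interval e, |u e x| ^ p

/-- Bound states: nontrivial weak solutions `u ∈ H¹(G)` of `-u'' + u = |u|^(p-2) u` on `G`. -/
def IsBoundState (G : SingleKnotGraph) (p : ℝ) (u : G.Edge → ℝ → ℝ) : Prop :=
  G.MemH1 u ∧ (∃ e, ∃ x ∈ G.interval e, u e x ≠ 0) ∧
    ∀ η : G.Edge → ℝ → ℝ, G.MemH1 η →
      ∑ e, ∫ x in G.interval e,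
        (weakDeriv (u e) (G.interval e) x * weakDeriv (η e) (G.interval e) x
          + u e x * η e x - |u e x| ^ (p - 2) * u e x * η e x) = 0

/-- The least action level, the infimum of the action over all bound states. -/
noncomputable def leastActionLevel (G : SingleKnotGraph) (p : ℝ) : EReal :=
  ⨅ u ∈ {v : G.Edge → ℝ → ℝ | G.IsBoundState p v}, (G.action p u : EReal)

/-- Action ground states: bound states that attain the least action level. -/
def IsActionGroundState (G : SingleKnotGraph) (p : ℝ) (u : G.Edge → ℝ → ℝ) : Prop :=
  G.IsBoundState p u ∧ (G.action p u : EReal) = G.leastActionLevel p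

end SingleKnotGraph

/-! Bound states are the nonzero classical solutions of U'' = U - |U|^(p-2) U on the edges, square
integrable with their derivatives, continuous at the knot, with zero total outgoing slope there
(Kirchhoff) and zero slope at the tips of the pendants (`IsBoundState.exists_isStationary`). Testing
such a u with itself gives ∫|u|^p = ‖u‖² in H¹, hence S(u) = (1/2 - 1/p)‖u‖², and it remains to
minimise the norm over nontrivial stationary solutions. The main tool is the conserved energy U'² -
U² + (2/p)|U|^p of each edge. On half-lines it is zero by integrability, so the slope at the knot is
±s with s² = c² - (2/p)|c|^p, where c is the value at the knot.

Without compact edges every nontrivial solution consists of soliton pieces cut at ±a, up to a global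
sign, and the Kirchhoff condition forces one and the same norm on all of them
(`normSq_of_no_compact_edges`). A compactness argument would not do here: for even H the shift a is
free and may escape to infinity.

With compact edges put N = P + 2L ≥ 1. Three facts carry the proof.

Existence (`exists_isStationary_of_compact_edges`). One even solution on [-ℓ, ℓ] is used on all
compact edges: whole on a loop, half on a pendant. It is joined to solitons with alternating shifts,
and its amplitude is found by the intermediate value theorem.

Compactness (`exists_tendsto_isStationary`). A norm bound controls the solutions and their slopes
pointwise, continuous dependence on the data at 0 gives a stationary limit along a subsequence, and
Fatou's lemma makes the norm lower semicontinuous.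

No vanishing (`exists_pos_forall_not_small`). If the limit were zero, the solutions would become
uniformly small on the compact edges. A small positive solution is almost linear, so each end of a
compact edge has outgoing slope -ts with tanh(θℓ) ≤ t < tanh ℓ. The half-lines contribute an integer
multiple of s, so Kirchhoff puts an integer into [N tanh(θℓ), N tanh ℓ). For θ close to 1 there is
none. Regularity of the graph makes this interval the same for all compact edges. -/

open Filter Topology Interval

/-! ### Integration by parts and the du Bois-Reymond lemma -/

/-- Integration by parts for two primitives of integrable functions. -/
theorem integral_mul_add_mul_of_primitive {F G f g : ℝ → ℝ} {a b : ℝ} (hab : a ≤ b)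
    (hf : IntervalIntegrable f volume a b) (hg : IntervalIntegrable g volume a b)
    (hF : ∀ x ∈ Icc a b, F x = F a + ∫ t in a..x, f t)
    (hG : ∀ x ∈ Icc a b, G x = G a + ∫ t in a..x, g t) :
    ∫ x in a..b, (f x * G x + F x * g x) = F b * G b - F a * G a := by
  have haux : ∀ {f : ℝ → ℝ} (c : ℝ), IntervalIntegrable f volume a b →
      AbsolutelyContinuousOnInterval (fun x ↦ c + ∫ t in a..x, f t) a b := by
    intro f c hf
    have h1 := hf.absolutelyContinuousOnInterval_intervalIntegral (c := a) (by simp)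
    have h2 : AbsolutelyContinuousOnInterval (fun _ : ℝ ↦ c) a b :=
      (contDiff_const.contDiffOn : ContDiffOn ℝ 1 (fun _ : ℝ ↦ c) _).absolutelyContinuousOnInterval
    exact h2.add h1
  have hder : ∀ {f : ℝ → ℝ} (c : ℝ), IntervalIntegrable f volume a b →
      ∀ᵐ x, x ∈ uIcc a b → deriv (fun x ↦ c + ∫ t in a..x, f t) x = f x := by
    intro f c hf
    filter_upwards [hf.ae_hasDerivAt_integral] with x hx hx'
    exact ((hx hx' a (by simp)).const_add c).deriv
  have key := (haux (F a) hf).integral_deriv_mul_eq_sub (haux (G a) hg)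
  rw [← hF b (right_mem_Icc.2 hab), ← hG b (right_mem_Icc.2 hab)] at key
  simp only [intervalIntegral.integral_same, add_zero] at key
  rw [← key]
  apply intervalIntegral.integral_congr_ae
  filter_upwards [hder (F a) hf, hder (G a) hg] with x h1 h2 hx
  have hx' := uIoc_subset_uIcc hx
  rw [h1 hx', h2 hx', ← hF x (by rwa [uIcc_of_le hab] at hx'),
    ← hG x (by rwa [uIcc_of_le hab] at hx')]

theorem eq_add_integral_of_hasDerivAt {F f : ℝ → ℝ} {a b : ℝ}
    (hF : ∀ x ∈ Icc a b, HasDerivAt F (f x) x) (hf : ContinuousOn f (Icc a b)) :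
    ∀ x ∈ Icc a b, F x = F a + ∫ t in a..x, f t := by
  intro x hx
  have hsub : uIcc a x ⊆ Icc a b := by
    rw [uIcc_of_le hx.1]; exact Icc_subset_Icc_right hx.2
  rw [intervalIntegral.integral_eq_sub_of_hasDerivAt (fun t ht ↦ hF t (hsub ht))
    ((hf.mono hsub).intervalIntegrable)]
  ring

/-- Integrating a product with a function vanishing outside an interval. -/
theorem intervalIntegral_eq_integral_of_support {f : ℝ → ℝ} {a b : ℝ} (hab : a ≤ b)
    (hf : ∀ x, x ∉ Icc a b → f x = 0) : ∫ x in a..b, f x = ∫ x, f x := by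
  rw [intervalIntegral.integral_of_le hab, ← integral_Icc_eq_integral_Ioc]
  exact setIntegral_eq_integral_of_forall_compl_eq_zero hf

theorem exists_Icc_of_hasCompactSupport {φ : ℝ → ℝ} (hφ : HasCompactSupport φ) :
    ∃ R : ℝ, 0 < R ∧ tsupport φ ⊆ Ioo (-R) R := by
  obtain ⟨R, hR⟩ := hφ.isCompact.isBounded.subset_closedBall 0
  refine ⟨|R| + 1, by positivity, hR.trans ?_⟩
  rw [Real.closedBall_eq_Icc]
  intro x hx
  constructor <;> cases abs_cases R <;> linarith [hx.1, hx.2]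

/-- Integration by parts of a primitive against a test function. -/
theorem integral_primitive_mul_deriv {F f φ : ℝ → ℝ} (hf : LocallyIntegrable f)
    (hF : ∀ x, F x = F 0 + ∫ t in (0 : ℝ)..x, f t) (hφ : ContDiff ℝ ∞ φ)
    (hc : HasCompactSupport φ) : ∫ x, F x * deriv φ x = - ∫ x, f x * φ x := by
  obtain ⟨R, hR, hs⟩ := exists_Icc_of_hasCompactSupport hc
  have hii : ∀ a b, IntervalIntegrable f volume a b := fun a b ↦
    (hf.integrableOn_isCompact isCompact_uIcc).intervalIntegrable
  have hd : Continuous (deriv φ) := hφ.continuous_deriv (by simp)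
  have hφ0 : ∀ x, x ∉ Ioo (-R) R → φ x = 0 := fun x hx ↦
    image_eq_zero_of_notMem_tsupport fun h ↦ hx (hs h)
  have hdφ0 : ∀ x, x ∉ Ioo (-R) R → deriv φ x = 0 := fun x hx ↦
    image_eq_zero_of_notMem_tsupport fun h ↦ hx (hs (tsupport_deriv_subset h))
  have hle : -R ≤ R := by linarith
  have hFR : ∀ x ∈ Icc (-R) R, F x = F (-R) + ∫ t in (-R)..x, f t := by
    intro x _
    rw [hF x, hF (-R), add_assoc, intervalIntegral.integral_add_adjacent_intervals (hii _ _)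
      (hii _ _)]
  have hFc : Continuous F := by
    rw [show F = fun x ↦ F 0 + ∫ t in (0 : ℝ)..x, f t from funext hF]
    exact continuous_const.add (intervalIntegral.continuous_primitive hii 0)
  have key := integral_mul_add_mul_of_primitive hle (hii _ _) (hd.intervalIntegrable _ _) hFR
    (eq_add_integral_of_hasDerivAt
      (fun x _ ↦ (hφ.differentiable (by simp) x).hasDerivAt) hd.continuousOn)
  rw [hφ0 R (by simp), hφ0 (-R) (by simp), mul_zero, mul_zero, sub_zero,
    intervalIntegral.integral_add ((hii _ _).mul_continuousOn hφ.continuous.continuousOn)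
      ((show Continuous (fun x ↦ F x * deriv φ x) from hFc.mul hd).intervalIntegrable _ _),
    intervalIntegral_eq_integral_of_support hle, intervalIntegral_eq_integral_of_support hle] at key
  · linarith
  · intro x hx; rw [hdφ0 x (fun h ↦ hx (Ioo_subset_Icc_self h)), mul_zero]
  · intro x hx; rw [hφ0 x (fun h ↦ hx (Ioo_subset_Icc_self h)), mul_zero]

theorem MeasureTheory.LocallyIntegrableOn.integrable_mul_of_tsupport_subset {U : Set ℝ}
    {w ψ : ℝ → ℝ} (hw : LocallyIntegrableOn w U) (hψ : Continuous ψ) (hψc : HasCompactSupport ψ)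
    (hψU : tsupport ψ ⊆ U) : Integrable (fun x ↦ w x * ψ x) := by
  have h1 : IntegrableOn w (tsupport ψ) := hw.integrableOn_compact_subset hψU hψc.isCompact
  have h2 : IntegrableOn (fun x ↦ w x * ψ x) (tsupport ψ) :=
    h1.mul_continuousOn hψ.continuousOn hψc.isCompact
  rwa [integrableOn_iff_integrable_of_support_subset] at h2
  intro x hx
  exact subset_tsupport _ (right_ne_zero_of_mul hx)

/-- The du Bois-Reymond lemma on an open interval. -/
theorem exists_ae_eq_const_of_integral_mul_deriv_eq_zero {U : Set ℝ} (hU : IsOpen U)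
    (hc : U.OrdConnected) (hne : U.Nonempty) {w : ℝ → ℝ} (hw : LocallyIntegrableOn w U)
    (h : ∀ φ : ℝ → ℝ, ContDiff ℝ ∞ φ → HasCompactSupport φ → tsupport φ ⊆ U →
      ∫ x, w x * deriv φ x = 0) : ∃ C, ∀ᵐ x, x ∈ U → w x = C := by
  obtain ⟨x₀, hx₀⟩ := hne
  obtain ⟨r, hr, hball⟩ := Metric.isOpen_iff.1 hU x₀ hx₀
  let B : ContDiffBump x₀ := ⟨r / 4, r / 2, by linarith, by linarith⟩
  have hBs : tsupport (B.normed volume) ⊆ U := by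
    rw [B.tsupport_normed_eq]
    exact (Metric.closedBall_subset_ball (show r / 2 < r by linarith)).trans hball
  have hBsm : ContDiff ℝ ∞ (B.normed volume) := B.contDiff_normed
  have hBc : HasCompactSupport (B.normed volume) := B.hasCompactSupport_normed
  set ρ := B.normed volume with hρ
  set C := ∫ x, w x * ρ x with hC
  refine ⟨C, ?_⟩
  have hz : ∀ᵐ x, x ∈ U → w x - C = 0 := by
    refine hU.ae_eq_zero_of_integral_contDiff_smul_eq_zero
      (hw.sub (locallyIntegrable_const C |>.locallyIntegrableOn U)) ?_
    intro ψ hψ hψc hψU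
    set c := ∫ x, ψ x with hc'
    -- Subtracting the multiple of ρ with the same mass makes the mean of χ zero, so its primitive
    -- has compact support and is an admissible test function.
    let χ : ℝ → ℝ := fun x ↦ ψ x - c * ρ x
    have hχ : ContDiff ℝ ∞ χ := hψ.sub (contDiff_const.mul hBsm)
    have hK : IsCompact (tsupport ψ ∪ tsupport ρ) := hψc.isCompact.union hBc.isCompact
    have hKne : (tsupport ψ ∪ tsupport ρ).Nonempty := by
      refine ⟨x₀, Or.inr ?_⟩
      rw [hρ, B.tsupport_normed_eq]
      exact Metric.mem_closedBall_self B.rOut_pos.le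
    obtain ⟨a, ha, ha'⟩ := hK.exists_isMinOn hKne continuousOn_id
    obtain ⟨b, hb, hb'⟩ := hK.exists_isMaxOn hKne continuousOn_id
    have hKU : tsupport ψ ∪ tsupport ρ ⊆ U := union_subset hψU hBs
    -- The primitive need not vanish between the two supports, so their whole hull has to lie in U.
    -- This is where U being an interval enters.
    have habU : Icc a b ⊆ U := hc.out (hKU ha) (hKU hb)
    have hab : a ≤ b := ha' hb
    have hχ0 : ∀ x, x ∉ Icc a b → χ x = 0 := by
      intro x hx
      have hx' : x ∉ tsupport ψ ∪ tsupport ρ := fun h ↦ hx ⟨ha' h, hb' h⟩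
      simp only [mem_union, not_or] at hx'
      simp [χ, image_eq_zero_of_notMem_tsupport hx'.1, image_eq_zero_of_notMem_tsupport hx'.2]
    have hψi : Integrable ψ := hψ.continuous.integrable_of_hasCompactSupport hψc
    have hρi : Integrable ρ := hBsm.continuous.integrable_of_hasCompactSupport hBc
    have hχint : ∫ x, χ x = 0 := by
      simp only [χ]
      rw [integral_sub hψi (hρi.const_mul c), integral_const_mul,
        show ∫ x, ρ x = 1 from B.integral_normed, mul_one, ← hc', sub_self]
    let φ : ℝ → ℝ := fun x ↦ ∫ t in a..x, χ t
    have hφd : ∀ x, HasDerivAt φ (χ x) x := fun x ↦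
      intervalIntegral.integral_hasDerivAt_right (hχ.continuous.intervalIntegrable _ _)
        hχ.continuous.stronglyMeasurable.stronglyMeasurableAtFilter hχ.continuous.continuousAt
    have hφ' : deriv φ = χ := funext fun x ↦ (hφd x).deriv
    have hφs : ContDiff ℝ ∞ φ := by
      rw [contDiff_infty_iff_deriv]
      exact ⟨fun x ↦ (hφd x).differentiableAt, hφ' ▸ hχ⟩
    have hφ0 : ∀ x, x ∉ Icc a b → φ x = 0 := by
      intro x hx
      rcases lt_or_ge x a with hxa | hxa
      · simp only [φ]
        rw [intervalIntegral.integral_symm, intervalIntegral.integral_of_le hxa.le,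
          integral_Ioc_eq_integral_Ioo, setIntegral_eq_zero_of_forall_eq_zero, neg_zero]
        intro t ht
        exact hχ0 t fun h ↦ absurd h.1 (not_le.2 ht.2)
      · have hxb : b < x := by
          by_contra hcon
          exact hx ⟨hxa, not_lt.1 hcon⟩
        simp only [φ]
        rw [intervalIntegral_eq_integral_of_support hxa, hχint]
        intro t ht
        exact hχ0 t fun h ↦ ht ⟨h.1, h.2.trans hxb.le⟩
    have hts : tsupport φ ⊆ Icc a b := by
      refine closure_minimal ?_ isClosed_Icc
      intro x hx
      by_contra hcon
      exact hx (hφ0 x hcon)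
    have hφc : HasCompactSupport φ := HasCompactSupport.of_support_subset_isCompact isCompact_Icc
      ((subset_tsupport φ).trans hts)
    have h0 := h φ hφs hφc (hts.trans habU)
    rw [hφ'] at h0
    have e1 : ∀ x, w x * χ x = w x * ψ x - c * (w x * ρ x) := fun x ↦ by simp only [χ]; ring
    simp_rw [e1] at h0
    rw [integral_sub (hw.integrable_mul_of_tsupport_subset hψ.continuous hψc hψU) ((hw.integrable_mul_of_tsupport_subset hBsm.continuous hBc hBs).const_mul c), integral_const_mul,
      ← hC] at h0
    have e2 : ∀ x, ψ x • (w x - C) = w x * ψ x - C * ψ x := fun x ↦ by simp only [smul_eq_mul]; ring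
    simp_rw [e2]
    rw [integral_sub (hw.integrable_mul_of_tsupport_subset hψ.continuous hψc hψU) (hψi.const_mul C), integral_const_mul, ← hc']
    linarith
  filter_upwards [hz] with x hx hxU
  linarith [hx hxU]

/-! ### Weak derivatives on the edges -/

/-- The intervals that occur as edges: `[0, ∞)` and `[0, a]` with `a > 0`. -/
def IsEdgeInterval (I : Set ℝ) : Prop := I = Ici 0 ∨ ∃ a, 0 < a ∧ I = Icc 0 a

namespace IsEdgeInterval

variable {I : Set ℝ}

theorem isClosed (hI : IsEdgeInterval I) : IsClosed I := by
  rcases hI with rfl | ⟨a, -, rfl⟩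
  exacts [isClosed_Ici, isClosed_Icc]

theorem measurableSet (hI : IsEdgeInterval I) : MeasurableSet I := hI.isClosed.measurableSet

theorem zero_mem (hI : IsEdgeInterval I) : (0 : ℝ) ∈ I := by
  rcases hI with rfl | ⟨a, h, rfl⟩
  exacts [self_mem_Ici, left_mem_Icc.2 h.le]

theorem nonneg (hI : IsEdgeInterval I) {x : ℝ} (hx : x ∈ I) : 0 ≤ x := by
  rcases hI with rfl | ⟨a, h, rfl⟩
  exacts [hx, hx.1]

theorem Icc_subset (hI : IsEdgeInterval I) {x : ℝ} (hx : x ∈ I) : Icc 0 x ⊆ I := by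
  rcases hI with rfl | ⟨a, h, rfl⟩
  exacts [Icc_subset_Ici_self, Icc_subset_Icc_right hx.2]

theorem ordConnected_interior (hI : IsEdgeInterval I) : (interior I).OrdConnected := by
  rcases hI with rfl | ⟨a, h, rfl⟩
  · rw [interior_Ici]; exact ordConnected_Ioi
  · rw [interior_Icc]; exact ordConnected_Ioo

theorem interior_nonempty (hI : IsEdgeInterval I) : (interior I).Nonempty := by
  rcases hI with rfl | ⟨a, h, rfl⟩
  · rw [interior_Ici]; exact nonempty_Ioi
  · rw [interior_Icc]; exact nonempty_Ioo.2 h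

theorem subset_closure_interior (hI : IsEdgeInterval I) : I ⊆ closure (interior I) := by
  rcases hI with rfl | ⟨a, h, rfl⟩
  · rw [interior_Ici, closure_Ioi]
  · rw [interior_Icc, closure_Ioo h.ne]

theorem restrict_interior (hI : IsEdgeInterval I) :
    (volume : Measure ℝ).restrict (interior I) = volume.restrict I := by
  rcases hI with rfl | ⟨a, h, rfl⟩
  · rw [interior_Ici]; exact Measure.restrict_congr_set Ioi_ae_eq_Ici
  · rw [interior_Icc]; exact Measure.restrict_congr_set Ioo_ae_eq_Icc

theorem exists_continuous_eqOn (hI : IsEdgeInterval I) {f : ℝ → ℝ} (hf : ContinuousOn f I) :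
    ∃ F : ℝ → ℝ, Continuous F ∧ EqOn F f I := by
  rcases hI with rfl | ⟨a, h, rfl⟩
  · refine ⟨fun x ↦ f (max 0 x), ?_, fun x hx ↦ by simp only [max_eq_right (mem_Ici.1 hx)]⟩
    exact hf.comp_continuous (by fun_prop) fun x ↦ mem_Ici.2 (le_max_left _ _)
  · exact ⟨IccExtend h.le (fun x : Icc (0 : ℝ) a ↦ f x),
      (continuousOn_iff_continuous_domRestrict.1 hf).Icc_extend', fun x hx ↦ IccExtend_of_mem _ _ hx⟩

end IsEdgeInterval

theorem setIntegral_mul_test {I : Set ℝ} {u φ : ℝ → ℝ} (hφ : tsupport φ ⊆ interior I) :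
    ∫ x in I, u x * φ x = ∫ x, u x * φ x :=
  setIntegral_eq_integral_of_forall_compl_eq_zero fun x hx ↦ by
    rw [image_eq_zero_of_notMem_tsupport fun h ↦ hx (interior_subset (hφ h)), mul_zero]

theorem HasWeakDerivOn.ae_eq {I : Set ℝ} {u g g' : ℝ → ℝ} (hI : IsEdgeInterval I)
    (h : HasWeakDerivOn u g I) (h' : HasWeakDerivOn u g' I) : g =ᵐ[volume.restrict I] g' := by
  have hz : ∀ᵐ x, x ∈ interior I → g x - g' x = 0 := by
    refine isOpen_interior.ae_eq_zero_of_integral_contDiff_smul_eq_zero (h.2.1.sub h'.2.1) ?_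
    intro φ hφ hc hs
    have e := (h.2.2 φ hφ hc hs).symm.trans (h'.2.2 φ hφ hc hs)
    rw [setIntegral_mul_test hs, setIntegral_mul_test hs] at e
    have e2 : ∀ x, φ x • (g x - g' x) = g x * φ x - g' x * φ x := fun x ↦ by
      simp only [smul_eq_mul]; ring
    simp_rw [e2]
    rw [integral_sub (h.2.1.integrable_mul_of_tsupport_subset hφ.continuous hc hs)
      (h'.2.1.integrable_mul_of_tsupport_subset hφ.continuous hc hs)]
    linarith
  rw [← hI.restrict_interior]
  filter_upwards [(ae_restrict_iff' isOpen_interior.measurableSet).2 hz] with x hx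
  linarith

theorem MeasureTheory.LocallyIntegrableOn.congr_ae_restrict {I : Set ℝ} {u v : ℝ → ℝ}
    (hu : LocallyIntegrableOn u (interior I)) (h : u =ᵐ[volume.restrict I] v) :
    LocallyIntegrableOn v (interior I) := by
  intro x hx
  obtain ⟨s, hs, hi⟩ := hu x hx
  refine ⟨s ∩ interior I, inter_mem hs self_mem_nhdsWithin, ?_⟩
  exact (hi.mono_set inter_subset_left).congr
    (ae_restrict_of_ae_restrict_of_subset (inter_subset_right.trans interior_subset) h)

theorem HasWeakDerivOn.congr {I : Set ℝ} {u g u' g' : ℝ → ℝ}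
    (h : HasWeakDerivOn u g I) (hu : u =ᵐ[volume.restrict I] u')
    (hg : g =ᵐ[volume.restrict I] g') : HasWeakDerivOn u' g' I := by
  refine ⟨h.1.congr_ae_restrict hu, h.2.1.congr_ae_restrict hg, fun φ hφ hc hs ↦ ?_⟩
  have h1 : ∫ x in I, u x * deriv φ x = ∫ x in I, u' x * deriv φ x :=
    integral_congr_ae (hu.mono fun x hx ↦ by beta_reduce; rw [hx])
  have h2 : ∫ x in I, g x * φ x = ∫ x in I, g' x * φ x :=
    integral_congr_ae (hg.mono fun x hx ↦ by beta_reduce; rw [hx])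
  rw [← h1, ← h2]
  exact h.2.2 φ hφ hc hs

theorem HasWeakDerivOn.congr_eqOn {I : Set ℝ} (hI : IsEdgeInterval I) {u g u' g' : ℝ → ℝ}
    (h : HasWeakDerivOn u g I) (hu : EqOn u u' I) (hg : EqOn g g' I) : HasWeakDerivOn u' g' I :=
  h.congr (ae_restrict_of_forall_mem hI.measurableSet hu)
    (ae_restrict_of_forall_mem hI.measurableSet hg)

/-- A primitive of a locally integrable function has it as weak derivative. -/
theorem hasWeakDerivOn_of_primitive {f g : ℝ → ℝ} {I : Set ℝ} (hg : LocallyIntegrable g)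
    (hf : ∀ x, f x = f 0 + ∫ t in (0 : ℝ)..x, g t) : HasWeakDerivOn f g I := by
  have hfc : Continuous f := by
    rw [show f = fun x ↦ f 0 + ∫ t in (0 : ℝ)..x, g t from funext hf]
    exact continuous_const.add (intervalIntegral.continuous_primitive
      (fun a b ↦ (hg.integrableOn_isCompact isCompact_uIcc).intervalIntegrable) 0)
  refine ⟨hfc.locallyIntegrable.locallyIntegrableOn _, hg.locallyIntegrableOn _, ?_⟩
  intro φ hφ hc hs
  rw [setIntegral_mul_test ((tsupport_deriv_subset).trans hs), setIntegral_mul_test hs]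
  exact integral_primitive_mul_deriv hg hf hφ hc

theorem eq_add_integral_of_hasDerivAt_univ {f g : ℝ → ℝ} (hf : ∀ x, HasDerivAt f (g x) x)
    (hg : Continuous g) (x : ℝ) : f x = f 0 + ∫ t in (0 : ℝ)..x, g t := by
  rw [intervalIntegral.integral_eq_sub_of_hasDerivAt (fun t _ ↦ hf t) (hg.intervalIntegrable _ _)]
  ring

theorem hasWeakDerivOn_of_hasDerivAt {f g : ℝ → ℝ} {I : Set ℝ} (hf : ∀ x, HasDerivAt f (g x) x)
    (hg : Continuous g) : HasWeakDerivOn f g I :=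
  hasWeakDerivOn_of_primitive hg.locallyIntegrable (eq_add_integral_of_hasDerivAt_univ hf hg)

theorem hasWeakDerivOn_zero {I : Set ℝ} : HasWeakDerivOn 0 0 I :=
  hasWeakDerivOn_of_hasDerivAt (fun x ↦ hasDerivAt_const x 0) continuous_const

/-- A function with a weak derivative is a primitive of it, almost everywhere. -/
theorem HasWeakDerivOn.exists_ae_eq_primitive {I : Set ℝ} (hI : IsEdgeInterval I) {u g : ℝ → ℝ}
    (h : HasWeakDerivOn u g I) (hg : LocallyIntegrable g) :
    ∃ C, u =ᵐ[volume.restrict I] fun x ↦ C + ∫ t in (0 : ℝ)..x, g t := by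
  let V : ℝ → ℝ := fun x ↦ ∫ t in (0 : ℝ)..x, g t
  have hV : ∀ x, V x = V 0 + ∫ t in (0 : ℝ)..x, g t := fun x ↦ by simp [V]
  have hVw : HasWeakDerivOn V g I := hasWeakDerivOn_of_primitive hg hV
  obtain ⟨C, hC⟩ := exists_ae_eq_const_of_integral_mul_deriv_eq_zero isOpen_interior
    hI.ordConnected_interior hI.interior_nonempty (h.1.sub hVw.1) (fun φ hφ hc hs ↦ by
      have e := (h.2.2 φ hφ hc hs).trans (hVw.2.2 φ hφ hc hs).symm
      have hs' : tsupport (deriv φ) ⊆ interior I := tsupport_deriv_subset.trans hs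
      have hd : Continuous (deriv φ) := hφ.continuous_deriv (by simp)
      rw [setIntegral_mul_test hs', setIntegral_mul_test hs'] at e
      simp_rw [Pi.sub_apply, sub_mul]
      rw [integral_sub (h.1.integrable_mul_of_tsupport_subset hd hc.deriv hs')
        (hVw.1.integrable_mul_of_tsupport_subset hd hc.deriv hs'), e, sub_self])
  refine ⟨C, ?_⟩
  rw [← hI.restrict_interior]
  filter_upwards [(ae_restrict_iff' isOpen_interior.measurableSet).2 hC] with x hx
  simp only [Pi.sub_apply, V] at hx
  linarith

theorem HasWeakDerivOn.exists_eqOn_primitive {I : Set ℝ} (hI : IsEdgeInterval I) {u g : ℝ → ℝ}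
    (h : HasWeakDerivOn u g I) (hg : LocallyIntegrable g) (hu : ContinuousOn u I) :
    ∀ x ∈ I, u x = u 0 + ∫ t in (0 : ℝ)..x, g t := by
  obtain ⟨C, hC⟩ := h.exists_ae_eq_primitive hI hg
  have hc : Continuous fun x ↦ C + ∫ t in (0 : ℝ)..x, g t :=
    continuous_const.add (intervalIntegral.continuous_primitive
      (fun a b ↦ (hg.integrableOn_isCompact isCompact_uIcc).intervalIntegrable) 0)
  have he : EqOn u (fun x ↦ C + ∫ t in (0 : ℝ)..x, g t) I :=
    Measure.eqOn_of_ae_eq hC hu hc.continuousOn hI.subset_closure_interior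
  intro x hx
  have h0 := he hI.zero_mem
  simp only [intervalIntegral.integral_same, add_zero] at h0
  rw [he hx, h0]

/-- Weak derivatives are controlled only on I. Extension by zero makes them locally integrable on
the line, so that their primitives are defined everywhere. -/
theorem locallyIntegrable_indicator_of_memLp {I : Set ℝ} (hI : IsEdgeInterval I) {g : ℝ → ℝ}
    (hg : MemLp g 2 (volume.restrict I)) : LocallyIntegrable (I.indicator g) :=
  ((memLp_indicator_iff_restrict hI.measurableSet).2 hg).locallyIntegrable (by norm_num)

theorem intervalIntegral_indicator_eq {I : Set ℝ} (hI : IsEdgeInterval I) {g : ℝ → ℝ} {x : ℝ}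
    (hx : x ∈ I) : ∫ t in (0 : ℝ)..x, I.indicator g t = ∫ t in (0 : ℝ)..x, g t := by
  refine intervalIntegral.integral_congr fun t ht ↦ ?_
  rw [uIcc_of_le (hI.nonneg hx)] at ht
  exact indicator_of_mem (hI.Icc_subset hx ht) g

/-- Continuous `H¹` functions are primitives of their weak derivatives. -/
theorem HasWeakDerivOn.eq_add_integral {I : Set ℝ} (hI : IsEdgeInterval I) {u g : ℝ → ℝ}
    (h : HasWeakDerivOn u g I) (hg : MemLp g 2 (volume.restrict I)) (hu : ContinuousOn u I) :
    ∀ x ∈ I, u x = u 0 + ∫ t in (0 : ℝ)..x, g t := by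
  intro x hx
  rw [← intervalIntegral_indicator_eq hI hx]
  exact (h.congr_eqOn hI (fun _ _ ↦ rfl) (fun t ht ↦ (indicator_of_mem ht g).symm)).exists_eqOn_primitive
    hI (locallyIntegrable_indicator_of_memLp hI hg) hu x hx

theorem intervalIntegrable_of_memLp {I : Set ℝ} (hI : IsEdgeInterval I) {g : ℝ → ℝ}
    (hg : MemLp g 2 (volume.restrict I)) {x : ℝ} (hx : x ∈ I) :
    IntervalIntegrable g volume 0 x := by
  have h := ((locallyIntegrable_indicator_of_memLp hI hg).integrableOn_isCompact
    (isCompact_uIcc (a := 0) (b := x))).intervalIntegrable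
  refine h.congr fun t ht ↦ ?_
  rw [uIoc_of_le (hI.nonneg hx)] at ht
  exact indicator_of_mem (hI.Icc_subset hx ⟨ht.1.le, ht.2⟩) g

/-! ### Flux identities on one edge -/

section flux

variable {I : Set ℝ} {G W η k : ℝ → ℝ}

theorem intervalIntegral_flux (hI : IsEdgeInterval I) (hG : ∀ x ∈ I, HasDerivAt G (W x) x)
    (hW : ContinuousOn W I) (hη : ContinuousOn η I) (hk : HasWeakDerivOn η k I)
    (hk2 : MemLp k 2 (volume.restrict I)) {x : ℝ} (hx : x ∈ I) :
    ∫ t in (0 : ℝ)..x, (G t * k t + W t * η t) = G x * η x - G 0 * η 0 := by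
  have hs := hI.Icc_subset hx
  rw [← integral_mul_add_mul_of_primitive (hI.nonneg hx) (f := W) (g := k) ?_
    (intervalIntegrable_of_memLp hI hk2 hx)
    (eq_add_integral_of_hasDerivAt (fun t ht ↦ hG t (hs ht)) (hW.mono hs))
    (fun t ht ↦ hk.eq_add_integral hI hk2 hη t (hs ht))]
  · exact intervalIntegral.integral_congr fun t _ ↦ add_comm _ _
  · exact ContinuousOn.intervalIntegrable (by rw [uIcc_of_le (hI.nonneg hx)]; exact hW.mono hs)

theorem setIntegral_Icc_flux {a : ℝ} (ha : 0 < a) (hG : ∀ x ∈ Icc 0 a, HasDerivAt G (W x) x)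
    (hW : ContinuousOn W (Icc 0 a)) (hη : ContinuousOn η (Icc 0 a))
    (hk : HasWeakDerivOn η k (Icc 0 a)) (hk2 : MemLp k 2 (volume.restrict (Icc 0 a))) :
    ∫ t in Icc 0 a, (G t * k t + W t * η t) = G a * η a - G 0 * η 0 := by
  rw [integral_Icc_eq_integral_Ioc, ← intervalIntegral.integral_of_le ha.le]
  exact intervalIntegral_flux (Or.inr ⟨a, ha, rfl⟩) hG hW hη hk hk2 (right_mem_Icc.2 ha.le)

/-- There is no boundary term at infinity: the product G η is integrable and, by the identity on [0,
x], has a limit, which can then only be zero. -/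
theorem setIntegral_Ici_flux (hG : ∀ x ∈ Ici 0, HasDerivAt G (W x) x)
    (hW : ContinuousOn W (Ici 0)) (hη : ContinuousOn η (Ici 0))
    (hk : HasWeakDerivOn η k (Ici 0)) (hk2 : MemLp k 2 (volume.restrict (Ici 0)))
    (hG2 : MemLp G 2 (volume.restrict (Ici 0))) (hW2 : MemLp W 2 (volume.restrict (Ici 0)))
    (hη2 : MemLp η 2 (volume.restrict (Ici 0))) :
    ∫ t in Ici 0, (G t * k t + W t * η t) = - (G 0 * η 0) := by
  have hint : IntegrableOn (fun t ↦ G t * k t + W t * η t) (Ici 0) :=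
    (hG2.integrable_mul hk2).add (hW2.integrable_mul hη2)
  have hGη : IntegrableOn (fun t ↦ G t * η t) (Ici 0) := hG2.integrable_mul hη2
  have hlim : Tendsto (fun x ↦ ∫ t in (0 : ℝ)..x, (G t * k t + W t * η t)) atTop
      (𝓝 (∫ t in Ici 0, (G t * k t + W t * η t))) := by
    rw [integral_Ici_eq_integral_Ioi]
    exact intervalIntegral_tendsto_integral_Ioi 0 (hint.mono_set Ioi_subset_Ici_self) tendsto_id
  have hlim2 : Tendsto (fun x ↦ G x * η x) atTop
      (𝓝 ((∫ t in Ici 0, (G t * k t + W t * η t)) + G 0 * η 0)) := by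
    refine (hlim.add_const (G 0 * η 0)).congr' ?_
    filter_upwards [eventually_ge_atTop 0] with x hx
    rw [intervalIntegral_flux (Or.inl rfl) hG hW hη hk hk2 hx]
    ring
  have h0 := IntegrableAtFilter.eq_zero_of_tendsto (μ := volume) ⟨Ici 0, Ici_mem_atTop 0, hGη⟩
    (fun s hs ↦ by
      obtain ⟨b, hb⟩ := mem_atTop_sets.1 hs
      exact measure_mono_top (fun x hx ↦ hb x hx) (Real.volume_Ici (a := b))) hlim2
  linarith

end flux

theorem weakDeriv_ae_eq {I : Set ℝ} (hI : IsEdgeInterval I) {u g : ℝ → ℝ}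
    (h : HasWeakDerivOn u g I) : weakDeriv u I =ᵐ[volume.restrict I] g := by
  have hex : ∃ g : ℝ → ℝ, HasWeakDerivOn u g I := ⟨g, h⟩
  rw [weakDeriv, dif_pos hex]
  exact (Classical.choose_spec hex).ae_eq hI h

theorem memH1On_of_hasDerivAt {I : Set ℝ} {f g : ℝ → ℝ} (hf : ∀ x, HasDerivAt f (g x) x)
    (hg : Continuous g) (hf2 : MemLp f 2 (volume.restrict I))
    (hg2 : MemLp g 2 (volume.restrict I)) : MemH1On f I :=
  ⟨hf2, g, hasWeakDerivOn_of_hasDerivAt hf hg, hg2⟩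

theorem memH1On_zero {I : Set ℝ} : MemH1On 0 I :=
  memH1On_of_hasDerivAt (g := 0) (fun x ↦ hasDerivAt_const x 0) continuous_const
    MemLp.zero MemLp.zero

theorem memLp_two_Icc_of_continuous {f : ℝ → ℝ} (hf : Continuous f) (a b : ℝ) :
    MemLp f 2 (volume.restrict (Icc a b)) :=
  (memLp_two_iff_integrable_sq hf.aestronglyMeasurable).2
    (hf.pow 2).continuousOn.integrableOn_Icc

theorem memLp_exp_neg_Ici : MemLp (fun x : ℝ ↦ Real.exp (-x)) 2 (volume.restrict (Ici 0)) := by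
  rw [memLp_two_iff_integrable_sq (by fun_prop)]
  have := (integrableOn_Ici_iff_integrableOn_Ioi (μ := volume)).2
    (exp_neg_integrableOn_Ioi 0 (b := 2) (by norm_num))
  refine this.congr (Eventually.of_forall fun x ↦ ?_)
  beta_reduce
  rw [← Real.exp_nat_mul]
  congr 1
  push_cast
  ring

/-! ### The stationary equation on one edge -/

/-- The restoring term `x - |x|^(p-2) x` of the stationary equation `u'' = u - |u|^(p-2) u`. -/
noncomputable def nlsForce (p x : ℝ) : ℝ := x - |x| ^ (p - 2) * x

theorem continuous_nlsForce {p : ℝ} (hp : 2 < p) : Continuous (nlsForce p) := by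
  unfold nlsForce
  exact continuous_id.sub ((continuous_abs.rpow_const fun x ↦ Or.inr (by linarith)).mul
    continuous_id)

theorem abs_nlsForce_le {p x M : ℝ} (hp : 2 < p) (hx : |x| ≤ M) :
    |nlsForce p x| ≤ (1 + M ^ (p - 2)) * |x| := by
  have h1 : |x| ^ (p - 2) ≤ M ^ (p - 2) :=
    Real.rpow_le_rpow (abs_nonneg x) hx (by linarith)
  have h0 : 0 ≤ |x| ^ (p - 2) := Real.rpow_nonneg (abs_nonneg x) _
  unfold nlsForce
  calc |x - |x| ^ (p - 2) * x| ≤ |x| + |(|x| ^ (p - 2) * x)| := abs_sub _ _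
    _ = |x| + |x| ^ (p - 2) * |x| := by rw [abs_mul, abs_of_nonneg h0]
    _ ≤ (1 + M ^ (p - 2)) * |x| := by nlinarith [abs_nonneg x]

theorem abs_rpow_sub_two_mul_sq {p x : ℝ} (hp : 2 < p) : |x| ^ (p - 2) * x * x = |x| ^ p := by
  rcases eq_or_ne x 0 with rfl | hx
  · simp [Real.zero_rpow (by linarith : p ≠ 0)]
  · rw [mul_assoc, ← pow_two, ← sq_abs, ← Real.rpow_natCast |x| 2, ← Real.rpow_add (abs_pos.2 hx)]
    norm_num

/-- `U` solves `U'' = U - |U|^(p-2) U` on `I`, with derivative `g`; both are extended beyond `I`. -/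
structure IsNLSSolution (p : ℝ) (I : Set ℝ) (U g : ℝ → ℝ) : Prop where
  hasDerivAt : ∀ x, HasDerivAt U (g x) x
  continuous_deriv : Continuous g
  hasDerivAt_deriv : ∀ x ∈ I, HasDerivAt g (nlsForce p (U x)) x

namespace IsNLSSolution

variable {p : ℝ} {I : Set ℝ} {U g : ℝ → ℝ}

theorem continuous (h : IsNLSSolution p I U g) : Continuous U :=
  continuous_iff_continuousAt.2 fun x ↦ (h.hasDerivAt x).continuousAt

/-- The function U² is a primitive of 2 U U', and 2 |U U'| ≤ U'² + U². One value of U and the norm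
thus control U on the whole edge. -/
theorem sq_le (hI : IsEdgeInterval I) (h : IsNLSSolution p I U g)
    (hU : MemLp U 2 (volume.restrict I)) (hg : MemLp g 2 (volume.restrict I)) {x y : ℝ}
    (hx : x ∈ I) (hy : y ∈ I) : U x ^ 2 ≤ U y ^ 2 + ∫ t in I, (g t ^ 2 + U t ^ 2) := by
  have hint : IntegrableOn (fun t ↦ g t ^ 2 + U t ^ 2) I := hg.integrable_sq.add hU.integrable_sq
  have hsub : Ι y x ⊆ I := by
    intro t ht
    rcases le_total y x with hyx | hyx
    · rw [uIoc_of_le hyx] at ht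
      exact hI.Icc_subset hx ⟨(hI.nonneg hy).trans ht.1.le, ht.2⟩
    · rw [uIoc_of_ge hyx] at ht
      exact hI.Icc_subset hy ⟨(hI.nonneg hx).trans ht.1.le, ht.2⟩
  have e : ∫ t in y..x, 2 * U t * g t = U x ^ 2 - U y ^ 2 := by
    refine intervalIntegral.integral_eq_sub_of_hasDerivAt (f := fun t ↦ U t ^ 2) (fun t _ ↦ ?_)
      (Continuous.intervalIntegrable
        ((continuous_const.mul h.continuous).mul h.continuous_deriv) _ _)
    exact ((h.hasDerivAt t).pow 2).congr_deriv (by simp)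
  have h1 : ‖∫ t in y..x, 2 * U t * g t‖ ≤ ∫ t in I, (g t ^ 2 + U t ^ 2) := by
    refine intervalIntegral.norm_integral_le_integral_norm_uIoc.trans ?_
    refine (setIntegral_mono_on (g := fun t ↦ g t ^ 2 + U t ^ 2) ?_ (hint.mono_set hsub)
      measurableSet_uIoc fun t _ ↦ ?_).trans
      (setIntegral_mono_set hint (Eventually.of_forall fun t ↦ by positivity)
        (Eventually.of_forall hsub))
    · exact (((continuous_const.mul h.continuous).mul h.continuous_deriv).norm.integrableOn_uIcc
        (a := y) (b := x)).mono_set uIoc_subset_uIcc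
    · rw [Real.norm_eq_abs, abs_le]
      constructor <;> nlinarith [sq_nonneg (U t - g t), sq_nonneg (U t + g t)]
  rw [e] at h1
  linarith [le_abs_self (U x ^ 2 - U y ^ 2), Real.norm_eq_abs (U x ^ 2 - U y ^ 2)]

theorem exists_abs_le (hI : IsEdgeInterval I) (h : IsNLSSolution p I U g)
    (hU : MemLp U 2 (volume.restrict I)) (hg : MemLp g 2 (volume.restrict I)) :
    ∃ M, ∀ x ∈ I, |U x| ≤ M :=
  ⟨√(U 0 ^ 2 + ∫ t in I, (g t ^ 2 + U t ^ 2)), fun _ hx ↦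
    Real.abs_le_sqrt (h.sq_le hI hU hg hx hI.zero_mem)⟩

theorem memLp_nlsForce (hp : 2 < p) (hI : IsEdgeInterval I) (h : IsNLSSolution p I U g)
    (hU : MemLp U 2 (volume.restrict I)) (hg : MemLp g 2 (volume.restrict I)) :
    MemLp (fun x ↦ nlsForce p (U x)) 2 (volume.restrict I) := by
  obtain ⟨M, hM⟩ := h.exists_abs_le hI hU hg
  refine hU.of_le_mul (c := 1 + M ^ (p - 2))
    ((continuous_nlsForce hp).comp h.continuous).aestronglyMeasurable ?_
  exact ae_restrict_of_forall_mem hI.measurableSet fun x hx ↦ abs_nlsForce_le hp (hM x hx)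

end IsNLSSolution

/-! ### Bound states as classical solutions on the graph -/

namespace SingleKnotGraph

variable {G : SingleKnotGraph} {p : ℝ}

theorem isEdgeInterval (G : SingleKnotGraph) (e : G.Edge) : IsEdgeInterval (G.interval e) := by
  rcases e with i | i | j
  · exact Or.inl rfl
  · exact Or.inr ⟨_, G.pendantLength_pos i, rfl⟩
  · exact Or.inr ⟨_, G.loopLength_pos j, rfl⟩

theorem IsBoundState.sum_integral_eq_zero {u : G.Edge → ℝ → ℝ} (hu : G.IsBoundState p u)
    {g : G.Edge → ℝ → ℝ} (hg : ∀ e, HasWeakDerivOn (u e) (g e) (G.interval e))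
    {η k : G.Edge → ℝ → ℝ} (hη : G.MemH1 η)
    (hk : ∀ e, HasWeakDerivOn (η e) (k e) (G.interval e)) :
    ∑ e, ∫ x in G.interval e, (g e x * k e x + nlsForce p (u e x) * η e x) = 0 := by
  rw [← hu.2.2 η hη]
  refine Finset.sum_congr rfl fun e _ ↦ integral_congr_ae ?_
  filter_upwards [weakDeriv_ae_eq (G.isEdgeInterval e) (hg e),
    weakDeriv_ae_eq (G.isEdgeInterval e) (hk e)] with x h1 h2
  rw [h1, h2, nlsForce]
  ring

theorem memH1_update {e : G.Edge} {η : ℝ → ℝ} (hη : MemH1On η (G.interval e))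
    (hc : ContinuousOn η (G.interval e)) (h0 : η 0 = 0)
    (hl : ∀ j, e = .inr (.inr j) → η (G.loopLength j) = 0) :
    G.MemH1 (Function.update 0 e η) := by
  have h0' : ∀ e', (Function.update (0 : G.Edge → ℝ → ℝ) e η) e' 0 = 0 := by
    intro e'
    rcases eq_or_ne e' e with rfl | hne
    · simp [h0]
    · simp [Function.update_of_ne hne]
  refine ⟨⟨fun e' ↦ ?_, fun e' e'' ↦ (h0' e').trans (h0' e'').symm, fun j ↦ ?_⟩, fun e' ↦ ?_⟩
  · rcases eq_or_ne e' e with rfl | hne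
    · simpa using hc
    · rw [Function.update_of_ne hne]
      exact continuousOn_const
  · rw [h0']
    rcases eq_or_ne (.inr (.inr j) : G.Edge) e with h | hne
    · subst h; simpa using hl j rfl
    · simp [Function.update_of_ne hne]
  · rcases eq_or_ne e' e with rfl | hne
    · simpa using hη
    · simpa [Function.update_of_ne hne] using memH1On_zero

theorem IsBoundState.integral_eq_zero_of_single {u : G.Edge → ℝ → ℝ} (hu : G.IsBoundState p u)
    {g : G.Edge → ℝ → ℝ} (hg : ∀ e, HasWeakDerivOn (u e) (g e) (G.interval e)) {e : G.Edge}
    {η k : ℝ → ℝ} (hη : MemH1On η (G.interval e))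
    (hk : HasWeakDerivOn η k (G.interval e))
    (hc : ContinuousOn η (G.interval e)) (h0 : η 0 = 0)
    (hl : ∀ j, e = .inr (.inr j) → η (G.loopLength j) = 0) :
    ∫ x in G.interval e, (g e x * k x + nlsForce p (u e x) * η x) = 0 := by
  have h := hu.sum_integral_eq_zero hg (k := Function.update 0 e k) (memH1_update hη hc h0 hl) ?_
  · rw [Finset.sum_eq_single e] at h
    · simpa using h
    · intro e' _ hne
      simp [Function.update_of_ne hne]
    · simp
  · intro e'
    rcases eq_or_ne e' e with rfl | hne
    · simpa using hk
    · simpa [Function.update_of_ne hne] using hasWeakDerivOn_zero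

/-- The classical form of the stationary equation on a graph: a solution `U` with derivative `g` on
each edge, continuity and the Kirchhoff condition at the knot, the Neumann condition at the tips. -/
structure IsStationary (G : SingleKnotGraph) (p : ℝ) (U g : G.Edge → ℝ → ℝ) : Prop where
  sol : ∀ e, IsNLSSolution p (G.interval e) (U e) (g e)
  memLp : ∀ e, MemLp (U e) 2 (volume.restrict (G.interval e))
  memLp_deriv : ∀ e, MemLp (g e) 2 (volume.restrict (G.interval e))
  knot : ∀ e e', U e 0 = U e' 0
  loop : ∀ j, U (.inr (.inr j)) (G.loopLength j) = U (.inr (.inr j)) 0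
  neumann : ∀ i, g (.inr (.inl i)) (G.pendantLength i) = 0
  kirchhoff : ∑ i, g (.inl i) 0 + (∑ i, g (.inr (.inl i)) 0 +
    ∑ j, (g (.inr (.inr j)) 0 - g (.inr (.inr j)) (G.loopLength j))) = 0

/-- The squared `H¹` norm. -/
noncomputable def normSq (G : SingleKnotGraph) (U g : G.Edge → ℝ → ℝ) : ℝ :=
  ∑ e, ∫ x in G.interval e, (g e x ^ 2 + U e x ^ 2)

theorem IsStationary.memH1 {U g : G.Edge → ℝ → ℝ} (h : G.IsStationary p U g) : G.MemH1 U :=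
  ⟨⟨fun e ↦ (h.sol e).continuous.continuousOn, h.knot, h.loop⟩, fun e ↦
    memH1On_of_hasDerivAt (h.sol e).hasDerivAt (h.sol e).continuous_deriv (h.memLp e)
      (h.memLp_deriv e)⟩

theorem IsStationary.hasWeakDerivOn {U g : G.Edge → ℝ → ℝ} (h : G.IsStationary p U g) (e : G.Edge) :
    HasWeakDerivOn (U e) (g e) (G.interval e) :=
  hasWeakDerivOn_of_hasDerivAt (h.sol e).hasDerivAt (h.sol e).continuous_deriv

/-- The sum of the fluxes of a solution against a test function. -/
theorem sum_flux (hp : 2 < p) {U g : G.Edge → ℝ → ℝ}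
    (sol : ∀ e, IsNLSSolution p (G.interval e) (U e) (g e))
    (memLp : ∀ e, MemLp (U e) 2 (volume.restrict (G.interval e)))
    (memLp_deriv : ∀ e, MemLp (g e) 2 (volume.restrict (G.interval e)))
    {η k : G.Edge → ℝ → ℝ} (hc : ∀ e, ContinuousOn (η e) (G.interval e))
    (hη2 : ∀ e, MemLp (η e) 2 (volume.restrict (G.interval e)))
    (hk : ∀ e, HasWeakDerivOn (η e) (k e) (G.interval e))
    (hk2 : ∀ e, MemLp (k e) 2 (volume.restrict (G.interval e))) :
    ∑ e, ∫ x in G.interval e, (g e x * k e x + nlsForce p (U e x) * η e x) =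
      ∑ i, -(g (.inl i) 0 * η (.inl i) 0) +
        (∑ i, (g (.inr (.inl i)) (G.pendantLength i) * η (.inr (.inl i)) (G.pendantLength i) -
          g (.inr (.inl i)) 0 * η (.inr (.inl i)) 0) +
        ∑ j, (g (.inr (.inr j)) (G.loopLength j) * η (.inr (.inr j)) (G.loopLength j) -
          g (.inr (.inr j)) 0 * η (.inr (.inr j)) 0)) := by
  have hW : ∀ e s, ContinuousOn (fun x ↦ nlsForce p (U e x)) s := fun e s ↦
    ((continuous_nlsForce hp).comp (sol e).continuous).continuousOn
  rw [Fintype.sum_sum_type, Fintype.sum_sum_type]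
  congr 1
  · refine Finset.sum_congr rfl fun i _ ↦ ?_
    exact setIntegral_Ici_flux (sol (.inl i)).hasDerivAt_deriv (hW _ _) (hc (.inl i)) (hk (.inl i))
      (hk2 (.inl i)) (memLp_deriv (.inl i))
      ((sol (.inl i)).memLp_nlsForce hp (G.isEdgeInterval (.inl i)) (memLp _) (memLp_deriv _))
      (hη2 (.inl i))
  congr 1
  · refine Finset.sum_congr rfl fun i _ ↦ ?_
    exact setIntegral_Icc_flux (G.pendantLength_pos i) (sol (.inr (.inl i))).hasDerivAt_deriv
      (hW _ _) (hc (.inr (.inl i))) (hk (.inr (.inl i))) (hk2 (.inr (.inl i)))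
  · refine Finset.sum_congr rfl fun i _ ↦ ?_
    exact setIntegral_Icc_flux (G.loopLength_pos i) (sol (.inr (.inr i))).hasDerivAt_deriv
      (hW _ _) (hc (.inr (.inr i))) (hk (.inr (.inr i))) (hk2 (.inr (.inr i)))

/-- After integration by parts only end point terms remain. Those at the tips vanish by the Neumann
condition; the others are the common knot value of the test function times the Kirchhoff sum. -/
theorem IsStationary.isBoundState (hp : 2 < p) {U g : G.Edge → ℝ → ℝ} (h : G.IsStationary p U g)
    (hne : ∃ e, ∃ x ∈ G.interval e, U e x ≠ 0) : G.IsBoundState p U := by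
  refine ⟨h.memH1, hne, fun η hη ↦ ?_⟩
  choose k hk hk2 using fun e ↦ (hη.2 e).2
  have key := sum_flux hp h.sol h.memLp h.memLp_deriv hη.1.1 (fun e ↦ (hη.2 e).1) hk hk2
  have e0 : G.Edge := .inl ⟨0, G.one_le_H⟩
  have h0 : ∀ e, η e 0 = η e0 0 := fun e ↦ hη.1.2.1 e e0
  simp only [h.neumann, hη.1.2.2, h0, zero_mul, zero_sub] at key
  have e2 : ∑ e, ∫ x in G.interval e, (g e x * k e x + nlsForce p (U e x) * η e x) = 0 := by
    rw [key]
    have := congrArg (fun t ↦ -(t * η e0 0)) h.kirchhoff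
    simp only [zero_mul, neg_zero] at this
    refine Eq.trans ?_ this
    rw [add_mul, add_mul, Finset.sum_mul, Finset.sum_mul, Finset.sum_mul, neg_add, neg_add,
      ← Finset.sum_neg_distrib, ← Finset.sum_neg_distrib, ← Finset.sum_neg_distrib]
    congr 2
    exact Finset.sum_congr rfl fun j _ ↦ by ring
  rw [← e2]
  refine Finset.sum_congr rfl fun e _ ↦ integral_congr_ae ?_
  filter_upwards [weakDeriv_ae_eq (G.isEdgeInterval e) (h.hasWeakDerivOn e),
    weakDeriv_ae_eq (G.isEdgeInterval e) (hk e)] with x h1 h2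
  rw [h1, h2, nlsForce]
  ring

/-- Test functions supported inside the edge show that u' has the continuous function `nlsForce p u`
as weak derivative; integrating twice gives a classical solution. -/
theorem IsBoundState.exists_isNLSSolution (hp : 2 < p) {u : G.Edge → ℝ → ℝ}
    (hu : G.IsBoundState p u) (e : G.Edge) :
    ∃ U g : ℝ → ℝ, IsNLSSolution p (G.interval e) U g ∧ EqOn (u e) U (G.interval e) ∧
      MemLp g 2 (volume.restrict (G.interval e)) := by
  have hI := G.isEdgeInterval e
  choose g hg hg2 using fun e ↦ (hu.1.2 e).2
  -- With a continuous extension of u the primitives are differentiable on the whole line, so the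
  -- derivatives are two-sided even at the end points of the edge.
  obtain ⟨v, hv, hvu⟩ := hI.exists_continuous_eqOn (hu.1.1.1 e)
  have hfv : Continuous fun x ↦ nlsForce p (v x) := (continuous_nlsForce hp).comp hv
  have hwg : HasWeakDerivOn (g e) (fun x ↦ nlsForce p (v x)) (G.interval e) := by
    refine ⟨(hg e).2.1, hfv.locallyIntegrable.locallyIntegrableOn _, fun φ hφ hc hs ↦ ?_⟩
    have hd : Continuous (deriv φ) := hφ.continuous_deriv (by simp)
    have hφd : ∀ x, HasDerivAt φ (deriv φ x) x := fun x ↦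
      (hφ.differentiable (by simp) x).hasDerivAt
    have hφ0 : ∀ x, x ∉ interior (G.interval e) → φ x = 0 := fun x hx ↦
      image_eq_zero_of_notMem_tsupport fun h ↦ hx (hs h)
    have hs' : tsupport (deriv φ) ⊆ interior (G.interval e) := tsupport_deriv_subset.trans hs
    have key := hu.integral_eq_zero_of_single hg (e := e) (η := φ) (k := deriv φ)
      (memH1On_of_hasDerivAt hφd hd ((hφ.continuous.memLp_of_hasCompactSupport hc).restrict _)
        ((hd.memLp_of_hasCompactSupport hc.deriv).restrict _))
      (hasWeakDerivOn_of_hasDerivAt hφd hd) hφ.continuous.continuousOn (hφ0 0 ?_) ?_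
    · have e1 : ∫ x in G.interval e, (g e x * deriv φ x + nlsForce p (u e x) * φ x) =
          ∫ x in G.interval e, (g e x * deriv φ x + nlsForce p (v x) * φ x) :=
        setIntegral_congr_fun hI.measurableSet fun x hx ↦ by rw [hvu hx]
      rw [e1, integral_add] at key
      · linarith
      · exact ((hg e).2.1.integrable_mul_of_tsupport_subset hd hc.deriv hs').integrableOn
      · exact ((hfv.mul hφ.continuous).integrable_of_hasCompactSupport hc.mul_left).integrableOn
    · rcases e with i | i | j <;> simp [interval]
    · rintro j rfl
      exact hφ0 _ (by simp [interval])
  obtain ⟨C, hC⟩ := hwg.exists_ae_eq_primitive hI hfv.locallyIntegrable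
  have hder : ∀ {f : ℝ → ℝ}, Continuous f → ∀ c x, HasDerivAt (fun x ↦ c + ∫ t in (0 : ℝ)..x, f t)
      (f x) x := fun {f} hf c x ↦
    (intervalIntegral.integral_hasDerivAt_right (hf.intervalIntegrable _ _)
      hf.stronglyMeasurable.stronglyMeasurableAtFilter hf.continuousAt).const_add c
  set g' : ℝ → ℝ := fun x ↦ C + ∫ t in (0 : ℝ)..x, nlsForce p (v t) with hg'
  have hg'd : ∀ x, HasDerivAt g' (nlsForce p (v x)) x := hder hfv C
  have hg'c : Continuous g' := continuous_iff_continuousAt.2 fun x ↦ (hg'd x).continuousAt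
  have hug : HasWeakDerivOn (u e) g' (G.interval e) :=
    (hg e).congr (Filter.EventuallyEq.refl _ _) hC
  have huU := hug.exists_eqOn_primitive hI hg'c.locallyIntegrable (hu.1.1.1 e)
  refine ⟨fun x ↦ u e 0 + ∫ t in (0 : ℝ)..x, g' t, g', ⟨hder hg'c _, hg'c, fun x hx ↦ ?_⟩, huU,
    (memLp_congr_ae hC).1 (hg2 e)⟩
  have h1 := hg'd x
  rw [hvu hx, huU x hx] at h1
  exact h1

theorem interval_end_mem_pendant (i : Fin G.P) :
    G.pendantLength i ∈ G.interval (.inr (.inl i)) := right_mem_Icc.2 (G.pendantLength_pos i).le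

theorem interval_end_mem_loop (j : Fin G.L) :
    G.loopLength j ∈ G.interval (.inr (.inr j)) := right_mem_Icc.2 (G.loopLength_pos j).le

/-- Bound states solve the stationary equation in the classical sense. -/
theorem IsBoundState.exists_isStationary (hp : 2 < p) {u : G.Edge → ℝ → ℝ}
    (hu : G.IsBoundState p u) :
    ∃ U g : G.Edge → ℝ → ℝ, G.IsStationary p U g ∧ ∀ e, EqOn (u e) (U e) (G.interval e) := by
  choose U g sol huU hg2 using fun e ↦ hu.exists_isNLSSolution hp e
  have hU2 : ∀ e, MemLp (U e) 2 (volume.restrict (G.interval e)) := fun e ↦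
    (memLp_congr_ae (ae_restrict_of_forall_mem (G.isEdgeInterval e).measurableSet (huU e))).1
      (hu.1.2 e).1
  have hwd : ∀ e, HasWeakDerivOn (u e) (g e) (G.interval e) := fun e ↦
    (hasWeakDerivOn_of_hasDerivAt (sol e).hasDerivAt (sol e).continuous_deriv).congr_eqOn
      (G.isEdgeInterval e) (huU e).symm (fun _ _ ↦ rfl)
  have hsum : ∀ {η k : G.Edge → ℝ → ℝ}, G.MemH1 η →
      (∀ e, HasWeakDerivOn (η e) (k e) (G.interval e)) →
      ∑ e, ∫ x in G.interval e, (g e x * k e x + nlsForce p (U e x) * η e x) = 0 := by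
    intro η k hη hk
    rw [← hu.sum_integral_eq_zero hwd hη hk]
    exact Finset.sum_congr rfl fun e _ ↦ setIntegral_congr_fun
      (G.isEdgeInterval e).measurableSet fun x hx ↦ by rw [huU e hx]
  have hn : ∀ i, g (.inr (.inl i)) (G.pendantLength i) = 0 := by
    intro i
    have hI := G.isEdgeInterval (.inr (.inl i))
    have hid : ∀ x : ℝ, HasDerivAt (fun x : ℝ ↦ x) ((fun _ ↦ (1 : ℝ)) x) x := fun x ↦ hasDerivAt_id' x
    -- The test function x vanishes at the knot and not at the tip, so it isolates the slope at the
    -- tip.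
    have h := hu.integral_eq_zero_of_single hwd (e := .inr (.inl i)) (η := fun x ↦ x)
      (k := fun _ ↦ 1)
      (memH1On_of_hasDerivAt hid continuous_const (memLp_two_Icc_of_continuous continuous_id' _ _)
        (memLp_two_Icc_of_continuous continuous_const _ _))
      (hasWeakDerivOn_of_hasDerivAt hid continuous_const) continuousOn_id rfl (by simp)
    have h2 := setIntegral_Icc_flux (G.pendantLength_pos i)
      (sol (.inr (.inl i))).hasDerivAt_deriv
      ((continuous_nlsForce hp).comp (sol _).continuous).continuousOn
      (η := fun x ↦ x) (k := fun _ ↦ 1) continuousOn_id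
      (hasWeakDerivOn_of_hasDerivAt hid continuous_const)
      (memLp_two_Icc_of_continuous continuous_const _ _)
    have h3 : ∫ x in G.interval (.inr (.inl i)), (g (.inr (.inl i)) x * 1 +
        nlsForce p (U (.inr (.inl i)) x) * x) = 0 := by
      rw [← h]
      exact setIntegral_congr_fun hI.measurableSet fun x hx ↦ by rw [huU _ hx]
    rw [mul_zero, sub_zero] at h2
    have h4 := h2.symm.trans h3
    exact (mul_eq_zero.1 h4).resolve_right (G.pendantLength_pos i).ne'
  refine ⟨U, g, ⟨sol, hU2, hg2, fun e e' ↦ ?_, fun j ↦ ?_, hn, ?_⟩, huU⟩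
  · rw [← huU e (G.isEdgeInterval e).zero_mem, ← huU e' (G.isEdgeInterval e').zero_mem]
    exact hu.1.1.2.1 e e'
  · rw [← huU _ (interval_end_mem_loop j), ← huU _ (G.isEdgeInterval _).zero_mem]
    exact hu.1.1.2.2 j
  -- A test function in H¹ with value 1 at the knot and at all tips: its boundary terms add up to
  -- the Kirchhoff sum.
  · let η : G.Edge → ℝ → ℝ := Sum.elim (fun _ x ↦ Real.exp (-x)) (fun _ _ ↦ 1)
    let k : G.Edge → ℝ → ℝ := Sum.elim (fun _ x ↦ -Real.exp (-x)) (fun _ _ ↦ 0)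
    have hd : ∀ e x, HasDerivAt (η e) (k e x) x := by
      rintro (i | e) x
      · exact (hasDerivAt_neg x).exp.congr_deriv (by simp [k])
      · exact hasDerivAt_const x 1
    have hkc : ∀ e, Continuous (k e) := by
      rintro (i | e)
      · exact (Real.continuous_exp.comp continuous_neg).neg
      · exact continuous_const
    have hηc : ∀ e, Continuous (η e) := fun e ↦
      continuous_iff_continuousAt.2 fun x ↦ (hd e x).continuousAt
    have hη2 : ∀ e, MemLp (η e) 2 (volume.restrict (G.interval e)) := by
      rintro (i | i | j)
      · exact memLp_exp_neg_Ici
      · exact memLp_two_Icc_of_continuous continuous_const _ _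
      · exact memLp_two_Icc_of_continuous continuous_const _ _
    have hk2 : ∀ e, MemLp (k e) 2 (volume.restrict (G.interval e)) := by
      rintro (i | i | j)
      · exact memLp_exp_neg_Ici.neg
      · exact memLp_two_Icc_of_continuous continuous_const _ _
      · exact memLp_two_Icc_of_continuous continuous_const _ _
    have h0 : ∀ e, η e 0 = 1 := by rintro (i | e) <;> simp [η]
    have hηH : G.MemH1 η := ⟨⟨fun e ↦ (hηc e).continuousOn, fun e e' ↦ by rw [h0, h0], fun j ↦ rfl⟩,
      fun e ↦ memH1On_of_hasDerivAt (hd e) (hkc e) (hη2 e) (hk2 e)⟩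
    have hkw : ∀ e, HasWeakDerivOn (η e) (k e) (G.interval e) := fun e ↦
      hasWeakDerivOn_of_hasDerivAt (hd e) (hkc e)
    have key := (sum_flux hp sol hU2 hg2 (fun e ↦ (hηc e).continuousOn) hη2 hkw hk2).symm.trans
      (hsum hηH hkw)
    have e1 : ∀ e x, η (.inr e) x = 1 := fun e x ↦ rfl
    simp only [hn, h0, e1, mul_one, zero_sub, Finset.sum_neg_distrib,
      Finset.sum_sub_distrib] at key ⊢
    linarith

/-- The action of a bound state is a multiple of its squared norm. -/
theorem IsBoundState.action_eq (hp : 2 < p) {u U g : G.Edge → ℝ → ℝ}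
    (hu : G.IsBoundState p u) (hs : G.IsStationary p U g)
    (huU : ∀ e, EqOn (u e) (U e) (G.interval e)) :
    G.action p u = (1 / 2 - 1 / p) * G.normSq U g := by
  have hm : ∀ e, MeasurableSet (G.interval e) := fun e ↦ (G.isEdgeInterval e).measurableSet
  have hwd : ∀ e, HasWeakDerivOn (u e) (g e) (G.interval e) := fun e ↦
    (hs.hasWeakDerivOn e).congr_eqOn (G.isEdgeInterval e) (huU e).symm (fun _ _ ↦ rfl)
  have e1 : ∀ e, ∫ x in G.interval e, (weakDeriv (u e) (G.interval e) x ^ 2 + u e x ^ 2) =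
      ∫ x in G.interval e, (g e x ^ 2 + U e x ^ 2) := fun e ↦ by
    refine integral_congr_ae ?_
    filter_upwards [weakDeriv_ae_eq (G.isEdgeInterval e) (hwd e),
      ae_restrict_of_forall_mem (hm e) (huU e)] with x h1 h2
    rw [h1, h2]
  have e2 : ∀ e, ∫ x in G.interval e, |u e x| ^ p = ∫ x in G.interval e, |U e x| ^ p := fun e ↦
    setIntegral_congr_fun (hm e) fun x hx ↦ by rw [huU e hx]
  -- Testing with u itself gives the Nehari identity between the squared norm and ∫|u|^p.
  have key := hu.sum_integral_eq_zero hwd hu.1 hwd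
  have e3 : ∀ e, ∫ x in G.interval e, (g e x * g e x + nlsForce p (u e x) * u e x) =
      (∫ x in G.interval e, (g e x ^ 2 + U e x ^ 2)) - ∫ x in G.interval e, |U e x| ^ p := by
    intro e
    have i1 : IntegrableOn (fun x ↦ g e x ^ 2 + U e x ^ 2) (G.interval e) :=
      (hs.memLp_deriv e).integrable_sq.add (hs.memLp e).integrable_sq
    have i2 : IntegrableOn (fun x ↦ |U e x| ^ p) (G.interval e) := by
      have i3 : IntegrableOn (fun x ↦ U e x * U e x - nlsForce p (U e x) * U e x) (G.interval e) :=
        ((hs.memLp e).integrable_mul (hs.memLp e)).sub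
          (((hs.sol e).memLp_nlsForce hp (G.isEdgeInterval e) (hs.memLp e)
            (hs.memLp_deriv e)).integrable_mul (hs.memLp e))
      refine i3.congr (Eventually.of_forall fun x ↦ ?_)
      simp only [nlsForce]
      rw [← abs_rpow_sub_two_mul_sq hp]
      ring
    rw [← integral_sub i1 i2]
    refine setIntegral_congr_fun (hm e) fun x hx ↦ ?_
    rw [huU e hx, ← abs_rpow_sub_two_mul_sq hp, nlsForce]
    ring
  simp_rw [e3] at key
  rw [Finset.sum_sub_distrib] at key
  unfold action normSq
  simp_rw [e1, e2]
  rw [← sub_eq_zero.1 key]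
  ring

end SingleKnotGraph

/-! ### The flow of the truncated phase plane field -/

/-- A bounded Lipschitz vector field has global integral curves. -/
theorem exists_hasDerivAt_of_lipschitzWith {E : Type*} [NormedAddCommGroup E] [NormedSpace ℝ E]
    [CompleteSpace E] {v : E → E} {K L : NNReal} (hv : LipschitzWith K v) (hL : ∀ x, ‖v x‖ ≤ L)
    (x₀ : E) : ∃ γ : ℝ → E, γ 0 = x₀ ∧ ∀ t, HasDerivAt γ (v (γ t)) t := by
  have hloc : ∀ n : ℕ, ∃ γ : ℝ → E, γ 0 = x₀ ∧
      ∀ t ∈ Ioo (-(n + 1 : ℝ)) (n + 1), HasDerivAt γ (v (γ t)) t := by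
    intro n
    have hn : (0 : ℝ) < n + 1 := by positivity
    have hp : IsPicardLindelof (fun _ ↦ v) (tmin := -(n + 1 : ℝ)) (tmax := n + 1)
        ⟨0, by constructor <;> linarith⟩ x₀ (L * (n + 1)) 0 L K := by
      refine IsPicardLindelof.of_time_independent (fun x _ ↦ hL x) hv.lipschitzOnWith ?_
      push_cast
      rw [sub_zero, sub_zero, zero_sub, neg_neg, max_self]
    obtain ⟨γ, h0, hγ⟩ := hp.exists_eq_forall_mem_Icc_hasDerivWithinAt₀
    exact ⟨γ, h0, fun t ht ↦
      (hγ t (Ioo_subset_Icc_self ht)).hasDerivAt (Icc_mem_nhds ht.1 ht.2)⟩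
  choose γ h0 hγ using hloc
  have hagree : ∀ m n : ℕ, m ≤ n → ∀ t ∈ Ioo (-(m + 1 : ℝ)) (m + 1), γ m t = γ n t := by
    intro m n hmn t ht
    have hmn' : (m : ℝ) ≤ n := by exact_mod_cast hmn
    have hm : (0 : ℝ) ≤ m := by positivity
    refine ODE_solution_unique_of_mem_Ioo (v := fun _ ↦ v) (s := fun _ ↦ univ) (K := K) (t₀ := 0)
      (fun _ _ ↦ hv.lipschitzOnWith) ⟨by linarith, by linarith⟩
      (fun s hs ↦ ⟨hγ m s hs, trivial⟩)
      (fun s hs ↦ ⟨hγ n s ⟨by linarith [hs.1], by linarith [hs.2]⟩, trivial⟩) ?_ ht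
    rw [h0, h0]
  -- The local curves agree where they overlap, so at time t any curve of large enough index may be
  -- used. The index N below is one larger than needed at t, to serve a whole neighbourhood of t.
  refine ⟨fun t ↦ γ ⌈|t|⌉₊ t, by simp [h0], fun t ↦ ?_⟩
  have hmem : ∀ s : ℝ, s ∈ Ioo (-(⌈|s|⌉₊ + 1 : ℝ)) (⌈|s|⌉₊ + 1) := fun s ↦ by
    have := Nat.le_ceil |s|
    constructor <;> cases abs_cases s <;> linarith
  set N := ⌈|t|⌉₊ + 1 with hN
  have hev : (fun t ↦ γ ⌈|t|⌉₊ t) =ᶠ[𝓝 t] γ N := by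
    have h1 : ∀ᶠ s in 𝓝 t, |s| < |t| + 1 :=
      continuous_abs.continuousAt.eventually_lt continuousAt_const (by linarith)
    filter_upwards [h1] with s hs
    refine hagree _ _ ?_ s (hmem s)
    rw [Nat.ceil_le, hN]
    push_cast
    linarith [Nat.le_ceil |t|]
  have hval : γ ⌈|t|⌉₊ t = γ N t := hev.eq_of_nhds
  change HasDerivAt _ (v (γ ⌈|t|⌉₊ t)) t
  rw [hval]
  refine (hγ N t ?_).congr_of_eventuallyEq hev
  have := hmem t
  rw [hN]
  push_cast
  exact ⟨by linarith [this.1], by linarith [this.2]⟩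

theorem hasDerivAt_abs_rpow_mul_self {q : ℝ} (hq : 0 < q) (x : ℝ) :
    HasDerivAt (fun x : ℝ ↦ |x| ^ q * x) ((q + 1) * |x| ^ q) x := by
  rcases eq_or_ne x 0 with rfl | hx
  · rw [hasDerivAt_iff_tendsto_slope_zero]
    have h1 : Tendsto (fun t : ℝ ↦ |t| ^ q) (𝓝[≠] 0) (𝓝 ((q + 1) * |(0 : ℝ)| ^ q)) := by
      have : Continuous fun t : ℝ ↦ |t| ^ q := continuous_abs.rpow_const fun x ↦ Or.inr hq.le
      have h2 := this.tendsto 0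
      simp only [abs_zero, Real.zero_rpow hq.ne', mul_zero] at h2 ⊢
      exact h2.mono_left nhdsWithin_le_nhds
    refine h1.congr' ?_
    filter_upwards [self_mem_nhdsWithin] with t ht
    have ht' : t ≠ 0 := ht
    simp only [zero_add, mul_zero, sub_zero, smul_eq_mul]
    field_simp
  · refine (((hasDerivAt_abs hx).rpow_const (p := q) (Or.inl (abs_ne_zero.2 hx))).mul
      (hasDerivAt_id' x)).congr_deriv ?_
    have h1 : |x| ^ (q - 1) * |x| = |x| ^ q := by
      rw [← Real.rpow_add_one (abs_ne_zero.2 hx)]; ring_nf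
    have h2 : (SignType.sign x : ℝ) * x = |x| := by
      rcases lt_or_gt_of_ne hx with h | h
      · simp [h, abs_of_neg h]
      · simp [h, abs_of_pos h]
    calc _ = q * (|x| ^ (q - 1) * ((SignType.sign x : ℝ) * x)) + |x| ^ q := by ring
      _ = _ := by rw [h2, h1]; ring

theorem exists_lipschitzOnWith_nlsForce {p : ℝ} (hp : 2 < p) (M : ℝ) :
    ∃ K, LipschitzOnWith K (nlsForce p) (Icc (-M) M) := by
  have hq : 0 < p - 2 := by linarith
  have hM0 : 0 ≤ |M| ^ (p - 2) := Real.rpow_nonneg (abs_nonneg M) _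
  refine ⟨(1 + (p - 2 + 1) * |M| ^ (p - 2)).toNNReal,
    (convex_Icc _ _).lipschitzOnWith_of_nnnorm_hasDerivWithin_le
      (f' := fun x ↦ 1 - (p - 2 + 1) * |x| ^ (p - 2))
      (fun x _ ↦ ((hasDerivAt_id' x).sub
        (hasDerivAt_abs_rpow_mul_self hq x)).hasDerivWithinAt) fun x hx ↦ ?_⟩
  rw [← NNReal.coe_le_coe, coe_nnnorm, Real.coe_toNNReal _ (by positivity), Real.norm_eq_abs]
  have h0 : 0 ≤ |x| ^ (p - 2) := Real.rpow_nonneg (abs_nonneg x) _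
  have h1 : |x| ^ (p - 2) ≤ |M| ^ (p - 2) :=
    Real.rpow_le_rpow (abs_nonneg x) ((abs_le.2 hx).trans (le_abs_self M)) hq.le
  rw [abs_le]
  constructor <;> nlinarith

/-- Truncation to `[-M, M]`. -/
noncomputable def clamp (M x : ℝ) : ℝ := max (-M) (min M x)

theorem lipschitzWith_clamp (M : ℝ) : LipschitzWith 1 (clamp M) :=
  (LipschitzWith.id.const_min M).const_max (-M)

theorem clamp_mem {M : ℝ} (hM : 0 ≤ M) (x : ℝ) : clamp M x ∈ Icc (-M) M :=
  ⟨le_max_left _ _, max_le (by linarith) (min_le_left _ _)⟩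

theorem clamp_of_abs_le {M x : ℝ} (h : |x| ≤ M) : clamp M x = x := by
  rw [clamp, min_eq_right (abs_le.1 h).2, max_eq_right (abs_le.1 h).1]

theorem clamp_neg {M : ℝ} (hM : 0 ≤ M) (x : ℝ) : clamp M (-x) = -clamp M x := by
  unfold clamp
  rcases le_total M x with h | h <;> rcases le_total (-M) x with h' | h' <;>
    simp [max_def, min_def] <;> split_ifs <;> linarith

/-- The truncated phase plane vector field of the stationary equation. -/
noncomputable def nlsField (p M : ℝ) (y : ℝ × ℝ) : ℝ × ℝ :=
  (clamp M y.2, nlsForce p (clamp M y.1))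

theorem nlsField_of_abs_le {p M : ℝ} {y : ℝ × ℝ} (h1 : |y.1| ≤ M) (h2 : |y.2| ≤ M) :
    nlsField p M y = (y.2, nlsForce p y.1) := by
  rw [nlsField, clamp_of_abs_le h1, clamp_of_abs_le h2]

theorem exists_lipschitzWith_nlsField {p M : ℝ} (hp : 2 < p) (hM : 0 ≤ M) :
    ∃ K, LipschitzWith K (nlsField p M) := by
  obtain ⟨K, hK⟩ := exists_lipschitzOnWith_nlsForce hp M
  have h1 : LipschitzWith (1 * 1) fun y : ℝ × ℝ ↦ clamp M y.2 :=
    (lipschitzWith_clamp M).comp LipschitzWith.prod_snd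
  have h2 : LipschitzWith (1 * 1) fun y : ℝ × ℝ ↦ clamp M y.1 :=
    (lipschitzWith_clamp M).comp LipschitzWith.prod_fst
  have h3 : LipschitzWith (K * (1 * 1)) fun y : ℝ × ℝ ↦ nlsForce p (clamp M y.1) := by
    rw [← lipschitzOnWith_univ]
    exact hK.comp h2.lipschitzOnWith fun y _ ↦ clamp_mem hM y.1
  exact ⟨_, h1.prodMk h3⟩

/-- Solutions of the original equation could a priori leave every bounded set. Clamping both
coordinates makes the field bounded and globally Lipschitz; a priori bounds show later that the
orbits used never meet the truncation. -/
theorem exists_flow {p M : ℝ} (hp : 2 < p) (hM : 0 ≤ M) (y : ℝ × ℝ) :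
    ∃ γ : ℝ → ℝ × ℝ, γ 0 = y ∧ ∀ t, HasDerivAt γ (nlsField p M (γ t)) t := by
  obtain ⟨K, hK⟩ := exists_lipschitzWith_nlsField hp hM
  refine exists_hasDerivAt_of_lipschitzWith hK (L := (M + (1 + M ^ (p - 2)) * M).toNNReal)
    (fun y ↦ ?_) y
  have h0 : 0 ≤ M ^ (p - 2) := Real.rpow_nonneg hM _
  rw [Real.coe_toNNReal _ (by positivity), Prod.norm_def]
  refine max_le ?_ ?_
  · exact (abs_le.2 (clamp_mem hM y.2)).trans (le_add_of_nonneg_right (by positivity))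
  · have h1 := abs_le.2 (clamp_mem hM y.1)
    refine (abs_nlsForce_le hp h1).trans ?_
    nlinarith

theorem dist_le_of_hasDerivAt_nlsField {p M : ℝ} {K : NNReal} (hK : LipschitzWith K (nlsField p M))
    {α β : ℝ → ℝ × ℝ} {b : ℝ} (hα : ∀ t ∈ Icc 0 b, HasDerivAt α (nlsField p M (α t)) t)
    (hβ : ∀ t ∈ Icc 0 b, HasDerivAt β (nlsField p M (β t)) t) {t : ℝ} (ht : t ∈ Icc 0 b) :
    dist (α t) (β t) ≤ dist (α 0) (β 0) * Real.exp (K * t) := by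
  have h := dist_le_of_trajectories_ODE (v := fun _ ↦ nlsField p M) (fun _ ↦ hK)
    (fun t ht ↦ (hα t ht).continuousAt.continuousWithinAt)
    (fun t ht ↦ (hα t (Ico_subset_Icc_self ht)).hasDerivWithinAt)
    (fun t ht ↦ (hβ t ht).continuousAt.continuousWithinAt)
    (fun t ht ↦ (hβ t (Ico_subset_Icc_self ht)).hasDerivWithinAt) le_rfl t ht
  rwa [sub_zero] at h

/-! ### Energy conservation and dependence on the data -/

/-- Twice the conserved energy of the stationary equation. -/
noncomputable def nlsEnergy (p x y : ℝ) : ℝ := y ^ 2 - x ^ 2 + 2 / p * |x| ^ p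

theorem continuous_nlsEnergy {p : ℝ} (hp : 2 < p) :
    Continuous fun y : ℝ × ℝ ↦ nlsEnergy p y.1 y.2 := by
  unfold nlsEnergy
  exact ((continuous_snd.pow 2).sub (continuous_fst.pow 2)).add
    (continuous_const.mul (continuous_fst.abs.rpow_const fun x ↦ Or.inr (by linarith)))

theorem hasDerivAt_nlsEnergy {p : ℝ} (hp : 2 < p) {U g : ℝ → ℝ} {x : ℝ}
    (hU : HasDerivAt U (g x) x) (hg : HasDerivAt g (nlsForce p (U x)) x) :
    HasDerivAt (fun x ↦ nlsEnergy p (U x) (g x)) 0 x := by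
  have h3 : HasDerivAt (fun x ↦ |U x| ^ p) (p * |U x| ^ (p - 2) * U x * g x) x :=
    (hasDerivAt_abs_rpow (U x) (by linarith)).comp x hU
  refine (((hg.pow 2).sub (hU.pow 2)).add (h3.const_mul (2 / p))).congr_deriv ?_
  have hp0 : p ≠ 0 := by linarith
  simp only [nlsForce]
  push_cast
  field_simp
  ring

namespace IsNLSSolution

variable {p : ℝ} {I : Set ℝ} {U g : ℝ → ℝ}

theorem energy_eq (hp : 2 < p) (hI : IsEdgeInterval I) (h : IsNLSSolution p I U g) {x : ℝ}
    (hx : x ∈ I) : nlsEnergy p (U x) (g x) = nlsEnergy p (U 0) (g 0) := by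
  have hd : ∀ t ∈ Icc 0 x, HasDerivAt (fun x ↦ nlsEnergy p (U x) (g x)) 0 t := fun t ht ↦
    hasDerivAt_nlsEnergy hp (h.hasDerivAt t) (h.hasDerivAt_deriv t (hI.Icc_subset hx ht))
  exact constant_of_has_deriv_right_zero (fun t ht ↦ (hd t ht).continuousAt.continuousWithinAt)
    (fun t ht ↦ (hd t (Ico_subset_Icc_self ht)).hasDerivWithinAt) x
    (right_mem_Icc.2 (hI.nonneg hx))

theorem energy_eq' (hp : 2 < p) (hI : IsEdgeInterval I) (h : IsNLSSolution p I U g) {x y : ℝ}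
    (hx : x ∈ I) (hy : y ∈ I) : nlsEnergy p (U x) (g x) = nlsEnergy p (U y) (g y) :=
  (h.energy_eq hp hI hx).trans (h.energy_eq hp hI hy).symm

theorem hasDerivAt_nlsField (h : IsNLSSolution p I U g) {M x : ℝ} (hx : x ∈ I)
    (h1 : |U x| ≤ M) (h2 : |g x| ≤ M) :
    HasDerivAt (fun x ↦ (U x, g x)) (nlsField p M (U x, g x)) x := by
  rw [nlsField_of_abs_le h1 h2]
  exact (h.hasDerivAt x).prodMk (h.hasDerivAt_deriv x hx)

/-- An integral curve of the truncated field that stays strictly inside the truncation. -/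
theorem of_hasDerivAt_nlsField {M : ℝ} {γ : ℝ → ℝ × ℝ}
    (hγ : ∀ t, HasDerivAt γ (nlsField p M (γ t)) t)
    (hI : ∀ t ∈ I, |(γ t).1| < M ∧ |(γ t).2| < M) :
    IsNLSSolution p I (fun t ↦ (γ t).1) (fun t ↦ clamp M (γ t).2) := by
  have hc : Continuous γ := continuous_iff_continuousAt.2 fun t ↦ (hγ t).continuousAt
  -- The derivative is the clamped coordinate because U' = g is required on the whole line, while
  -- the orbit is known to stay inside only on I. Around points of I the strict bound makes the
  -- clamp inactive.
  refine ⟨fun t ↦ (hγ t).fst, (lipschitzWith_clamp M).continuous.comp (continuous_snd.comp hc),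
    fun t ht ↦ ?_⟩
  have h2 : HasDerivAt (fun t ↦ (γ t).2) (nlsForce p (clamp M (γ t).1)) t := (hγ t).snd
  rw [clamp_of_abs_le (hI t ht).1.le] at h2
  refine h2.congr_of_eventuallyEq ?_
  have : ∀ᶠ s in 𝓝 t, |(γ s).2| < M :=
    (continuous_snd.comp hc).abs.continuousAt.eventually_lt continuousAt_const (hI t ht).2
  filter_upwards [this] with s hs
  exact clamp_of_abs_le hs.le

/-- Two bounded solutions with the same data at `0` agree. -/
theorem eqOn (hp : 2 < p) (hI : IsEdgeInterval I) (h : IsNLSSolution p I U g) {V k : ℝ → ℝ}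
    (h' : IsNLSSolution p I V k) {M : ℝ} (hU : ∀ x ∈ I, |U x| ≤ M) (hg : ∀ x ∈ I, |g x| ≤ M)
    (hV : ∀ x ∈ I, |V x| ≤ M) (hk : ∀ x ∈ I, |k x| ≤ M) (h0 : U 0 = V 0) (h1 : g 0 = k 0) :
    ∀ x ∈ I, U x = V x ∧ g x = k x := by
  intro x hx
  have hM : 0 ≤ M := (abs_nonneg _).trans (hU x hx)
  obtain ⟨K, hK⟩ := exists_lipschitzWith_nlsField hp hM
  have hs := hI.Icc_subset hx
  have hd := dist_le_of_hasDerivAt_nlsField hK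
    (fun t ht ↦ h.hasDerivAt_nlsField (hs ht) (hU t (hs ht)) (hg t (hs ht)))
    (fun t ht ↦ h'.hasDerivAt_nlsField (hs ht) (hV t (hs ht)) (hk t (hs ht)))
    (right_mem_Icc.2 (hI.nonneg hx))
  rw [h0, h1, dist_self, zero_mul, dist_le_zero, Prod.mk.injEq] at hd
  exact hd

/-- Uniformly bounded solutions whose data at `0` converge, converge to a solution. -/
theorem exists_tendsto (hp : 2 < p) (hI : IsEdgeInterval I) {U g : ℕ → ℝ → ℝ}
    (h : ∀ n, IsNLSSolution p I (U n) (g n)) {M : ℝ} (hU : ∀ n, ∀ x ∈ I, |U n x| ≤ M)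
    (hg : ∀ n, ∀ x ∈ I, |g n x| ≤ M) {c s : ℝ} (hc : Tendsto (fun n ↦ U n 0) atTop (𝓝 c))
    (hs : Tendsto (fun n ↦ g n 0) atTop (𝓝 s)) :
    ∃ V k : ℝ → ℝ, IsNLSSolution p I V k ∧
      (∀ x ∈ I, Tendsto (fun n ↦ U n x) atTop (𝓝 (V x))) ∧
      (∀ x ∈ I, Tendsto (fun n ↦ g n x) atTop (𝓝 (k x))) := by
  have hM : 0 ≤ M := (abs_nonneg _).trans (hU 0 0 hI.zero_mem)
  -- Truncating at M + 1 leaves room: limits are bounded by M only in the weak sense, and must stay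
  -- strictly inside.
  have hM1 : 0 ≤ M + 1 := by linarith
  obtain ⟨K, hK⟩ := exists_lipschitzWith_nlsField hp hM1
  obtain ⟨γ, hγ0, hγ⟩ := exists_flow hp hM1 (c, s)
  have hlim : ∀ x ∈ I, Tendsto (fun n ↦ (U n x, g n x)) atTop (𝓝 (γ x)) := by
    intro x hx
    rw [tendsto_iff_dist_tendsto_zero]
    have h1 : Tendsto (fun n ↦ dist (U n 0, g n 0) (γ 0) * Real.exp (K * x)) atTop (𝓝 0) := by
      have := (tendsto_iff_dist_tendsto_zero.1 (hc.prodMk_nhds hs)).mul_const (Real.exp (K * x))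
      rwa [zero_mul, ← hγ0] at this
    refine squeeze_zero (fun _ ↦ dist_nonneg) (fun n ↦ ?_) h1
    have hss := hI.Icc_subset hx
    exact dist_le_of_hasDerivAt_nlsField hK (α := fun x ↦ (U n x, g n x))
      (fun t ht ↦ (h n).hasDerivAt_nlsField (hss ht) (by linarith [hU n t (hss ht)])
        (by linarith [hg n t (hss ht)])) (fun t _ ↦ hγ t) (right_mem_Icc.2 (hI.nonneg hx))
  have hV : ∀ x ∈ I, Tendsto (fun n ↦ U n x) atTop (𝓝 (γ x).1) := fun x hx ↦
    (continuous_fst.tendsto _).comp (hlim x hx)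
  have hk : ∀ x ∈ I, Tendsto (fun n ↦ g n x) atTop (𝓝 (γ x).2) := fun x hx ↦
    (continuous_snd.tendsto _).comp (hlim x hx)
  have hb : ∀ x ∈ I, |(γ x).1| < M + 1 ∧ |(γ x).2| < M + 1 := fun x hx ↦
    ⟨(le_of_tendsto (hV x hx).abs (Eventually.of_forall fun n ↦ hU n x hx)).trans_lt (by linarith),
      (le_of_tendsto (hk x hx).abs (Eventually.of_forall fun n ↦ hg n x hx)).trans_lt
        (by linarith)⟩
  refine ⟨_, _, of_hasDerivAt_nlsField hγ hb, hV, fun x hx ↦ ?_⟩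
  rw [clamp_of_abs_le (hb x hx).2.le]
  exact hk x hx

end IsNLSSolution

/-! ### The soliton -/

/-- The largest value of the soliton, `(p/2)^(1/(p-2))`. -/
noncomputable def solitonMax (p : ℝ) : ℝ := (p / 2) ^ (1 / (p - 2))

theorem one_le_solitonMax {p : ℝ} (hp : 2 < p) : 1 ≤ solitonMax p :=
  Real.one_le_rpow (by linarith) (by have : 0 < p - 2 := by linarith
                                     positivity)

theorem solitonMax_pos {p : ℝ} (hp : 2 < p) : 0 < solitonMax p :=
  one_pos.trans_le (one_le_solitonMax hp)

theorem solitonMax_rpow {p : ℝ} (hp : 2 < p) : solitonMax p ^ (p - 2) = p / 2 := by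
  have : p - 2 ≠ 0 := by linarith
  rw [solitonMax, ← Real.rpow_mul (by linarith), one_div, inv_mul_cancel₀ this, Real.rpow_one]

theorem nlsEnergy_eq {p : ℝ} (hp : 2 < p) (x y : ℝ) :
    nlsEnergy p x y = y ^ 2 - x ^ 2 * (1 - 2 / p * |x| ^ (p - 2)) := by
  rw [nlsEnergy, ← abs_rpow_sub_two_mul_sq hp]
  ring

theorem abs_rpow_sub_two_le {p x : ℝ} (hp : 2 < p) (hx : |x| ≤ solitonMax p) :
    2 / p * |x| ^ (p - 2) ≤ 1 := by
  have h := Real.rpow_le_rpow (abs_nonneg x) hx (show 0 ≤ p - 2 by linarith)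
  rw [solitonMax_rpow hp] at h
  calc 2 / p * |x| ^ (p - 2) ≤ 2 / p * (p / 2) := by gcongr
    _ = 1 := by have : p ≠ 0 := by linarith
                field_simp

/-- Nonpositive energy means y² ≤ x² (1 - (2/p)|x|^(p-2)). For x ≠ 0 the bracket must be
nonnegative, which bounds x, and it is at most 1, which gives |y| ≤ |x|. Geometrically, the point
lies within the homoclinic loops of ± the soliton. -/
theorem abs_le_solitonMax_of_nlsEnergy_nonpos {p x y : ℝ} (hp : 2 < p)
    (h : nlsEnergy p x y ≤ 0) : |x| ≤ solitonMax p ∧ |y| ≤ solitonMax p := by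
  have hp0 : 0 < p := by linarith
  rw [nlsEnergy_eq hp] at h
  have hx : |x| ≤ solitonMax p := by
    by_contra hcon
    push Not at hcon
    have h1 := Real.rpow_lt_rpow (solitonMax_pos hp).le hcon (show 0 < p - 2 by linarith)
    rw [solitonMax_rpow hp] at h1
    have h2 : 1 < 2 / p * |x| ^ (p - 2) := by
      calc 1 = 2 / p * (p / 2) := by field_simp
        _ < 2 / p * |x| ^ (p - 2) := by gcongr
    have h3 : 0 < x ^ 2 := by
      rw [← sq_abs]; have := (solitonMax_pos hp).trans hcon; positivity
    nlinarith [sq_nonneg y]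
  refine ⟨hx, ?_⟩
  have h4 : 0 ≤ |x| ^ (p - 2) := Real.rpow_nonneg (abs_nonneg x) _
  have h5 : y ^ 2 ≤ x ^ 2 := by
    have : 0 ≤ 2 / p * |x| ^ (p - 2) := by positivity
    nlinarith [sq_nonneg x]
  exact (sq_le_sq.1 h5).trans hx

/-- The soliton of the stationary equation on the line. -/
noncomputable def soliton (p x : ℝ) : ℝ :=
  solitonMax p * Real.cosh ((p - 2) / 2 * x) ^ (-(2 / (p - 2)))

/-- The derivative of the soliton. -/
noncomputable def solitonDeriv (p x : ℝ) : ℝ :=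
  -(soliton p x * (Real.sinh ((p - 2) / 2 * x) / Real.cosh ((p - 2) / 2 * x)))

theorem soliton_pos {p : ℝ} (hp : 2 < p) (x : ℝ) : 0 < soliton p x :=
  mul_pos (solitonMax_pos hp) (Real.rpow_pos_of_pos (Real.cosh_pos _) _)

theorem soliton_neg (p x : ℝ) : soliton p (-x) = soliton p x := by
  simp [soliton]

theorem solitonDeriv_neg (p x : ℝ) : solitonDeriv p (-x) = -solitonDeriv p x := by
  simp only [solitonDeriv, soliton_neg, mul_neg, Real.sinh_neg, Real.cosh_neg]
  ring

theorem soliton_zero (p : ℝ) : soliton p 0 = solitonMax p := by simp [soliton]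

theorem solitonDeriv_zero (p : ℝ) : solitonDeriv p 0 = 0 := by simp [solitonDeriv]

theorem soliton_rpow {p : ℝ} (hp : 2 < p) (x : ℝ) :
    soliton p x ^ (p - 2) = p / 2 * (Real.cosh ((p - 2) / 2 * x) ^ 2)⁻¹ := by
  have h : p - 2 ≠ 0 := by linarith
  rw [soliton, Real.mul_rpow (solitonMax_pos hp).le (Real.rpow_nonneg (Real.cosh_pos _).le _),
    solitonMax_rpow hp, ← Real.rpow_mul (Real.cosh_pos _).le,
    show -(2 / (p - 2)) * (p - 2) = -((2 : ℕ) : ℝ) by field_simp; norm_num,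
    Real.rpow_neg (Real.cosh_pos _).le, Real.rpow_natCast]

theorem hasDerivAt_soliton {p : ℝ} (hp : 2 < p) (x : ℝ) :
    HasDerivAt (soliton p) (solitonDeriv p x) x := by
  have hq : p - 2 ≠ 0 := by linarith
  have hc := (Real.cosh_pos ((p - 2) / 2 * x)).ne'
  have h1 : HasDerivAt (fun x : ℝ ↦ (p - 2) / 2 * x) ((p - 2) / 2) x := by
    simpa using (hasDerivAt_id x).const_mul ((p - 2) / 2)
  have h2 := ((h1.cosh).rpow_const (p := -(2 / (p - 2))) (Or.inl hc)).const_mul (solitonMax p)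
  refine h2.congr_deriv ?_
  rw [solitonDeriv, soliton, Real.rpow_sub_one hc]
  field_simp

theorem hasDerivAt_solitonDeriv {p : ℝ} (hp : 2 < p) (x : ℝ) :
    HasDerivAt (solitonDeriv p) (nlsForce p (soliton p x)) x := by
  have hc := (Real.cosh_pos ((p - 2) / 2 * x)).ne'
  have h1 : HasDerivAt (fun x : ℝ ↦ (p - 2) / 2 * x) ((p - 2) / 2) x := by
    simpa using (hasDerivAt_id x).const_mul ((p - 2) / 2)
  have h2 := ((hasDerivAt_soliton hp x).mul (h1.sinh.div h1.cosh hc)).neg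
  refine h2.congr_deriv ?_
  have hs : Real.sinh ((p - 2) / 2 * x) ^ 2 = Real.cosh ((p - 2) / 2 * x) ^ 2 - 1 :=
    Real.sinh_sq _
  rw [nlsForce, abs_of_pos (soliton_pos hp x), soliton_rpow hp, solitonDeriv, Pi.div_apply]
  generalize Real.sinh ((p - 2) / 2 * x) = S at hs ⊢
  generalize Real.cosh ((p - 2) / 2 * x) = C at hs hc ⊢
  field_simp
  rw [hs]
  ring

theorem nlsEnergy_soliton {p : ℝ} (hp : 2 < p) (x : ℝ) :
    nlsEnergy p (soliton p x) (solitonDeriv p x) = 0 := by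
  have hc := (Real.cosh_pos ((p - 2) / 2 * x)).ne'
  have hp0 : p ≠ 0 := by linarith
  have hs : Real.sinh ((p - 2) / 2 * x) ^ 2 = Real.cosh ((p - 2) / 2 * x) ^ 2 - 1 :=
    Real.sinh_sq _
  rw [nlsEnergy_eq hp, abs_of_pos (soliton_pos hp x), soliton_rpow hp, solitonDeriv]
  generalize Real.sinh ((p - 2) / 2 * x) = S at hs ⊢
  generalize Real.cosh ((p - 2) / 2 * x) = C at hs hc ⊢
  field_simp
  rw [hs]
  ring

theorem soliton_le_exp {p : ℝ} (hp : 2 < p) (x : ℝ) :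
    soliton p x ≤ solitonMax p * 2 ^ (2 / (p - 2)) * Real.exp (-x) := by
  have hq : 0 < p - 2 := by linarith
  rw [soliton, mul_assoc]
  refine mul_le_mul_of_nonneg_left ?_ (solitonMax_pos hp).le
  have h1 : Real.exp ((p - 2) / 2 * x) / 2 ≤ Real.cosh ((p - 2) / 2 * x) := by
    rw [Real.cosh_eq]
    linarith [Real.exp_pos (-((p - 2) / 2 * x))]
  refine (Real.rpow_le_rpow_of_nonpos (by positivity) h1 (neg_nonpos.2 (by positivity))).trans ?_
  rw [Real.div_rpow (Real.exp_pos _).le (by norm_num), ← Real.exp_mul,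
    show (p - 2) / 2 * x * -(2 / (p - 2)) = -x by field_simp, Real.rpow_neg (by norm_num),
    div_inv_eq_mul, mul_comm]

theorem abs_solitonDeriv_le {p : ℝ} (hp : 2 < p) (x : ℝ) : |solitonDeriv p x| ≤ soliton p x := by
  have h := nlsEnergy_soliton hp x
  rw [nlsEnergy_eq hp] at h
  have h4 : 0 ≤ 2 / p * |soliton p x| ^ (p - 2) := by
    have := Real.rpow_nonneg (abs_nonneg (soliton p x)) (p - 2)
    positivity
  have h5 : solitonDeriv p x ^ 2 ≤ soliton p x ^ 2 := by
    nlinarith [sq_nonneg (soliton p x)]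
  exact (sq_le_sq.1 h5).trans_eq (abs_of_pos (soliton_pos hp x))

theorem continuous_soliton {p : ℝ} (hp : 2 < p) : Continuous (soliton p) :=
  continuous_iff_continuousAt.2 fun x ↦ (hasDerivAt_soliton hp x).continuousAt

theorem continuous_solitonDeriv {p : ℝ} (hp : 2 < p) : Continuous (solitonDeriv p) :=
  continuous_iff_continuousAt.2 fun x ↦ (hasDerivAt_solitonDeriv hp x).continuousAt

theorem exists_soliton_eq {p c : ℝ} (hp : 2 < p) (hc : 0 < c) (hc' : c ≤ solitonMax p) :
    ∃ a, 0 ≤ a ∧ soliton p a = c := by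
  have hlim : Tendsto (soliton p) atTop (𝓝 0) := by
    refine squeeze_zero (fun x ↦ (soliton_pos hp x).le) (soliton_le_exp hp) ?_
    simpa using (Real.tendsto_exp_neg_atTop_nhds_zero).const_mul
      (solitonMax p * 2 ^ (2 / (p - 2)))
  obtain ⟨b, hb, hb0⟩ := ((hlim.eventually_lt_const hc).and (eventually_ge_atTop 0)).exists
  obtain ⟨a, ha, hac⟩ := intermediate_value_Icc' hb0 (continuous_soliton hp).continuousOn
    ⟨hb.le, hc'.trans_eq (soliton_zero p).symm⟩
  exact ⟨a, ha.1, hac⟩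

theorem isNLSSolution_soliton {p : ℝ} (hp : 2 < p) (I : Set ℝ) {κ : ℝ} (hκ : |κ| = 1) (a : ℝ) :
    IsNLSSolution p I (fun x ↦ κ * soliton p (x + a)) (fun x ↦ κ * solitonDeriv p (x + a)) := by
  refine ⟨fun x ↦ ((hasDerivAt_soliton hp (x + a)).comp_add_const x a).const_mul κ,
    continuous_const.mul ((continuous_solitonDeriv hp).comp (by fun_prop)), fun x _ ↦ ?_⟩
  refine (((hasDerivAt_solitonDeriv hp (x + a)).comp_add_const x a).const_mul κ).congr_deriv ?_
  rw [nlsForce, nlsForce, abs_mul, hκ, one_mul]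
  ring

theorem memLp_soliton {p : ℝ} (hp : 2 < p) (a : ℝ) :
    MemLp (fun x ↦ soliton p (x + a)) 2 (volume.restrict (Ici 0)) := by
  refine memLp_exp_neg_Ici.of_le_mul (c := solitonMax p * 2 ^ (2 / (p - 2)) * Real.exp (-a))
    ((continuous_soliton hp).comp (by fun_prop)).aestronglyMeasurable
    (Eventually.of_forall fun x ↦ ?_)
  rw [Real.norm_eq_abs, abs_of_pos (soliton_pos hp _), Real.norm_eq_abs,
    abs_of_pos (Real.exp_pos _), mul_assoc, ← Real.exp_add]
  convert soliton_le_exp hp (x + a) using 3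
  ring

theorem memLp_solitonDeriv {p : ℝ} (hp : 2 < p) (a : ℝ) :
    MemLp (fun x ↦ solitonDeriv p (x + a)) 2 (volume.restrict (Ici 0)) :=
  (memLp_soliton hp a).of_le ((continuous_solitonDeriv hp).comp (by fun_prop)).aestronglyMeasurable
    (Eventually.of_forall fun x ↦ (abs_solitonDeriv_le hp _).trans (le_abs_self _))

theorem nlsForce_neg (p x : ℝ) : nlsForce p (-x) = -nlsForce p x := by
  rw [nlsForce, nlsForce, abs_neg]
  ring

/-! ### Shooting for an even solution -/

/-- Time reversal of integral curves. -/
theorem hasDerivAt_nlsField_reverse {p M : ℝ} (hM : 0 ≤ M) {γ : ℝ → ℝ × ℝ}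
    (hγ : ∀ t, HasDerivAt γ (nlsField p M (γ t)) t) (c t : ℝ) :
    HasDerivAt (fun t ↦ ((γ (c - t)).1, -(γ (c - t)).2))
      (nlsField p M ((γ (c - t)).1, -(γ (c - t)).2)) t := by
  have h : HasDerivAt (fun t ↦ γ (c - t))
      (-(clamp M (γ (c - t)).2), -(nlsForce p (clamp M (γ (c - t)).1))) t :=
    ((hγ (c - t)).scomp t ((hasDerivAt_id' t).const_sub c)).congr_deriv (by simp [nlsField])
  have h1 : HasDerivAt (fun t ↦ (γ (c - t)).1) (-(clamp M (γ (c - t)).2)) t := h.fst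
  have h2 : HasDerivAt (fun t ↦ (γ (c - t)).2) (-(nlsForce p (clamp M (γ (c - t)).1))) t := h.snd
  have h3 := h1.prodMk h2.neg
  rw [neg_neg] at h3
  rw [nlsField, clamp_neg hM]
  exact h3

/-- Integral curves of nonpositive energy stay where the field is not truncated. -/
theorem nlsEnergy_eq_of_hasDerivAt_nlsField {p M : ℝ} (hp : 2 < p) (hM : solitonMax p < M)
    {γ : ℝ → ℝ × ℝ} (hγ : ∀ t, HasDerivAt γ (nlsField p M (γ t)) t)
    (h0 : nlsEnergy p (γ 0).1 (γ 0).2 ≤ 0) {t : ℝ} (ht : 0 ≤ t) :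
    nlsEnergy p (γ t).1 (γ t).2 = nlsEnergy p (γ 0).1 (γ 0).2 := by
  have hc : Continuous γ := continuous_iff_continuousAt.2 fun t ↦ (hγ t).continuousAt
  have hE : Continuous fun t ↦ nlsEnergy p (γ t).1 (γ t).2 := (continuous_nlsEnergy hp).comp hc
  -- Continuation in time: the set is closed, and at each of its points the energy bound keeps the
  -- orbit strictly inside the truncation, where the energy is conserved a little longer.
  have key : Icc 0 t ⊆ {t | nlsEnergy p (γ t).1 (γ t).2 = nlsEnergy p (γ 0).1 (γ 0).2} := by
    refine IsClosed.Icc_subset_of_forall_exists_gt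
      ((isClosed_eq hE continuous_const).inter isClosed_Icc) rfl ?_
    rintro x ⟨hx, -⟩ y hy
    simp only [mem_ofPred_eq] at hx
    obtain ⟨h1, h2⟩ := abs_le_solitonMax_of_nlsEnergy_nonpos hp (hx.trans_le h0)
    have hev : ∀ᶠ s in 𝓝 x, |(γ s).1| < M ∧ |(γ s).2| < M :=
      ((continuous_fst.comp hc).abs.continuousAt.eventually_lt continuousAt_const
        (h1.trans_lt hM)).and
      ((continuous_snd.comp hc).abs.continuousAt.eventually_lt continuousAt_const
        (h2.trans_lt hM))
    obtain ⟨ε, hε, hb⟩ := Metric.eventually_nhds_iff.1 hev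
    have hy' : x < y := hy
    set z := min y (x + ε / 2) with hz
    have hxz : x < z := lt_min hy' (by linarith)
    refine ⟨z, ?_, hxz, min_le_left _ _⟩
    have hd : ∀ s ∈ Icc x z, HasDerivAt (fun t ↦ nlsEnergy p (γ t).1 (γ t).2) 0 s := by
      intro s hs
      have hs' : dist s x < ε := by
        rw [Real.dist_eq, abs_of_nonneg (by linarith [hs.1])]
        linarith [hs.2, min_le_right y (x + ε / 2)]
      obtain ⟨b1, b2⟩ := hb hs'
      have h := hγ s
      rw [nlsField_of_abs_le b1.le b2.le] at h
      exact hasDerivAt_nlsEnergy (g := fun t ↦ (γ t).2) hp h.fst h.snd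
    have := constant_of_has_deriv_right_zero
      (fun s hs ↦ (hd s hs).continuousAt.continuousWithinAt)
      (fun s hs ↦ (hd s (Ico_subset_Icc_self hs)).hasDerivWithinAt) z (right_mem_Icc.2 hxz.le)
    exact this.trans hx
  exact key (right_mem_Icc.2 ht)

theorem eq_of_hasDerivAt_nlsField {p M : ℝ} (hp : 2 < p) (hM : 0 ≤ M) {α β : ℝ → ℝ × ℝ}
    (hα : ∀ t, HasDerivAt α (nlsField p M (α t)) t)
    (hβ : ∀ t, HasDerivAt β (nlsField p M (β t)) t) (h0 : α 0 = β 0) {t : ℝ} (ht : 0 ≤ t) :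
    α t = β t := by
  obtain ⟨K, hK⟩ := exists_lipschitzWith_nlsField hp hM
  have := dist_le_of_hasDerivAt_nlsField hK (fun t _ ↦ hα t) (fun t _ ↦ hβ t)
    (right_mem_Icc.2 ht)
  rwa [h0, dist_self, zero_mul, dist_le_zero] at this

theorem nlsForce_zero (p : ℝ) : nlsForce p 0 = 0 := by simp [nlsForce]

theorem nlsForce_one (p : ℝ) : nlsForce p 1 = 0 := by simp [nlsForce]

theorem hasDerivAt_nlsField_const {p M c : ℝ} (hM : 0 ≤ M) (hc : nlsForce p (clamp M c) = 0)
    (t : ℝ) : HasDerivAt (fun _ : ℝ ↦ (c, (0 : ℝ))) (nlsField p M (c, 0)) t := by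
  rw [nlsField, hc, clamp_of_abs_le (by simpa using hM)]
  exact hasDerivAt_const t _

/-- A symmetric solution on `[-ℓ, ℓ]` whose end data match those of solitons, up to a prescribed
ratio of the slopes. -/
theorem exists_symmetric_solution {p ℓ N m : ℝ} (hp : 2 < p) (hℓ : 0 < ℓ) (hmN : m ^ 2 ≤ N ^ 2) :
    ∃ f k : ℝ → ℝ, IsNLSSolution p (Icc (-ℓ) ℓ) f k ∧ k 0 = 0 ∧ f (-ℓ) = f ℓ ∧ k (-ℓ) = -k ℓ ∧
      f ℓ ≠ 0 ∧ |f ℓ| ≤ solitonMax p ∧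
      N ^ 2 * k ℓ ^ 2 = m ^ 2 * (f ℓ ^ 2 - 2 / p * |f ℓ| ^ p) := by
  have hB := one_le_solitonMax hp
  set M := solitonMax p + 1 with hMdef
  have hM : 0 ≤ M := by linarith
  have hBM : solitonMax p < M := by linarith
  -- Shooting from the maximum candidate (A, 0) at time 0; the amplitude A ranges between the
  -- constant solution 1 and the top of the soliton.
  choose γ hγ0 hγ using fun A : ℝ ↦ exists_flow hp hM (A, 0)
  have hE0 : ∀ A ∈ Icc 1 (solitonMax p), nlsEnergy p (γ A 0).1 (γ A 0).2 ≤ 0 := by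
    intro A hA
    have hA0 : |A| ≤ solitonMax p := by rw [abs_of_nonneg (by linarith [hA.1])]; exact hA.2
    rw [hγ0, nlsEnergy_eq hp]
    have := abs_rpow_sub_two_le hp hA0
    nlinarith [sq_nonneg A]
  have hE : ∀ A ∈ Icc 1 (solitonMax p), ∀ t, 0 ≤ t →
      nlsEnergy p (γ A t).1 (γ A t).2 = nlsEnergy p (γ A 0).1 (γ A 0).2 := fun A hA t ht ↦
    nlsEnergy_eq_of_hasDerivAt_nlsField hp hBM (hγ A) (hE0 A hA) ht
  have hb : ∀ A ∈ Icc 1 (solitonMax p), ∀ t, 0 ≤ t →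
      |(γ A t).1| ≤ solitonMax p ∧ |(γ A t).2| ≤ solitonMax p := fun A hA t ht ↦
    abs_le_solitonMax_of_nlsEnergy_nonpos hp ((hE A hA t ht).trans_le (hE0 A hA))
  have hcont : Continuous fun A ↦ γ A ℓ := by
    obtain ⟨K, hK⟩ := exists_lipschitzWith_nlsField hp hM
    refine (LipschitzWith.of_dist_le_mul (K := (Real.exp (K * ℓ)).toNNReal)
      fun A A' ↦ ?_).continuous
    have h := dist_le_of_hasDerivAt_nlsField hK (fun t _ ↦ hγ A t) (fun t _ ↦ hγ A' t)
      (right_mem_Icc.2 hℓ.le)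
    have hd : dist ((A, 0) : ℝ × ℝ) (A', 0) = dist A A' := by simp [Prod.dist_eq]
    rw [hγ0, hγ0, hd] at h
    rw [Real.coe_toNNReal _ (Real.exp_pos _).le, mul_comm]
    exact h
  have hF : Continuous fun A ↦ N ^ 2 * (γ A ℓ).2 ^ 2 -
      m ^ 2 * ((γ A ℓ).1 ^ 2 - 2 / p * |(γ A ℓ).1| ^ p) := by
    have h1 : Continuous fun A ↦ (γ A ℓ).1 := continuous_fst.comp hcont
    have h2 : Continuous fun A ↦ (γ A ℓ).2 := continuous_snd.comp hcont
    exact (continuous_const.mul (h2.pow 2)).sub (continuous_const.mul ((h1.pow 2).sub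
      (continuous_const.mul (h1.abs.rpow_const fun x ↦ Or.inr (by linarith)))))
  -- For A = 1 the solution is constant, the slope is zero and the bracket is 1 - 2/p ≥ 0.
  have hF1 : N ^ 2 * (γ 1 ℓ).2 ^ 2 - m ^ 2 * ((γ 1 ℓ).1 ^ 2 - 2 / p * |(γ 1 ℓ).1| ^ p) ≤ 0 := by
    have e : γ 1 ℓ = (1, 0) :=
      eq_of_hasDerivAt_nlsField (β := fun _ ↦ (1, 0)) hp hM (hγ 1)
        (hasDerivAt_nlsField_const hM
          (by rw [clamp_of_abs_le (by rw [abs_one]; linarith), nlsForce_one])) (hγ0 1) hℓ.le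
    rw [e]
    have : 2 / p ≤ 1 := by rw [div_le_one (by linarith)]; linarith
    simp only [abs_one, Real.one_rpow]
    nlinarith [sq_nonneg m]
  -- For A = `solitonMax p` the energy is zero, so the bracket equals the squared slope and m² ≤ N²
  -- decides the sign.
  have hF2 : 0 ≤ N ^ 2 * (γ (solitonMax p) ℓ).2 ^ 2 - m ^ 2 *
      ((γ (solitonMax p) ℓ).1 ^ 2 - 2 / p * |(γ (solitonMax p) ℓ).1| ^ p) := by
    have e := hE _ (right_mem_Icc.2 hB) ℓ hℓ.le
    rw [hγ0, nlsEnergy_eq hp (solitonMax p), abs_of_pos (solitonMax_pos hp),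
      solitonMax_rpow hp, show (2 / p * (p / 2)) = 1 by
        have : p ≠ 0 := by linarith
        field_simp, nlsEnergy] at e
    have e2 : (γ (solitonMax p) ℓ).1 ^ 2 - 2 / p * |(γ (solitonMax p) ℓ).1| ^ p =
        (γ (solitonMax p) ℓ).2 ^ 2 := by linarith
    rw [e2]
    nlinarith [sq_nonneg (γ (solitonMax p) ℓ).2]
  obtain ⟨A, hA, hFA⟩ := intermediate_value_Icc hB hF.continuousOn ⟨hF1, hF2⟩
  have hrev := hasDerivAt_nlsField_reverse hM (hγ A)
  have hsymm : ∀ t, 0 ≤ t → γ A (-t) = ((γ A t).1, -(γ A t).2) := by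
    intro t ht
    have h := eq_of_hasDerivAt_nlsField hp hM (hrev 0) (hγ A) (by simp [hγ0]) ht
    rw [zero_sub] at h
    rw [← h]
    simp
  have hb' : ∀ t, |(γ A t).1| ≤ solitonMax p ∧ |(γ A t).2| ≤ solitonMax p := by
    intro t
    rcases le_total 0 t with ht | ht
    · exact hb A hA t ht
    · have h := hsymm (-t) (by linarith)
      rw [neg_neg] at h
      rw [h, abs_neg]
      exact hb A hA (-t) (by linarith)
  have hcl : ∀ t, clamp M (γ A t).2 = (γ A t).2 := fun t ↦
    clamp_of_abs_le ((hb' t).2.trans hBM.le)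
  refine ⟨fun t ↦ (γ A t).1, fun t ↦ clamp M (γ A t).2,
    IsNLSSolution.of_hasDerivAt_nlsField (hγ A)
      fun t _ ↦ ⟨(hb' t).1.trans_lt hBM, (hb' t).2.trans_lt hBM⟩, ?_, ?_, ?_, ?_, (hb' ℓ).1, ?_⟩
  · beta_reduce; rw [hcl, hγ0]
  · beta_reduce; rw [hsymm ℓ hℓ.le]
  · beta_reduce; rw [hcl, hcl, hsymm ℓ hℓ.le]
  -- If the end value were 0, nonpositive energy would make the slope 0 too; running time backwards
  -- from the origin gives the zero solution, against A ≥ 1.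
  · intro hz
    beta_reduce at hz
    have hle := (hE A hA ℓ hℓ.le).trans_le (hE0 A hA)
    rw [nlsEnergy_eq hp, hz] at hle
    have hz2 : (γ A ℓ).2 = 0 := by nlinarith [sq_nonneg (γ A ℓ).2]
    have h := eq_of_hasDerivAt_nlsField (β := fun _ ↦ (0, 0)) hp hM (hrev ℓ)
      (hasDerivAt_nlsField_const hM
        (by rw [clamp_of_abs_le (by rwa [abs_zero]), nlsForce_zero])) (by simp [hz, hz2]) hℓ.le
    simp only [sub_self, hγ0, Prod.mk.injEq] at h
    linarith [hA.1, h.1]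
  · beta_reduce at hFA ⊢
    rw [hcl]
    linarith

theorem IsNLSSolution.comp_add_const {p a : ℝ} {I J : Set ℝ} {U g : ℝ → ℝ}
    (h : IsNLSSolution p I U g) (hJ : ∀ x ∈ J, x + a ∈ I) :
    IsNLSSolution p J (fun x ↦ U (x + a)) (fun x ↦ g (x + a)) :=
  ⟨fun x ↦ (h.hasDerivAt (x + a)).comp_add_const x a, h.continuous_deriv.comp (by fun_prop),
    fun x hx ↦ (h.hasDerivAt_deriv (x + a) (hJ x hx)).comp_add_const x a⟩

/-! ### Existence of a stationary solution -/

namespace SingleKnotGraph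

variable {G : SingleKnotGraph} {p ℓ : ℝ}

/-- A graph without compact edges carries the soliton, with its maximum at the knot. -/
theorem isStationary_soliton (hp : 2 < p) (hP : G.P = 0) (hL : G.L = 0) :
    G.IsStationary p (fun _ ↦ soliton p) (fun _ ↦ solitonDeriv p) := by
  have : IsEmpty (Fin G.P) := by rw [hP]; infer_instance
  have : IsEmpty (Fin G.L) := by rw [hL]; infer_instance
  refine ⟨fun e ↦ ?_, ?_, ?_, fun _ _ ↦ rfl, isEmptyElim, isEmptyElim, ?_⟩
  · simpa using isNLSSolution_soliton hp (G.interval e) (κ := 1) (by simp) 0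
  · rintro (i | i | i)
    · have := memLp_soliton hp 0
      simp only [add_zero] at this
      exact this
    · exact isEmptyElim i
    · exact isEmptyElim i
  · rintro (i | i | i)
    · have := memLp_solitonDeriv hp 0
      simp only [add_zero] at this
      exact this
    · exact isEmptyElim i
    · exact isEmptyElim i
  · simp [solitonDeriv_zero]

/-- All compact edges carry the same even profile f, so together they add -(P + 2L) k(ℓ) to the
Kirchhoff sum. The half-lines carry solitons cut at a with alternating signs of the shift, whose
slopes add up to ±m times that at a, with m = 0 or 1 by the parity of H. The balance of the two is
the squared relation of `exists_symmetric_solution`, up to signs. -/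
theorem exists_isStationary_of_compact_edges (hp : 2 < p) (hℓ : 0 < ℓ) (hG : G.IsRegular ℓ)
    (hN : 1 ≤ G.P + 2 * G.L) :
    ∃ U g : G.Edge → ℝ → ℝ, G.IsStationary p U g ∧ ∃ e, ∃ x ∈ G.interval e, U e x ≠ 0 := by
  set m : ℝ := ∑ i : Fin G.H, (-1 : ℝ) ^ i.1 with hm
  have hm1 : m ^ 2 ≤ 1 := by
    rw [hm, Fin.sum_neg_one_pow]
    split_ifs <;> norm_num
  have hN' : (1 : ℝ) ≤ (G.P + 2 * G.L : ℝ) := by exact_mod_cast hN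
  obtain ⟨f, k, hf, hk0, hfs, hks, hf0, hfB, hmatch⟩ :=
    exists_symmetric_solution (N := G.P + 2 * G.L) (m := m) hp hℓ (by nlinarith)
  -- The shooting argument does not control the sign of f(ℓ); the sign κ adapts the solitons to it.
  obtain ⟨κ, hκ, hκf⟩ : ∃ κ : ℝ, |κ| = 1 ∧ κ * |f ℓ| = f ℓ := by
    rcases abs_cases (f ℓ) with h | h
    · exact ⟨1, by simp, by rw [h.1, one_mul]⟩
    · exact ⟨-1, by simp, by rw [h.1]; ring⟩
  have hκ2 : κ ^ 2 = 1 := by rw [← sq_abs, hκ, one_pow]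
  obtain ⟨a, -, ha⟩ := exists_soliton_eq hp (abs_pos.2 hf0) hfB
  have hda : solitonDeriv p a ^ 2 = f ℓ ^ 2 - 2 / p * |f ℓ| ^ p := by
    have := nlsEnergy_soliton hp a
    rw [ha, nlsEnergy, abs_abs, sq_abs] at this
    linarith
  -- The matching relation holds only for squares. The remaining sign is absorbed by reversing all
  -- shifts at once.
  obtain ⟨τ, hτ, hτk⟩ : ∃ τ : ℝ, (τ = 1 ∨ τ = -1) ∧
      κ * (τ * m) * solitonDeriv p a = (G.P + 2 * G.L) * k ℓ := by
    have h : ((G.P + 2 * G.L) * k ℓ) ^ 2 = (κ * m * solitonDeriv p a) ^ 2 := by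
      rw [mul_pow, mul_pow, mul_pow, hmatch, hda, hκ2, one_mul]
    rcases sq_eq_sq_iff_eq_or_eq_neg.1 h with h | h
    · exact ⟨1, Or.inl rfl, by rw [h]; ring⟩
    · exact ⟨-1, Or.inr rfl, by rw [h]; ring⟩
  have hσ : ∀ i : ℕ, τ * (-1) ^ i = 1 ∨ τ * (-1) ^ i = -1 := by
    intro i
    rcases neg_one_pow_eq_or ℝ i with h | h <;> rcases hτ with h' | h' <;> rw [h, h'] <;> norm_num
  have hsol : ∀ i : ℕ, soliton p (τ * (-1) ^ i * a) = soliton p a := by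
    intro i
    rcases hσ i with h | h <;> rw [h]
    · rw [one_mul]
    · rw [neg_one_mul, soliton_neg]
  have hsold : ∀ i : ℕ, solitonDeriv p (τ * (-1) ^ i * a) = τ * (-1) ^ i * solitonDeriv p a := by
    intro i
    rcases hσ i with h | h <;> rw [h]
    · rw [one_mul, one_mul]
    · rw [neg_one_mul, solitonDeriv_neg, neg_one_mul]
  -- The profile is moved by ℓ: the knot sits at -ℓ (and at ℓ on a loop), the tip of a pendant at
  -- the critical point 0.
  let U : G.Edge → ℝ → ℝ :=
    Sum.elim (fun i x ↦ κ * soliton p (x + τ * (-1) ^ i.1 * a)) (fun _ x ↦ f (x + -ℓ))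
  let g : G.Edge → ℝ → ℝ :=
    Sum.elim (fun i x ↦ κ * solitonDeriv p (x + τ * (-1) ^ i.1 * a)) (fun _ x ↦ k (x + -ℓ))
  have hU0 : ∀ e, U e 0 = f ℓ := by
    rintro (i | e)
    · simp only [U, Sum.elim_inl, zero_add]
      rw [hsol, ha, hκf]
    · simp [U, hfs]
  have hsolU : ∀ e, IsNLSSolution p (G.interval e) (U e) (g e) := by
    rintro (i | i | j)
    · exact isNLSSolution_soliton hp _ hκ _
    · refine hf.comp_add_const fun x hx ↦ ?_
      have hx' : x ∈ Icc 0 (G.pendantLength i) := hx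
      rw [hG.1 i] at hx'
      constructor <;> linarith [hx'.1, hx'.2]
    · refine hf.comp_add_const fun x hx ↦ ?_
      have hx' : x ∈ Icc 0 (G.loopLength j) := hx
      rw [hG.2 j] at hx'
      constructor <;> linarith [hx'.1, hx'.2]
  refine ⟨U, g, ⟨hsolU, ?_, ?_, fun e e' ↦ by rw [hU0, hU0], fun j ↦ ?_, fun i ↦ ?_, ?_⟩, ?_⟩
  · rintro (i | i | j)
    · exact (memLp_soliton hp _).const_mul κ
    · exact memLp_two_Icc_of_continuous (hsolU (.inr (.inl i))).continuous _ _
    · exact memLp_two_Icc_of_continuous (hsolU (.inr (.inr j))).continuous _ _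
  · rintro (i | i | j)
    · exact (memLp_solitonDeriv hp _).const_mul κ
    · exact memLp_two_Icc_of_continuous (hsolU (.inr (.inl i))).continuous_deriv _ _
    · exact memLp_two_Icc_of_continuous (hsolU (.inr (.inr j))).continuous_deriv _ _
  · rw [hU0, hG.2 j]
    simp only [U, Sum.elim_inr]
    congr 1
    ring
  · rw [hG.1 i]
    simp [g, hk0]
  · simp only [g, Sum.elim_inl, Sum.elim_inr, zero_add, hsold, hG.2, hks]
    rw [show 2 * ℓ + -ℓ = ℓ by ring]
    simp only [Finset.sum_const, Finset.card_univ, Fintype.card_fin, nsmul_eq_mul]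
    have : ∑ i : Fin G.H, κ * (τ * (-1) ^ i.1 * solitonDeriv p a) =
        κ * (τ * m) * solitonDeriv p a := by
      rw [hm, Finset.mul_sum, Finset.mul_sum, Finset.sum_mul]
      exact Finset.sum_congr rfl fun i _ ↦ by ring
    rw [this, hτk]
    ring
  · exact ⟨.inl ⟨0, G.one_le_H⟩, 0, (G.isEdgeInterval _).zero_mem, by rwa [hU0]⟩

end SingleKnotGraph

/-! ### Solutions of zero energy -/

namespace IsNLSSolution

variable {p : ℝ} {I : Set ℝ} {U g : ℝ → ℝ}

theorem neg (h : IsNLSSolution p I U g) : IsNLSSolution p I (fun x ↦ -U x) (fun x ↦ -g x) :=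
  ⟨fun x ↦ (h.hasDerivAt x).neg, h.continuous_deriv.neg, fun x hx ↦ by
    rw [nlsForce_neg]; exact (h.hasDerivAt_deriv x hx).neg⟩

/-- Square integrable solutions on a half-line have zero energy. -/
theorem energy_eq_zero (hp : 2 < p) (h : IsNLSSolution p (Ici 0) U g)
    (hU : MemLp U 2 (volume.restrict (Ici 0))) (hg : MemLp g 2 (volume.restrict (Ici 0)))
    {x : ℝ} (hx : 0 ≤ x) : nlsEnergy p (U x) (g x) = 0 := by
  have hI : IsEdgeInterval (Ici 0) := Or.inl rfl
  have hint : IntegrableOn (fun x ↦ g x ^ 2 - U x ^ 2 +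
      2 / p * (U x * U x - nlsForce p (U x) * U x)) (Ici 0) :=
    (hg.integrable_sq.sub hU.integrable_sq).add
      (((hU.integrable_mul hU).sub ((h.memLp_nlsForce hp hI hU hg).integrable_mul hU)).const_mul _)
  -- The energy is a constant that is integrable over a set of infinite measure.
  have hc : IntegrableOn (fun _ : ℝ ↦ nlsEnergy p (U 0) (g 0)) (Ici 0) := by
    refine hint.congr_fun (fun x hx ↦ ?_) measurableSet_Ici
    beta_reduce
    rw [← h.energy_eq hp hI hx, nlsEnergy, nlsForce, ← abs_rpow_sub_two_mul_sq hp]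
    ring
  rw [integrableOn_const_iff] at hc
  rw [h.energy_eq hp hI hx]
  rcases hc with hc | hc
  · simpa using hc
  · simp at hc

theorem abs_deriv_le_of_energy_eq_zero (hp : 2 < p) {x y : ℝ} (h : nlsEnergy p x y = 0) :
    |y| ≤ |x| := by
  have h4 : 0 ≤ 2 / p * |x| ^ p := by
    have := Real.rpow_nonneg (abs_nonneg x) p
    positivity
  rw [nlsEnergy] at h
  exact sq_le_sq.1 (by linarith)

/-- Solutions of zero energy vanish identically or nowhere. -/
theorem eq_zero_of_energy_eq_zero (hp : 2 < p) (hI : IsEdgeInterval I) (h : IsNLSSolution p I U g)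
    (hE : nlsEnergy p (U 0) (g 0) = 0) {y : ℝ} (hy : y ∈ I) (hUy : U y = 0) :
    ∀ x ∈ I, U x = 0 := by
  have hle : ∀ x ∈ I, |U x * g x| ≤ U x ^ 2 := fun x hx ↦ by
    have := abs_deriv_le_of_energy_eq_zero hp ((h.energy_eq hp hI hx).trans hE)
    rw [abs_mul, ← sq_abs]
    nlinarith [abs_nonneg (U x)]
  -- Since |U U'| ≤ U², the function U² exp(2x) increases and U² exp(-2x) decreases. The first
  -- carries a zero at y back to 0, the second carries it from 0 to every point.
  have hd : ∀ κ x : ℝ, HasDerivAt (fun x ↦ U x ^ 2 * Real.exp (κ * x))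
      ((2 * (U x * g x) + κ * U x ^ 2) * Real.exp (κ * x)) x := fun κ x ↦ by
    have h1 : HasDerivAt (fun x : ℝ ↦ κ * x) κ x := by simpa using (hasDerivAt_id x).const_mul κ
    refine (((h.hasDerivAt x).pow 2).mul h1.exp).congr_deriv ?_
    simp only [Pi.pow_apply]
    push_cast
    ring
  have hcont : ∀ κ : ℝ, ∀ s : Set ℝ, ContinuousOn (fun x ↦ U x ^ 2 * Real.exp (κ * x)) s :=
    fun κ s x _ ↦ (hd κ x).continuousAt.continuousWithinAt
  have hU0 : U 0 = 0 := by
    have hmono : MonotoneOn (fun x ↦ U x ^ 2 * Real.exp (2 * x)) (Icc 0 y) := by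
      refine monotoneOn_of_deriv_nonneg (convex_Icc _ _) (hcont 2 _)
        (fun x _ ↦ (hd 2 x).differentiableAt.differentiableWithinAt) fun x hx ↦ ?_
      rw [(hd 2 x).deriv]
      have := hle x (hI.Icc_subset hy (interior_subset hx))
      exact mul_nonneg (by linarith [(abs_le.1 this).1]) (Real.exp_pos _).le
    have h0 := hmono (left_mem_Icc.2 (hI.nonneg hy)) (right_mem_Icc.2 (hI.nonneg hy))
      (hI.nonneg hy)
    simp only [hUy, mul_zero, Real.exp_zero, mul_one] at h0
    nlinarith [sq_nonneg (U 0)]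
  intro x hx
  have hanti : AntitoneOn (fun x ↦ U x ^ 2 * Real.exp (-2 * x)) (Icc 0 x) := by
    refine antitoneOn_of_deriv_nonpos (convex_Icc _ _) (hcont (-2) _)
      (fun t _ ↦ (hd (-2) t).differentiableAt.differentiableWithinAt) fun t ht ↦ ?_
    rw [(hd (-2) t).deriv]
    have := hle t (hI.Icc_subset hx (interior_subset ht))
    exact mul_nonpos_of_nonpos_of_nonneg (by linarith [(abs_le.1 this).2]) (Real.exp_pos _).le
  have h0 := hanti (left_mem_Icc.2 (hI.nonneg hx)) (right_mem_Icc.2 (hI.nonneg hx))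
    (hI.nonneg hx)
  simp only [hU0, mul_zero] at h0
  have h1 : 0 ≤ U x ^ 2 * Real.exp (-2 * x) := by positivity
  have h2 : U x ^ 2 * Real.exp (-2 * x) = 0 := le_antisymm (h0.trans_eq (by simp)) h1
  simpa using h2

end IsNLSSolution

/-! ### Small positive solutions and the linear equation -/

theorem nlsEnergy_nonpos {p x : ℝ} (hp : 2 < p) (hx : |x| ≤ solitonMax p) :
    nlsEnergy p x 0 ≤ 0 := by
  rw [nlsEnergy_eq hp]
  nlinarith [abs_rpow_sub_two_le hp hx, sq_nonneg x]

theorem nlsEnergy_neg_of_ne_zero {p x : ℝ} (hp : 2 < p) (hx0 : x ≠ 0) (hx : |x| < solitonMax p) :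
    nlsEnergy p x 0 < 0 := by
  have h := Real.rpow_lt_rpow (abs_nonneg x) hx (show 0 < p - 2 by linarith)
  rw [solitonMax_rpow hp] at h
  have h1 : 2 / p * |x| ^ (p - 2) < 1 := by
    calc 2 / p * |x| ^ (p - 2) < 2 / p * (p / 2) := by gcongr
      _ = 1 := by have : p ≠ 0 := by linarith
                  field_simp
  rw [nlsEnergy_eq hp]
  have : 0 < x ^ 2 := by positivity
  nlinarith

/-- For small `x`, the force `nlsForce p x` lies between `θ r` and `r`, where
`r² = x² - (2/p) |x|^p`. -/
theorem nlsForce_bounds {p x r θ : ℝ} (hp : 2 < p) (hθ0 : 0 < θ) (hx : 0 < x)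
    (hxθ : x ^ (p - 2) ≤ 1 - θ) (hr : 0 < r) (hr2 : r ^ 2 = x ^ 2 - 2 / p * |x| ^ p) :
    0 < nlsForce p x ∧ θ * r ≤ nlsForce p x ∧ nlsForce p x < r := by
  have hy0 : 0 < x ^ (p - 2) := Real.rpow_pos_of_pos hx _
  have hh : nlsForce p x = x * (1 - x ^ (p - 2)) := by rw [nlsForce, abs_of_pos hx]; ring
  have hr2' : r ^ 2 = x ^ 2 * (1 - 2 / p * x ^ (p - 2)) := by
    rw [hr2, ← abs_rpow_sub_two_mul_sq hp, abs_of_pos hx]; ring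
  set y := x ^ (p - 2) with hy
  have hp1 : 0 < 2 / p := by have : 0 < p := by linarith
                             positivity
  have hp2 : 2 / p < 1 := by rw [div_lt_one (by linarith)]; linarith
  have hrx : r ≤ x := by
    refine le_of_sq_le_sq ?_ hx.le
    rw [hr2']
    nlinarith [sq_nonneg x, mul_pos hp1 hy0]
  refine ⟨?_, ?_, ?_⟩
  · rw [hh]; exact mul_pos hx (by linarith)
  · rw [hh]; nlinarith
  · rw [hh]
    refine lt_of_pow_lt_pow_left₀ 2 hr.le ?_
    rw [hr2', mul_pow]
    -- The difference of the two sides is y (2 - 2/p - y), positive because 0 < y < 1 and 2/p < 1.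
    have : (1 - y) ^ 2 < 1 - 2 / p * y := by nlinarith
    have hx2 : 0 < x ^ 2 := by positivity
    exact mul_lt_mul_of_pos_left this hx2

namespace IsNLSSolution

variable {p : ℝ} {U g : ℝ → ℝ}

/-- Comparison of a small positive solution with the solutions of the linear equation: the quantity
`r - U'`, where `r² = U² - (2/p) |U|^p`, decays at a rate between `θ` and `1`. -/
theorem exists_comparison (hp : 2 < p) {a θ δ : ℝ} (ha : 0 < a) (hθ0 : 0 < θ) (hθ1 : θ < 1)
    (hδ : δ ^ (p - 2) ≤ 1 - θ) (h : IsNLSSolution p (Icc 0 a) U g)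
    (hU : ∀ x ∈ Icc 0 a, |U x| ≤ δ) (h0 : 0 < U 0) {y : ℝ} (hy : y ∈ Icc 0 a) (hgy : g y = 0) :
    ∃ w > 0, g 0 ^ 2 + w = U 0 ^ 2 - 2 / p * |U 0| ^ p ∧
      g a ^ 2 + w = U a ^ 2 - 2 / p * |U a| ^ p ∧
      √(g 0 ^ 2 + w) - g 0 < (√(g a ^ 2 + w) - g a) * Real.exp a ∧
      (√(g a ^ 2 + w) - g a) * Real.exp (θ * a) ≤ √(g 0 ^ 2 + w) - g 0 ∧ g 0 < g a := by
  have hI : IsEdgeInterval (Icc 0 a) := Or.inr ⟨a, ha, rfl⟩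
  have hp2 : 0 < p - 2 := by linarith
  have h0I : (0 : ℝ) ∈ Icc 0 a := left_mem_Icc.2 ha.le
  have haI : a ∈ Icc 0 a := right_mem_Icc.2 ha.le
  have hδ0 : 0 ≤ δ := (abs_nonneg _).trans (hU 0 h0I)
  have hδB : δ < solitonMax p := by
    refine lt_of_lt_of_le ?_ (one_le_solitonMax hp)
    by_contra hcon
    have := Real.one_le_rpow (not_lt.1 hcon) hp2.le
    linarith
  -- With w the negative of the conserved energy, r² = g² + w. A critical point with small nonzero
  -- value makes w positive, so r stays away from zero and is differentiable.
  set w : ℝ := -nlsEnergy p (U 0) (g 0) with hw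
  have hwx : ∀ x ∈ Icc 0 a, g x ^ 2 + w = U x ^ 2 - 2 / p * |U x| ^ p := fun x hx ↦ by
    rw [hw, ← h.energy_eq hp hI hx, nlsEnergy]
    ring
  have hUy : U y ≠ 0 := by
    intro hz
    have hE : nlsEnergy p (U 0) (g 0) = 0 := by
      rw [← h.energy_eq hp hI hy, nlsEnergy_eq hp, hz, hgy]; ring
    exact h0.ne' (h.eq_zero_of_energy_eq_zero hp hI hE hy hz 0 h0I)
  have hw0 : 0 < w := by
    rw [hw, ← h.energy_eq hp hI hy, hgy]
    linarith [nlsEnergy_neg_of_ne_zero hp hUy ((hU y hy).trans_lt hδB)]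
  have hUne : ∀ x ∈ Icc 0 a, U x ≠ 0 := by
    intro x hx hz
    have := hwx x hx
    rw [hz, abs_zero, Real.zero_rpow (by linarith)] at this
    nlinarith [sq_nonneg (g x)]
  have hUpos : ∀ x ∈ Icc 0 a, 0 < U x := by
    intro x hx
    by_contra hcon
    obtain ⟨z, hz, hz0⟩ := intermediate_value_Icc' hx.1 h.continuous.continuousOn
      ⟨not_lt.1 hcon, h0.le⟩
    exact hUne z (hI.Icc_subset hx hz) hz0
  have hpos : ∀ x, 0 < g x ^ 2 + w := fun x ↦ by positivity
  have hbd : ∀ x ∈ Icc 0 a, 0 < nlsForce p (U x) ∧ θ * √(g x ^ 2 + w) ≤ nlsForce p (U x) ∧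
      nlsForce p (U x) < √(g x ^ 2 + w) := by
    intro x hx
    refine nlsForce_bounds hp hθ0 (hUpos x hx) ?_ (Real.sqrt_pos.2 (hpos x)) ?_
    · refine (Real.rpow_le_rpow (hUpos x hx).le ?_ hp2.le).trans hδ
      exact (le_abs_self _).trans (hU x hx)
    · rw [Real.sq_sqrt (hpos x).le, hwx x hx]
  -- Writing F for the force, r' = g F / r, so (r - g)' = -(F / r)(r - g), and F / r lies in [θ, 1).
  -- The weights exp(x) and exp(θx) then turn r - g into an increasing and a decreasing function.
  have hd : ∀ κ : ℝ, ∀ x ∈ Icc 0 a, HasDerivAt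
      (fun x ↦ (√(g x ^ 2 + w) - g x) * Real.exp (κ * x))
      ((√(g x ^ 2 + w) - g x) * (κ - nlsForce p (U x) / √(g x ^ 2 + w)) * Real.exp (κ * x)) x := by
    intro κ x hx
    have hg := h.hasDerivAt_deriv x hx
    have h1 : HasDerivAt (fun x : ℝ ↦ κ * x) κ x := by simpa using (hasDerivAt_id x).const_mul κ
    have h2 : HasDerivAt (fun x ↦ √(g x ^ 2 + w))
        (2 * g x * nlsForce p (U x) / (2 * √(g x ^ 2 + w))) x := by
      have := ((hg.pow 2).add_const w).sqrt (hpos x).ne'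
      exact this.congr_deriv (by simp)
    refine ((h2.sub hg).mul h1.exp).congr_deriv ?_
    have hr := (Real.sqrt_pos.2 (hpos x)).ne'
    simp only [Pi.sub_apply]
    field_simp
    ring
  have hcont : ∀ κ : ℝ, ContinuousOn (fun x ↦ (√(g x ^ 2 + w) - g x) * Real.exp (κ * x))
      (Icc 0 a) := fun κ x hx ↦ (hd κ x hx).continuousAt.continuousWithinAt
  have hA : ∀ x, 0 < √(g x ^ 2 + w) - g x := fun x ↦ by
    have : |g x| < √(g x ^ 2 + w) := by
      rw [← Real.sqrt_sq_eq_abs]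
      exact Real.sqrt_lt_sqrt (sq_nonneg _) (by linarith)
    linarith [le_abs_self (g x)]
  refine ⟨w, hw0, hwx 0 h0I, hwx a haI, ?_, ?_, ?_⟩
  · have hmono : StrictMonoOn (fun x ↦ (√(g x ^ 2 + w) - g x) * Real.exp (1 * x)) (Icc 0 a) := by
      refine strictMonoOn_of_deriv_pos (convex_Icc _ _) (hcont 1) fun x hx ↦ ?_
      have hx' := interior_subset hx
      rw [(hd 1 x hx').deriv]
      have hr := Real.sqrt_pos.2 (hpos x)
      refine mul_pos (mul_pos (hA x) ?_) (Real.exp_pos _)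
      rw [sub_pos, div_lt_one hr]
      exact (hbd x hx').2.2
    simpa using hmono h0I haI ha
  · have hanti : AntitoneOn (fun x ↦ (√(g x ^ 2 + w) - g x) * Real.exp (θ * x)) (Icc 0 a) := by
      refine antitoneOn_of_deriv_nonpos (convex_Icc _ _) (hcont θ)
        (fun x hx ↦ (hd θ x (interior_subset hx)).differentiableAt.differentiableWithinAt)
        fun x hx ↦ ?_
      have hx' := interior_subset hx
      rw [(hd θ x hx').deriv]
      have hr := Real.sqrt_pos.2 (hpos x)
      refine mul_nonpos_of_nonpos_of_nonneg
        (mul_nonpos_of_nonneg_of_nonpos (hA x).le ?_) (Real.exp_pos _).le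
      rw [sub_nonpos, le_div_iff₀ hr]
      exact (hbd x hx').2.1
    simpa using hanti h0I haI ha.le
  · have hmono : StrictMonoOn g (Icc 0 a) := by
      refine strictMonoOn_of_deriv_pos (convex_Icc _ _) h.continuous_deriv.continuousOn
        fun x hx ↦ ?_
      rw [(h.hasDerivAt_deriv x (interior_subset hx)).deriv]
      exact (hbd x (interior_subset hx)).1
    exact hmono h0I haI ha

end IsNLSSolution

/-- As tanh b = (exp(2b) - 1) / (exp(2b) + 1), comparing s - t with (s + t) exp(2b) is the same as
comparing -t with s tanh b. This turns decay estimates for r - g into slope estimates. -/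
theorem Real.tanh_mul_add (b s t : ℝ) :
    (s - t - (s + t) * Real.exp (2 * b)) =
      (-t - Real.tanh b * s) * (Real.exp (2 * b) + 1) := by
  have e : Real.exp (2 * b) = Real.exp b ^ 2 := by rw [← Real.exp_nat_mul]; norm_num
  have hpos := Real.exp_pos b
  rw [Real.tanh_eq, Real.exp_neg, e]
  have : (Real.exp b + (Real.exp b)⁻¹) ≠ 0 := by positivity
  field_simp
  ring

theorem Real.neg_lt_tanh_mul {b s t : ℝ} (h : s - t < (s + t) * Real.exp (2 * b)) :
    -t < Real.tanh b * s := by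
  have e := Real.tanh_mul_add b s t
  have hpos := Real.exp_pos (2 * b)
  by_contra hcon
  have : 0 ≤ (-t - Real.tanh b * s) * (Real.exp (2 * b) + 1) :=
    mul_nonneg (by linarith) (by positivity)
  linarith

theorem Real.tanh_mul_le_neg {b s t : ℝ} (h : (s + t) * Real.exp (2 * b) ≤ s - t) :
    Real.tanh b * s ≤ -t := by
  have e := Real.tanh_mul_add b s t
  have hpos := Real.exp_pos (2 * b)
  by_contra hcon
  have : (-t - Real.tanh b * s) * (Real.exp (2 * b) + 1) < 0 :=
    mul_neg_of_neg_of_pos (by linarith) (by positivity)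
  linarith

namespace IsNLSSolution

variable {p : ℝ} {U g : ℝ → ℝ}

/-- The slope at the knot of a small positive solution on a pendant. -/
theorem slope_pendant (hp : 2 < p) {a θ δ : ℝ} (ha : 0 < a) (hθ0 : 0 < θ) (hθ1 : θ < 1)
    (hδ : δ ^ (p - 2) ≤ 1 - θ) (h : IsNLSSolution p (Icc 0 a) U g)
    (hU : ∀ x ∈ Icc 0 a, |U x| ≤ δ) (h0 : 0 < U 0) (hga : g a = 0) {s : ℝ} (hs : 0 ≤ s)
    (hs2 : s ^ 2 = U 0 ^ 2 - 2 / p * |U 0| ^ p) :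
    0 < s ∧ Real.tanh (θ * a) * s ≤ -g 0 ∧ -g 0 < Real.tanh a * s := by
  obtain ⟨w, hw, e0, ea, h1, h2, -⟩ := h.exists_comparison hp ha hθ0 hθ1 hδ hU h0
    (right_mem_Icc.2 ha.le) hga
  have hss : √(g 0 ^ 2 + w) = s := by rw [e0, ← hs2, Real.sqrt_sq hs]
  have hs2' : s ^ 2 = g 0 ^ 2 + w := by rw [e0, hs2]
  rw [hss, hga, zero_pow two_ne_zero, zero_add, sub_zero] at h1 h2
  have habs : |g 0| < s := abs_lt_of_sq_lt_sq (by linarith) hs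
  obtain ⟨hg1, hg2⟩ := abs_lt.1 habs
  -- At the tip r - g equals √w, and w = (s - g 0)(s + g 0). Squaring the comparison and cancelling
  -- s - g 0 doubles the exponent, so a pendant of length a behaves like a loop of length 2a.
  have hw2 : √w ^ 2 = (s - g 0) * (s + g 0) := by rw [Real.sq_sqrt hw.le]; linarith
  have hexp : ∀ b : ℝ, Real.exp (2 * b) = Real.exp b ^ 2 := fun b ↦ by
    rw [← Real.exp_nat_mul]; norm_num
  refine ⟨by linarith [abs_nonneg (g 0)], Real.tanh_mul_le_neg ?_, Real.neg_lt_tanh_mul ?_⟩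
  · have h3 : (√w * Real.exp (θ * a)) ^ 2 ≤ (s - g 0) ^ 2 :=
      pow_le_pow_left₀ (by positivity) h2 2
    rw [mul_pow, hw2, ← hexp, pow_two (s - g 0), mul_assoc] at h3
    exact le_of_mul_le_mul_left h3 (by linarith)
  · have h3 : (s - g 0) ^ 2 < (√w * Real.exp a) ^ 2 :=
      pow_lt_pow_left₀ h1 (by linarith) two_ne_zero
    rw [mul_pow, hw2, ← hexp, pow_two (s - g 0), mul_assoc] at h3
    exact lt_of_mul_lt_mul_left h3 (by linarith)

/-- The slopes at the knot of a small positive solution on a loop. -/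
theorem slope_loop (hp : 2 < p) {a θ δ : ℝ} (ha : 0 < a) (hθ0 : 0 < θ) (hθ1 : θ < 1)
    (hδ : δ ^ (p - 2) ≤ 1 - θ) (h : IsNLSSolution p (Icc 0 (2 * a)) U g)
    (hU : ∀ x ∈ Icc 0 (2 * a), |U x| ≤ δ) (h0 : 0 < U 0) (hUa : U (2 * a) = U 0) {s : ℝ}
    (hs : 0 ≤ s) (hs2 : s ^ 2 = U 0 ^ 2 - 2 / p * |U 0| ^ p) :
    0 < s ∧ Real.tanh (θ * a) * s ≤ -g 0 ∧ -g 0 < Real.tanh a * s ∧ g (2 * a) = -g 0 := by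
  have ha2 : 0 < 2 * a := by linarith
  obtain ⟨y, hy, hgy⟩ := exists_hasDerivAt_eq_zero ha2 h.continuous.continuousOn hUa.symm
    fun x _ ↦ h.hasDerivAt x
  obtain ⟨w, hw, e0, ea, h1, h2, h3⟩ := h.exists_comparison hp ha2 hθ0 hθ1 hδ hU h0
    (Ioo_subset_Icc_self hy) hgy
  -- The energy gives equal slopes up to sign; equality is excluded because the force is positive
  -- and g increases strictly.
  have hg : g (2 * a) = -g 0 := by
    rw [hUa, ← e0] at ea
    rcases sq_eq_sq_iff_eq_or_eq_neg.1 (show g (2 * a) ^ 2 = g 0 ^ 2 by linarith) with h | h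
    · linarith
    · exact h
  have hss : √(g 0 ^ 2 + w) = s := by rw [e0, ← hs2, Real.sqrt_sq hs]
  rw [hg, neg_sq, hss, sub_neg_eq_add] at h1 h2
  have habs : |g 0| < s := abs_lt_of_sq_lt_sq (by rw [hs2, ← e0]; linarith) hs
  rw [mul_left_comm] at h2
  exact ⟨by linarith [abs_nonneg (g 0)], Real.tanh_mul_le_neg h2, Real.neg_lt_tanh_mul h1, hg⟩

end IsNLSSolution

/-! ### Exclusion of small stationary solutions -/

namespace SingleKnotGraph

variable {G : SingleKnotGraph} {p ℓ : ℝ} {U g : G.Edge → ℝ → ℝ}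

theorem IsStationary.neg (h : G.IsStationary p U g) :
    G.IsStationary p (fun e x ↦ -U e x) (fun e x ↦ -g e x) where
  sol e := (h.sol e).neg
  memLp e := (h.memLp e).neg
  memLp_deriv e := (h.memLp_deriv e).neg
  knot e e' := by rw [h.knot e e']
  loop j := by rw [h.loop j]
  neumann i := by rw [h.neumann i, neg_zero]
  kirchhoff := by
    have := h.kirchhoff
    simp only [Finset.sum_neg_distrib, Finset.sum_sub_distrib] at this ⊢
    linarith

theorem IsStationary.energy_halfLine (hp : 2 < p) (h : G.IsStationary p U g) (i : Fin G.H)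
    {x : ℝ} (hx : 0 ≤ x) : nlsEnergy p (U (.inl i) x) (g (.inl i) x) = 0 :=
  (h.sol (.inl i)).energy_eq_zero hp (h.memLp (.inl i)) (h.memLp_deriv (.inl i)) hx

/-- On a compact edge there is a critical point. -/
theorem IsStationary.exists_deriv_eq_zero (h : G.IsStationary p U g) (e : Fin G.P ⊕ Fin G.L) :
    ∃ y ∈ G.interval (.inr e), g (.inr e) y = 0 := by
  rcases e with i | j
  · exact ⟨_, interval_end_mem_pendant i, h.neumann i⟩
  · obtain ⟨y, hy, hgy⟩ := exists_hasDerivAt_eq_zero (G.loopLength_pos j)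
      (h.sol (.inr (.inr j))).continuous.continuousOn (h.loop j).symm
      fun x _ ↦ (h.sol (.inr (.inr j))).hasDerivAt x
    exact ⟨y, Ioo_subset_Icc_self hy, hgy⟩

/-- Small stationary solutions vanishing at the knot are zero. -/
theorem IsStationary.eq_zero_of_knot_eq_zero (hp : 2 < p) (h : G.IsStationary p U g)
    (h0 : ∀ e, U e 0 = 0) (hsmall : ∀ e, ∀ x ∈ G.interval (.inr e), |U (.inr e) x| ≤ solitonMax p) :
    ∀ e, ∀ x ∈ G.interval e, U e x = 0 := by
  intro e
  refine (h.sol e).eq_zero_of_energy_eq_zero hp (G.isEdgeInterval e) ?_ (G.isEdgeInterval e).zero_mem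
    (h0 e)
  rcases e with i | e
  · exact h.energy_halfLine hp i le_rfl
  · obtain ⟨y, hy, hgy⟩ := h.exists_deriv_eq_zero e
    -- The energy is nonpositive at a critical point of small value, and equals the squared slope at
    -- the knot, where U vanishes.
    refine le_antisymm ?_ ?_
    · rw [← (h.sol _).energy_eq hp (G.isEdgeInterval _) hy, hgy]
      exact nlsEnergy_nonpos hp (hsmall e y hy)
    · rw [h0, nlsEnergy, abs_zero, Real.zero_rpow (by linarith)]
      nlinarith [sq_nonneg (g (.inr e) 0)]

/-- There are no positive stationary solutions which are too small on the compact edges. -/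
theorem not_isStationary_of_small (hp : 2 < p) (hℓ : 0 < ℓ) (hG : G.IsRegular ℓ)
    (hN : 1 ≤ G.P + 2 * G.L) {θ δ : ℝ} (hθ0 : 0 < θ) (hθ1 : θ < 1) (hδ : δ ^ (p - 2) ≤ 1 - θ)
    (hgap : ∀ m : ℤ, (m : ℝ) < (G.P + 2 * G.L) * Real.tanh ℓ →
      (m : ℝ) < (G.P + 2 * G.L) * Real.tanh (θ * ℓ)) (h : G.IsStationary p U g)
    (hsmall : ∀ e, ∀ x ∈ G.interval (.inr e), |U (.inr e) x| ≤ δ) {c : ℝ} (hc : 0 < c)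
    (h0 : ∀ e, U e 0 = c) : False := by
  have hPd : ∀ {i : Fin G.P} {s : ℝ}, 0 ≤ s → s ^ 2 = c ^ 2 - 2 / p * |c| ^ p → 0 < s ∧
      Real.tanh (θ * ℓ) * s ≤ -g (.inr (.inl i)) 0 ∧ -g (.inr (.inl i)) 0 < Real.tanh ℓ * s := by
    intro i s hs hs2
    have hsol := h.sol (.inr (.inl i))
    have hsm := hsmall (.inl i)
    have hn := h.neumann i
    rw [hG.1 i] at hn
    simp only [interval, hG.1 i] at hsol hsm
    exact hsol.slope_pendant hp hℓ hθ0 hθ1 hδ hsm (by rwa [h0]) hn hs (by rwa [h0])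
  have hLd : ∀ {j : Fin G.L} {s : ℝ}, 0 ≤ s → s ^ 2 = c ^ 2 - 2 / p * |c| ^ p → 0 < s ∧
      Real.tanh (θ * ℓ) * s ≤ -g (.inr (.inr j)) 0 ∧ -g (.inr (.inr j)) 0 < Real.tanh ℓ * s ∧
      g (.inr (.inr j)) (2 * ℓ) = -g (.inr (.inr j)) 0 := by
    intro j s hs hs2
    have hsol := h.sol (.inr (.inr j))
    have hsm := hsmall (.inr j)
    have hn := h.loop j
    rw [hG.2 j] at hn
    simp only [interval, hG.2 j] at hsol hsm
    exact hsol.slope_loop hp hℓ hθ0 hθ1 hδ hsm (by rwa [h0]) hn hs (by rwa [h0])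
  have hH : ∀ i : Fin G.H, g (.inl i) 0 ^ 2 = c ^ 2 - 2 / p * |c| ^ p := by
    intro i
    have := h.energy_halfLine hp i le_rfl
    rw [h0, nlsEnergy] at this
    linarith
  -- All half-line slopes at the knot have the same modulus s, so their sum is an integer multiple
  -- of s.
  set s := |g (.inl ⟨0, G.one_le_H⟩) 0| with hs
  have hs0 : 0 ≤ s := abs_nonneg _
  have hs2 : s ^ 2 = c ^ 2 - 2 / p * |c| ^ p := by rw [hs, sq_abs, hH]
  have hε : ∀ i : Fin G.H, ∃ ε : ℤ, g (.inl i) 0 = ε * s := by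
    intro i
    rcases sq_eq_sq_iff_eq_or_eq_neg.1 ((hH i).trans hs2.symm) with h | h
    · exact ⟨1, by rw [h]; simp⟩
    · exact ⟨-1, by rw [h]; simp⟩
  choose ε hε using hε
  have hk := h.kirchhoff
  have hm : ∑ i, g (.inl i) 0 = ((∑ i, ε i : ℤ) : ℝ) * s := by
    push_cast
    rw [Finset.sum_mul]
    exact Finset.sum_congr rfl fun i _ ↦ hε i
  have hloop : ∀ j, g (.inr (.inr j)) 0 - g (.inr (.inr j)) (G.loopLength j) =
      2 * g (.inr (.inr j)) 0 := fun j ↦ by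
    rw [hG.2 j, (hLd hs0 hs2).2.2.2]; ring
  simp_rw [hloop] at hk
  rw [hm, ← Finset.mul_sum] at hk
  have hspos : 0 < s := by
    rcases Nat.eq_zero_or_pos G.P with hP | hP
    · exact (hLd (j := ⟨0, by omega⟩) hs0 hs2).1
    · exact (hPd (i := ⟨0, hP⟩) hs0 hs2).1
  have sP1 : G.P * (Real.tanh (θ * ℓ) * s) ≤ ∑ i, -g (.inr (.inl i)) 0 := by
    have := Finset.card_nsmul_le_sum Finset.univ (fun i ↦ -g (.inr (.inl i)) 0)
      (Real.tanh (θ * ℓ) * s) fun i _ ↦ (hPd hs0 hs2).2.1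
    simpa using this
  have sL1 : G.L * (Real.tanh (θ * ℓ) * s) ≤ ∑ i, -g (.inr (.inr i)) 0 := by
    have := Finset.card_nsmul_le_sum Finset.univ (fun i ↦ -g (.inr (.inr i)) 0)
      (Real.tanh (θ * ℓ) * s) fun i _ ↦ (hLd hs0 hs2).2.1
    simpa using this
  have sP2 : ∑ i, -g (.inr (.inl i)) 0 ≤ G.P * (Real.tanh ℓ * s) := by
    have := Finset.sum_le_card_nsmul Finset.univ (fun i ↦ -g (.inr (.inl i)) 0)
      (Real.tanh ℓ * s) fun i _ ↦ (hPd hs0 hs2).2.2.le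
    simpa using this
  have sL2 : ∑ i, -g (.inr (.inr i)) 0 ≤ G.L * (Real.tanh ℓ * s) := by
    have := Finset.sum_le_card_nsmul Finset.univ (fun i ↦ -g (.inr (.inr i)) 0)
      (Real.tanh ℓ * s) fun i _ ↦ (hLd hs0 hs2).2.2.1.le
    simpa using this
  have hlt : ∑ i, -g (.inr (.inl i)) 0 + 2 * ∑ i, -g (.inr (.inr i)) 0 <
      (G.P + 2 * G.L) * (Real.tanh ℓ * s) := by
    rcases Nat.eq_zero_or_pos G.P with hP | hP
    · have : ∑ i, -g (.inr (.inr i)) 0 < ∑ _i : Fin G.L, Real.tanh ℓ * s :=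
        Finset.sum_lt_sum_of_nonempty ⟨⟨0, by omega⟩, Finset.mem_univ _⟩
          fun i _ ↦ (hLd hs0 hs2).2.2.1
      simp only [Finset.sum_const, Finset.card_univ, Fintype.card_fin, nsmul_eq_mul] at this
      linarith
    · have : ∑ i, -g (.inr (.inl i)) 0 < ∑ _i : Fin G.P, Real.tanh ℓ * s :=
        Finset.sum_lt_sum_of_nonempty ⟨⟨0, hP⟩, Finset.mem_univ _⟩
          fun i _ ↦ (hPd hs0 hs2).2.2
      simp only [Finset.sum_const, Finset.card_univ, Fintype.card_fin, nsmul_eq_mul] at this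
      linarith
  simp only [Finset.sum_neg_distrib] at sP1 sL1 hlt
  -- The upper slope bounds put the integer strictly below N tanh ℓ, hence by the gap strictly below
  -- N tanh(θℓ), which contradicts the lower slope bounds.
  have h1 : ((∑ i, ε i : ℤ) : ℝ) < (G.P + 2 * G.L) * Real.tanh ℓ := by
    refine lt_of_mul_lt_mul_right ?_ hspos.le
    linarith
  have h2 := mul_lt_mul_of_pos_right (hgap _ h1) hspos
  linarith

/-- Nontrivial stationary solutions on a regular graph with compact edges are not small there. -/
theorem exists_pos_forall_not_small (hp : 2 < p) (hℓ : 0 < ℓ) (hG : G.IsRegular ℓ)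
    (hN : 1 ≤ G.P + 2 * G.L) :
    ∃ δ > 0, ∀ U g : G.Edge → ℝ → ℝ, G.IsStationary p U g →
      (∀ e, ∀ x ∈ G.interval (.inr e), |U (.inr e) x| ≤ δ) →
      ∀ e, ∀ x ∈ G.interval e, U e x = 0 := by
  have hp2 : 0 < p - 2 := by linarith
  obtain ⟨θ, hθ0, hθ1, hgap⟩ : ∃ θ : ℝ, 0 < θ ∧ θ < 1 ∧
      ∀ m : ℤ, (m : ℝ) < (G.P + 2 * G.L) * Real.tanh ℓ →
        (m : ℝ) < (G.P + 2 * G.L) * Real.tanh (θ * ℓ) := by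
    have hc : ContinuousAt (fun θ : ℝ ↦ (G.P + 2 * G.L : ℝ) * Real.tanh (θ * ℓ)) 1 := by
      have : Continuous Real.tanh := by
        rw [show Real.tanh = fun x ↦ Real.sinh x / Real.cosh x from
          funext Real.tanh_eq_sinh_div_cosh]
        exact Real.continuous_sinh.div Real.continuous_cosh fun x ↦ (Real.cosh_pos x).ne'
      exact (continuous_const.mul (this.comp (by fun_prop))).continuousAt
    -- The largest integer strictly below N tanh ℓ. Since N tanh ℓ may itself be an integer, the
    -- strict upper slope bound is essential.
    set n : ℤ := ⌈(G.P + 2 * G.L : ℝ) * Real.tanh ℓ⌉ - 1 with hn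
    have hlt : (n : ℝ) < (G.P + 2 * G.L : ℝ) * Real.tanh (1 * ℓ) := by
      rw [one_mul, ← Int.lt_ceil, hn]
      omega
    have hev := (continuousAt_const.eventually_lt hc hlt).and
      ((continuousAt_const (y := (0 : ℝ))).eventually_lt continuousAt_id one_pos)
    have hev2 := (hev.filter_mono nhdsWithin_le_nhds).and
      (self_mem_nhdsWithin : Iio (1 : ℝ) ∈ 𝓝[<] 1)
    obtain ⟨θ, ⟨h1, h2⟩, h3⟩ := hev2.exists
    refine ⟨θ, h2, h3, fun m hm ↦ lt_of_le_of_lt ?_ h1⟩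
    rw [← Int.lt_ceil] at hm
    exact_mod_cast (by omega : m ≤ n)
  have hδ : ((1 - θ) ^ (1 / (p - 2))) ^ (p - 2) ≤ 1 - θ := by
    rw [← Real.rpow_mul (by linarith), one_div, inv_mul_cancel₀ hp2.ne', Real.rpow_one]
  have hδ1 : (1 - θ) ^ (1 / (p - 2)) ≤ solitonMax p :=
    (Real.rpow_le_one (by linarith) (by linarith) (by positivity)).trans (one_le_solitonMax hp)
  refine ⟨(1 - θ) ^ (1 / (p - 2)), Real.rpow_pos_of_pos (by linarith) _, fun U g h hsmall ↦ ?_⟩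
  have e0 : G.Edge := .inl ⟨0, G.one_le_H⟩
  have h0 : ∀ e, U e 0 = U e0 0 := fun e ↦ h.knot e e0
  rcases lt_trichotomy (U e0 0) 0 with hc | hc | hc
  · exact (not_isStationary_of_small hp hℓ hG hN hθ0 hθ1 hδ hgap h.neg
      (fun e x hx ↦ by rw [abs_neg]; exact hsmall e x hx) (neg_pos.2 hc)
      fun e ↦ by rw [h0]).elim
  · exact h.eq_zero_of_knot_eq_zero hp (fun e ↦ (h0 e).trans hc)
      fun e x hx ↦ (hsmall e x hx).trans hδ1
  · exact (not_isStationary_of_small hp hℓ hG hN hθ0 hθ1 hδ hgap h hsmall hc h0).elim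

end SingleKnotGraph

/-! ### Compactness and minimisation -/

/-- Fatou's lemma for integrals of nonnegative functions over a set. -/
theorem integrableOn_and_setIntegral_le_of_tendsto {I : Set ℝ} (hI : MeasurableSet I)
    {f : ℕ → ℝ → ℝ} {F : ℝ → ℝ} {b : ℝ} (hf : ∀ n, IntegrableOn (f n) I) (hf0 : ∀ n x, 0 ≤ f n x)
    (hF : Continuous F) (hF0 : ∀ x, 0 ≤ F x)
    (hlim : ∀ x ∈ I, Tendsto (fun n ↦ f n x) atTop (𝓝 (F x)))
    (hb : Tendsto (fun n ↦ ∫ x in I, f n x) atTop (𝓝 b)) :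
    IntegrableOn F I ∧ ∫ x in I, F x ≤ b := by
  have hb0 : 0 ≤ b := ge_of_tendsto' hb fun n ↦ integral_nonneg (hf0 n)
  have key : ∫⁻ x in I, ENNReal.ofReal (F x) ≤ ENNReal.ofReal b := by
    calc ∫⁻ x in I, ENNReal.ofReal (F x)
        = ∫⁻ x in I, liminf (fun n ↦ ENNReal.ofReal (f n x)) atTop := by
          refine setLIntegral_congr_fun hI fun x hx ↦ ?_
          exact ((ENNReal.continuous_ofReal.tendsto _).comp (hlim x hx)).liminf_eq.symm
      _ ≤ liminf (fun n ↦ ∫⁻ x in I, ENNReal.ofReal (f n x)) atTop :=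
          lintegral_liminf_le' fun n ↦ (hf n).aemeasurable.ennreal_ofReal
      _ = ENNReal.ofReal b := by
          refine Tendsto.liminf_eq ?_
          refine ((ENNReal.continuous_ofReal.tendsto _).comp hb).congr fun n ↦ ?_
          exact ofReal_integral_eq_lintegral_ofReal (hf n) (Eventually.of_forall (hf0 n))
  have hint : IntegrableOn F I := by
    refine ⟨hF.aestronglyMeasurable, ?_⟩
    rw [hasFiniteIntegral_iff_ofReal (Eventually.of_forall hF0)]
    exact key.trans_lt ENNReal.ofReal_lt_top
  refine ⟨hint, ?_⟩
  rw [← ofReal_integral_eq_lintegral_ofReal hint (Eventually.of_forall hF0)] at key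
  exact (ENNReal.ofReal_le_ofReal_iff hb0).1 key

theorem integrableOn_sq_add_sq {I : Set ℝ} {f g : ℝ → ℝ} (hf : MemLp f 2 (volume.restrict I))
    (hg : MemLp g 2 (volume.restrict I)) : IntegrableOn (fun x ↦ f x ^ 2 + g x ^ 2) I :=
  hf.integrable_sq.add hg.integrable_sq

namespace IsNLSSolution

variable {p : ℝ} {U g : ℝ → ℝ}

/-- Solutions on a bounded interval are bounded in terms of their norm. -/
theorem exists_bound_Icc (hp : 2 < p) {a : ℝ} (ha : 0 < a) (C : ℝ) :
    ∃ M, ∀ U g : ℝ → ℝ, IsNLSSolution p (Icc 0 a) U g →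
      ∫ x in Icc 0 a, (g x ^ 2 + U x ^ 2) ≤ C → ∀ x ∈ Icc 0 a, |U x| ≤ M ∧ |g x| ≤ M := by
  have hp0 : 0 < 2 / p := by have : 0 < p := by linarith
                             positivity
  -- At some y the density is at most its mean C / a, so U² ≤ C / a + C everywhere. Comparing
  -- energies at x and y then bounds the slope, which explains the second constant.
  set M₁ := √(C / a + C) with hM₁
  refine ⟨max M₁ √(M₁ ^ 2 + (C / a + 2 / p * M₁ ^ p)), fun U g h hC ↦ ?_⟩
  have hI : IsEdgeInterval (Icc 0 a) := Or.inr ⟨a, ha, rfl⟩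
  have hU2 := memLp_two_Icc_of_continuous h.continuous 0 a
  have hg2 := memLp_two_Icc_of_continuous h.continuous_deriv 0 a
  obtain ⟨y, hy, hyC⟩ : ∃ y ∈ Icc 0 a, g y ^ 2 + U y ^ 2 ≤ C / a := by
    obtain ⟨y, hy, hle⟩ := exists_le_setAverage (μ := volume) (s := Icc 0 a)
      (f := fun x ↦ g x ^ 2 + U x ^ 2) (by simp [ha]) (by simp)
      (integrableOn_sq_add_sq hg2 hU2)
    refine ⟨y, hy, hle.trans ?_⟩
    rw [setAverage_eq, measureReal_def, Real.volume_Icc, sub_zero, ENNReal.toReal_ofReal ha.le,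
      smul_eq_mul, inv_mul_eq_div]
    gcongr
  have hUM : ∀ x ∈ Icc 0 a, |U x| ≤ M₁ := fun x hx ↦ by
    refine Real.abs_le_sqrt ((h.sq_le hI hU2 hg2 hx hy).trans ?_)
    nlinarith [sq_nonneg (g y)]
  intro x hx
  refine ⟨(hUM x hx).trans (le_max_left _ _), le_trans (Real.abs_le_sqrt ?_) (le_max_right _ _)⟩
  have hE := h.energy_eq' hp hI hx hy
  rw [nlsEnergy, nlsEnergy] at hE
  have h1 : U x ^ 2 ≤ M₁ ^ 2 := sq_le_sq' (by linarith [(abs_le.1 (hUM x hx)).1])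
    (abs_le.1 (hUM x hx)).2
  have h2 : |U y| ^ p ≤ M₁ ^ p := Real.rpow_le_rpow (abs_nonneg _) (hUM y hy) (by linarith)
  have h3 : 0 ≤ |U x| ^ p := Real.rpow_nonneg (abs_nonneg _) _
  nlinarith [sq_nonneg (U y), mul_nonneg hp0.le h3, mul_le_mul_of_nonneg_left h2 hp0.le]

/-- Bounded solutions depend continuously on their data at `0`, compared to the zero solution. -/
theorem abs_le_mul_exp {I : Set ℝ} (hI : IsEdgeInterval I) {M : ℝ} (hM : 0 ≤ M) {K : NNReal}
    (hK : LipschitzWith K (nlsField p M)) (h : IsNLSSolution p I U g)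
    (hU : ∀ x ∈ I, |U x| ≤ M) (hg : ∀ x ∈ I, |g x| ≤ M) {x : ℝ} (hx : x ∈ I) :
    |U x| ≤ max |U 0| |g 0| * Real.exp (K * x) := by
  have hs := hI.Icc_subset hx
  have hd := dist_le_of_hasDerivAt_nlsField hK (α := fun x ↦ (U x, g x)) (β := fun _ ↦ (0, 0))
    (fun t ht ↦ h.hasDerivAt_nlsField (hs ht) (hU t (hs ht)) (hg t (hs ht)))
    (fun t _ ↦ hasDerivAt_nlsField_const hM
      (by rw [clamp_of_abs_le (by rwa [abs_zero]), nlsForce_zero]) t)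
    (right_mem_Icc.2 (hI.nonneg hx))
  simp only [Prod.dist_eq, Real.dist_eq, sub_zero] at hd
  exact (le_max_left _ _).trans hd

end IsNLSSolution

namespace SingleKnotGraph

variable {G : SingleKnotGraph} {p ℓ : ℝ} {U g : G.Edge → ℝ → ℝ}

theorem integral_le_normSq (G : SingleKnotGraph) (U g : G.Edge → ℝ → ℝ) (e : G.Edge) :
    ∫ x in G.interval e, (g e x ^ 2 + U e x ^ 2) ≤ G.normSq U g :=
  Finset.single_le_sum (f := fun e ↦ ∫ x in G.interval e, (g e x ^ 2 + U e x ^ 2))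
    (fun e _ ↦ integral_nonneg fun x ↦ by positivity) (Finset.mem_univ e)

theorem normSq_nonneg (G : SingleKnotGraph) (U g : G.Edge → ℝ → ℝ) : 0 ≤ G.normSq U g :=
  Finset.sum_nonneg fun e _ ↦ integral_nonneg fun x ↦ by positivity

/-- Half-lines need no norm bound, as zero energy already confines the orbit. The finitely many
compact edges are covered by `IsNLSSolution.exists_bound_Icc`. -/
theorem exists_bound (G : SingleKnotGraph) (hp : 2 < p) (C : ℝ) :
    ∃ M, ∀ U g : G.Edge → ℝ → ℝ, G.IsStationary p U g → G.normSq U g ≤ C →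
      ∀ e, ∀ x ∈ G.interval e, |U e x| ≤ M ∧ |g e x| ≤ M := by
  have hedge : ∀ e : G.Edge, ∃ M, ∀ U g : G.Edge → ℝ → ℝ, G.IsStationary p U g →
      G.normSq U g ≤ C → ∀ x ∈ G.interval e, |U e x| ≤ M ∧ |g e x| ≤ M := by
    rintro (i | i | j)
    · exact ⟨solitonMax p, fun U g h _ x hx ↦
        abs_le_solitonMax_of_nlsEnergy_nonpos hp (h.energy_halfLine hp i hx).le⟩
    · obtain ⟨M, hM⟩ := IsNLSSolution.exists_bound_Icc hp (G.pendantLength_pos i) C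
      exact ⟨M, fun U g h hC ↦ hM _ _ (h.sol (.inr (.inl i)))
        ((G.integral_le_normSq U g (.inr (.inl i))).trans hC)⟩
    · obtain ⟨M, hM⟩ := IsNLSSolution.exists_bound_Icc hp (G.loopLength_pos j) C
      exact ⟨M, fun U g h hC ↦ hM _ _ (h.sol (.inr (.inr j)))
        ((G.integral_le_normSq U g (.inr (.inr j))).trans hC)⟩
  choose M hM using hedge
  have hle : ∀ e, M e ≤ ∑ e, |M e| := fun e ↦ (le_abs_self _).trans
    (Finset.single_le_sum (f := fun e ↦ |M e|) (fun _ _ ↦ abs_nonneg _) (Finset.mem_univ e))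
  exact ⟨∑ e, |M e|, fun U g h hC e x hx ↦
    ⟨(hM e U g h hC x hx).1.trans (hle e), (hM e U g h hC x hx).2.trans (hle e)⟩⟩

/-- Sequences of stationary solutions with convergent norms converge along a subsequence, together
with their derivatives, to a stationary solution, and the norm is lower semicontinuous. -/
theorem exists_tendsto_isStationary (hp : 2 < p) {U g : ℕ → G.Edge → ℝ → ℝ}
    (h : ∀ n, G.IsStationary p (U n) (g n)) {C S : ℝ} (hC : ∀ n, G.normSq (U n) (g n) ≤ C)
    (hS : Tendsto (fun n ↦ G.normSq (U n) (g n)) atTop (𝓝 S)) :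
    ∃ V k : G.Edge → ℝ → ℝ, ∃ φ : ℕ → ℕ, StrictMono φ ∧ G.IsStationary p V k ∧
      G.normSq V k ≤ S ∧
      (∀ e, ∀ x ∈ G.interval e, Tendsto (fun n ↦ U (φ n) e x) atTop (𝓝 (V e x))) ∧
      (∀ e, ∀ x ∈ G.interval e, Tendsto (fun n ↦ g (φ n) e x) atTop (𝓝 (k e x))) := by
  obtain ⟨M, hM⟩ := G.exists_bound hp C
  have hM' := fun n ↦ hM (U n) (g n) (h n) (hC n)
  -- Data at 0 determine the limit on each edge, so finite-dimensional compactness suffices. The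
  -- norms of the single edges are included so that Fatou's lemma applies edge by edge even if mass
  -- escapes along a half-line.
  let D : ℕ → G.Edge → ℝ × ℝ × ℝ := fun n e ↦
    (U n e 0, g n e 0, ∫ x in G.interval e, (g n e x ^ 2 + U n e x ^ 2))
  have hD : ∀ n, D n ∈ Metric.closedBall 0 (|M| + |C|) := by
    intro n
    rw [mem_closedBall_zero_iff, pi_norm_le_iff_of_nonneg (by positivity)]
    intro e
    have h0 := hM' n e 0 (G.isEdgeInterval e).zero_mem
    have h1 : 0 ≤ ∫ x in G.interval e, (g n e x ^ 2 + U n e x ^ 2) :=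
      integral_nonneg fun x ↦ by positivity
    have h2 := (G.integral_le_normSq (U n) (g n) e).trans (hC n)
    simp only [D, Prod.norm_def, Real.norm_eq_abs, max_le_iff, abs_of_nonneg h1]
    refine ⟨?_, ?_, ?_⟩ <;> linarith [le_abs_self M, le_abs_self C, abs_nonneg M, abs_nonneg C,
      h0.1, h0.2]
  obtain ⟨A, -, φ, hφ, hlim⟩ := tendsto_subseq_of_bounded Metric.isBounded_closedBall hD
  have hlim' := fun e ↦ tendsto_pi_nhds.1 hlim e
  have l1 : ∀ e, Tendsto (fun n ↦ U (φ n) e 0) atTop (𝓝 (A e).1) := fun e ↦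
    (continuous_fst.tendsto _).comp (hlim' e)
  have l2 : ∀ e, Tendsto (fun n ↦ g (φ n) e 0) atTop (𝓝 (A e).2.1) := fun e ↦
    ((continuous_fst.comp continuous_snd).tendsto _).comp (hlim' e)
  have l3 : ∀ e, Tendsto (fun n ↦ ∫ x in G.interval e, (g (φ n) e x ^ 2 + U (φ n) e x ^ 2)) atTop
      (𝓝 (A e).2.2) := fun e ↦ ((continuous_snd.comp continuous_snd).tendsto _).comp (hlim' e)
  choose V k hV hVlim hklim using fun e ↦ IsNLSSolution.exists_tendsto hp (G.isEdgeInterval e)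
    (fun n ↦ (h (φ n)).sol e) (fun n x hx ↦ (hM' (φ n) e x hx).1)
    (fun n x hx ↦ (hM' (φ n) e x hx).2) (l1 e) (l2 e)
  have hmem0 : ∀ e, (0 : ℝ) ∈ G.interval e := fun e ↦ (G.isEdgeInterval e).zero_mem
  have fatou := fun e ↦ integrableOn_and_setIntegral_le_of_tendsto
    (G.isEdgeInterval e).measurableSet (f := fun n x ↦ g (φ n) e x ^ 2 + U (φ n) e x ^ 2)
    (F := fun x ↦ k e x ^ 2 + V e x ^ 2)
    (fun n ↦ integrableOn_sq_add_sq ((h (φ n)).memLp_deriv e) ((h (φ n)).memLp e))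
    (fun n x ↦ by positivity)
    (((hV e).continuous_deriv.pow 2).add ((hV e).continuous.pow 2)) (fun x ↦ by positivity)
    (fun x hx ↦ ((hklim e x hx).pow 2).add ((hVlim e x hx).pow 2)) (l3 e)
  refine ⟨V, k, φ, hφ, ⟨hV, fun e ↦ ?_, fun e ↦ ?_, fun e e' ↦ ?_, fun j ↦ ?_, fun i ↦ ?_, ?_⟩, ?_,
    hVlim, hklim⟩
  · rw [memLp_two_iff_integrable_sq (hV e).continuous.aestronglyMeasurable]
    refine Integrable.mono (fatou e).1 ((hV e).continuous.pow 2).aestronglyMeasurable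
      (Eventually.of_forall fun x ↦ ?_)
    rw [Real.norm_of_nonneg (by positivity), Real.norm_of_nonneg (by positivity)]
    linarith [sq_nonneg (k e x)]
  · rw [memLp_two_iff_integrable_sq (hV e).continuous_deriv.aestronglyMeasurable]
    refine Integrable.mono (fatou e).1 ((hV e).continuous_deriv.pow 2).aestronglyMeasurable
      (Eventually.of_forall fun x ↦ ?_)
    rw [Real.norm_of_nonneg (by positivity), Real.norm_of_nonneg (by positivity)]
    linarith [sq_nonneg (V e x)]
  · refine tendsto_nhds_unique (hVlim e 0 (hmem0 e)) ?_
    simpa only [(h _).knot e e'] using hVlim e' 0 (hmem0 e')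
  · refine tendsto_nhds_unique (hVlim _ _ (interval_end_mem_loop j)) ?_
    simpa only [(h _).loop j] using hVlim _ 0 (hmem0 _)
  · refine tendsto_nhds_unique (hklim _ _ (interval_end_mem_pendant i)) ?_
    simpa only [(h _).neumann i] using tendsto_const_nhds
  · have t := (tendsto_finsetSum Finset.univ fun i _ ↦ hklim (.inl i) 0 (hmem0 _)).add
      ((tendsto_finsetSum Finset.univ fun i _ ↦ hklim (.inr (.inl i)) 0 (hmem0 _)).add
        (tendsto_finsetSum Finset.univ fun j _ ↦ (hklim (.inr (.inr j)) 0 (hmem0 _)).sub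
          (hklim (.inr (.inr j)) _ (interval_end_mem_loop j))))
    simp only [(h _).kirchhoff] at t
    exact (tendsto_nhds_unique t tendsto_const_nhds)
  · have t : Tendsto (fun n ↦ G.normSq (U (φ n)) (g (φ n))) atTop (𝓝 (∑ e, (A e).2.2)) :=
      tendsto_finsetSum Finset.univ fun e _ ↦ l3 e
    rw [tendsto_nhds_unique (hS.comp hφ.tendsto_atTop) t]
    exact Finset.sum_le_sum fun e _ ↦ (fatou e).2

/-- On a regular graph with compact edges some nontrivial stationary solution has least norm. -/
theorem exists_isStationary_minimal (hp : 2 < p) (hℓ : 0 < ℓ) (hG : G.IsRegular ℓ)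
    (hN : 1 ≤ G.P + 2 * G.L) :
    ∃ V k : G.Edge → ℝ → ℝ, G.IsStationary p V k ∧ (∃ e, ∃ x ∈ G.interval e, V e x ≠ 0) ∧
      ∀ U g : G.Edge → ℝ → ℝ, G.IsStationary p U g → (∃ e, ∃ x ∈ G.interval e, U e x ≠ 0) →
        G.normSq V k ≤ G.normSq U g := by
  let T : Set ℝ := {s | ∃ U g : G.Edge → ℝ → ℝ, G.IsStationary p U g ∧
    (∃ e, ∃ x ∈ G.interval e, U e x ≠ 0) ∧ G.normSq U g = s}
  have hTne : T.Nonempty := by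
    obtain ⟨U, g, h, hne⟩ := exists_isStationary_of_compact_edges hp hℓ hG hN
    exact ⟨_, U, g, h, hne, rfl⟩
  have hTb : BddBelow T := ⟨0, by rintro _ ⟨U, g, -, -, rfl⟩; exact G.normSq_nonneg U g⟩
  obtain ⟨t, -, ht, htT⟩ := exists_seq_tendsto_sInf hTne hTb
  choose U g hUg hne hnorm using htT
  have hS : Tendsto (fun n ↦ G.normSq (U n) (g n)) atTop (𝓝 (sInf T)) := by
    simpa only [hnorm] using ht
  obtain ⟨C, hC⟩ := hS.bddAbove_range
  have hC' : ∀ n, G.normSq (U n) (g n) ≤ C := fun n ↦ hC (mem_range_self n)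
  obtain ⟨V, k, φ, hφ, hV, hVS, hVlim, hklim⟩ := exists_tendsto_isStationary hp hUg hC' hS
  refine ⟨V, k, hV, ?_, fun U' g' h' hne' ↦ hVS.trans (csInf_le hTb ⟨U', g', h', hne', rfl⟩)⟩
  by_contra hcon
  push Not at hcon
  obtain ⟨δ, hδ, hsmall⟩ := exists_pos_forall_not_small hp hℓ hG hN
  -- For a zero limit the energy at the critical point of a compact edge is zero, hence so is the
  -- slope at 0.
  have hk0 : ∀ e, k (.inr e) 0 = 0 := by
    intro e
    obtain ⟨y, hy, hky⟩ := hV.exists_deriv_eq_zero e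
    have hE := (hV.sol (.inr e)).energy_eq hp (G.isEdgeInterval _) hy
    rw [hky, hcon _ y hy, hcon _ 0 (G.isEdgeInterval _).zero_mem, nlsEnergy, nlsEnergy] at hE
    nlinarith
  obtain ⟨M, hM⟩ := G.exists_bound hp C
  have hM' := fun n ↦ hM (U n) (g n) (hUg n) (hC' n)
  have hM0 : 0 ≤ M := (abs_nonneg _).trans
    (hM' 0 (.inl ⟨0, G.one_le_H⟩) 0 (G.isEdgeInterval _).zero_mem).1
  obtain ⟨K, hK⟩ := exists_lipschitzWith_nlsField hp hM0
  -- The data at 0 tend to zero, and on a bounded edge Grönwall's inequality against the zero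
  -- solution makes the smallness uniform.
  have hev : ∀ e, ∀ᶠ n in atTop, ∀ x ∈ G.interval (.inr e), |U (φ n) (.inr e) x| ≤ δ := by
    intro e
    obtain ⟨b, hb⟩ : ∃ b, ∀ x ∈ G.interval (.inr e), x ≤ b := by
      rcases e with i | j
      · exact ⟨G.pendantLength i, fun x hx ↦ hx.2⟩
      · exact ⟨G.loopLength j, fun x hx ↦ hx.2⟩
    have h0 := (G.isEdgeInterval (.inr e)).zero_mem
    have l1 := (hVlim (.inr e) 0 h0).abs
    have l2 := (hklim (.inr e) 0 h0).abs
    rw [hcon _ 0 h0] at l1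
    rw [hk0] at l2
    have l3 := (l1.max l2).mul_const (Real.exp (K * b))
    rw [abs_zero, max_self, zero_mul] at l3
    filter_upwards [l3.eventually_lt_const hδ] with n hn x hx
    refine le_trans ?_ hn.le
    refine (((hUg (φ n)).sol (.inr e)).abs_le_mul_exp (G.isEdgeInterval _) hM0 hK
      (fun x hx ↦ (hM' (φ n) _ x hx).1) (fun x hx ↦ (hM' (φ n) _ x hx).2) hx).trans ?_
    have := hb x hx
    gcongr
  obtain ⟨n, hn⟩ := (eventually_all.2 hev).exists
  obtain ⟨e, x, hx, hne⟩ := hne (φ n)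
  exact hne (hsmall _ _ (hUg (φ n)) hn e x hx)

end SingleKnotGraph

/-! ### Graphs without compact edges -/

/-- The energy density of the soliton. -/
noncomputable def solitonDensity (p x : ℝ) : ℝ := solitonDeriv p x ^ 2 + soliton p x ^ 2

theorem continuous_solitonDensity {p : ℝ} (hp : 2 < p) : Continuous (solitonDensity p) :=
  ((continuous_solitonDeriv hp).pow 2).add ((continuous_soliton hp).pow 2)

theorem setIntegral_solitonDensity_comp_add (p b : ℝ) :
    ∫ x in Ici 0, solitonDensity p (x + b) = ∫ x in Ioi b, solitonDensity p x := by
  rw [integral_Ici_eq_integral_Ioi]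
  have h := (measurePreserving_add_right (volume : Measure ℝ) b).setIntegral_preimage_emb
    (measurableEmbedding_addRight b) (solitonDensity p) (Ioi b)
  simpa using h

theorem integrableOn_solitonDensity {p : ℝ} (hp : 2 < p) (b : ℝ) :
    IntegrableOn (solitonDensity p) (Ioi b) := by
  have h0 : IntegrableOn (solitonDensity p) (Ici 0) := by
    have h1 := memLp_solitonDeriv hp 0
    have h2 := memLp_soliton hp 0
    simp only [add_zero] at h1 h2
    exact integrableOn_sq_add_sq h1 h2
  refine (((continuous_solitonDensity hp).continuousOn.integrableOn_Icc (a := b) (b := 0)).union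
    h0).mono_set fun x hx ↦ ?_
  rcases le_total x 0 with h | h
  · exact Or.inl ⟨le_of_lt hx, h⟩
  · exact Or.inr h

/-- The norms of the two pieces of the soliton are symmetric around that of its half. -/
theorem integral_solitonDensity_symm {p : ℝ} (hp : 2 < p) {ε : ℝ} (hε : ε = 1 ∨ ε = -1) (a : ℝ) :
    ∫ x in Ioi (ε * a), solitonDensity p x = (∫ x in Ioi 0, solitonDensity p x) +
      ε * ((∫ x in Ioi a, solitonDensity p x) - ∫ x in Ioi 0, solitonDensity p x) := by
  have hint := integrableOn_solitonDensity hp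
  rcases hε with rfl | rfl
  · rw [one_mul]; ring
  · have e1 := intervalIntegral.integral_interval_add_Ioi (hint (-a)) (hint 0)
    have e2 := intervalIntegral.integral_interval_add_Ioi (hint 0) (hint a)
    have e3 : ∫ x in -a..0, solitonDensity p x = ∫ x in (0 : ℝ)..a, solitonDensity p x := by
      have := intervalIntegral.integral_comp_neg (solitonDensity p) (a := 0) (b := a)
      rw [neg_zero] at this
      rw [← this]
      refine intervalIntegral.integral_congr fun x _ ↦ ?_
      simp [solitonDensity, soliton_neg, solitonDeriv_neg]
    rw [neg_one_mul]
    linarith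

namespace SingleKnotGraph

variable {G : SingleKnotGraph} {p ℓ : ℝ} {U g : G.Edge → ℝ → ℝ}

/-- On each half-line the solution is the soliton shifted by εᵢ a with εᵢ = ±1. With J(a) the
squared norm of the soliton on (a, ∞), the total is H J(0) + (∑ εᵢ)(J(a) - J(0)). Kirchhoff says
that ∑ εᵢ times the slope at a is zero, so either ∑ εᵢ = 0 or a = 0, and the correction vanishes. -/
theorem normSq_of_pos (hp : 2 < p) (hP : G.P = 0) (hL : G.L = 0) (h : G.IsStationary p U g)
    {c : ℝ} (hc : 0 < c) (h0 : ∀ e, U e 0 = c) :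
    G.normSq U g = G.H * ∫ x in Ioi 0, solitonDensity p x := by
  have : IsEmpty (Fin G.P) := by rw [hP]; infer_instance
  have : IsEmpty (Fin G.L) := by rw [hL]; infer_instance
  have hE : ∀ i : Fin G.H, nlsEnergy p c (g (.inl i) 0) = 0 := fun i ↦ by
    rw [← h0 (.inl i)]; exact h.energy_halfLine hp i le_rfl
  have hcB : c ≤ solitonMax p := (le_abs_self c).trans
    (abs_le_solitonMax_of_nlsEnergy_nonpos hp (hE ⟨0, G.one_le_H⟩).le).1
  obtain ⟨a, ha, hac⟩ := exists_soliton_eq hp hc hcB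
  have hEa := nlsEnergy_soliton hp a
  rw [hac] at hEa
  have hε : ∀ i : Fin G.H, ∃ ε : ℝ, (ε = 1 ∨ ε = -1) ∧ g (.inl i) 0 = ε * solitonDeriv p a := by
    intro i
    have hsq : g (.inl i) 0 ^ 2 = solitonDeriv p a ^ 2 := by
      have := (hE i).trans hEa.symm
      rw [nlsEnergy, nlsEnergy] at this
      linarith
    rcases sq_eq_sq_iff_eq_or_eq_neg.1 hsq with h | h
    · exact ⟨1, Or.inl rfl, by rw [h, one_mul]⟩
    · exact ⟨-1, Or.inr rfl, by rw [h, neg_one_mul]⟩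
  choose ε hε hgε using hε
  have hJ : ∀ i : Fin G.H, ∫ x in Ici 0, (g (.inl i) x ^ 2 + U (.inl i) x ^ 2) =
      ∫ x in Ioi (ε i * a), solitonDensity p x := by
    intro i
    have hsolε : soliton p (ε i * a) = c ∧ solitonDeriv p (ε i * a) = ε i * solitonDeriv p a := by
      rcases hε i with h | h <;> rw [h]
      · rw [one_mul, one_mul]; exact ⟨hac, rfl⟩
      · rw [neg_one_mul, neg_one_mul, soliton_neg, solitonDeriv_neg]; exact ⟨hac, rfl⟩
    have hs := isNLSSolution_soliton hp (Ici 0) (κ := 1) (by simp) (ε i * a)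
    simp only [one_mul] at hs
    have hb := fun x (hx : x ∈ Ici (0 : ℝ)) ↦
      abs_le_solitonMax_of_nlsEnergy_nonpos hp (h.energy_halfLine hp i hx).le
    have hb' := fun x ↦ abs_le_solitonMax_of_nlsEnergy_nonpos hp (nlsEnergy_soliton hp x).le
    have heq := (h.sol (.inl i)).eqOn hp (Or.inl rfl) hs (fun x hx ↦ (hb x hx).1)
      (fun x hx ↦ (hb x hx).2) (fun x _ ↦ (hb' _).1) (fun x _ ↦ (hb' _).2)
      (by rw [h0, zero_add, hsolε.1]) (by rw [hgε, zero_add, hsolε.2])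
    rw [← setIntegral_solitonDensity_comp_add]
    refine setIntegral_congr_fun measurableSet_Ici fun x hx ↦ ?_
    rw [(heq x hx).1, (heq x hx).2, solitonDensity]
  have hk := h.kirchhoff
  simp only [hgε, Finset.univ_eq_empty, Finset.sum_empty, add_zero] at hk
  rw [← Finset.sum_mul] at hk
  have hsum : G.normSq U g = ∑ i, ∫ x in Ioi (ε i * a), solitonDensity p x := by
    rw [normSq, Fintype.sum_sum_type]
    simp only [Finset.univ_eq_empty, Finset.sum_empty, add_zero]
    exact Finset.sum_congr rfl fun i _ ↦ hJ i
  rw [hsum]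
  simp_rw [fun i ↦ integral_solitonDensity_symm hp (hε i) a]
  rw [Finset.sum_add_distrib, ← Finset.sum_mul]
  simp only [Finset.sum_const, Finset.card_univ, Fintype.card_fin, nsmul_eq_mul]
  rcases mul_eq_zero.1 hk with hk | hk
  · rw [hk, zero_mul, add_zero]
  · have ha0 : a = 0 := by
      rw [solitonDeriv, neg_eq_zero] at hk
      have := (mul_eq_zero.1 hk).resolve_left (soliton_pos hp a).ne'
      have := (div_eq_zero_iff.1 this).resolve_right (Real.cosh_pos _).ne'
      rw [Real.sinh_eq_zero] at this
      exact (mul_eq_zero.1 this).resolve_left (by linarith)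
    rw [ha0, sub_self, mul_zero, add_zero]

theorem normSq_neg (G : SingleKnotGraph) (U g : G.Edge → ℝ → ℝ) :
    G.normSq (fun e x ↦ -U e x) (fun e x ↦ -g e x) = G.normSq U g := by
  simp only [normSq, neg_sq]

/-- Without compact edges all nontrivial stationary solutions have the same norm. -/
theorem normSq_of_no_compact_edges (hp : 2 < p) (hP : G.P = 0) (hL : G.L = 0)
    (h : G.IsStationary p U g) (hne : ∃ e, ∃ x ∈ G.interval e, U e x ≠ 0) :
    G.normSq U g = G.H * ∫ x in Ioi 0, solitonDensity p x := by
  have e0 : G.Edge := .inl ⟨0, G.one_le_H⟩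
  have h0 : ∀ e, U e 0 = U e0 0 := fun e ↦ h.knot e e0
  rcases lt_trichotomy (U e0 0) 0 with hc | hc | hc
  · rw [← G.normSq_neg]
    exact normSq_of_pos hp hP hL h.neg (neg_pos.2 hc) fun e ↦ by rw [h0]
  · obtain ⟨e, x, hx, hne⟩ := hne
    refine absurd (h.eq_zero_of_knot_eq_zero hp (fun e ↦ (h0 e).trans hc) ?_ e x hx) hne
    have : IsEmpty (Fin G.P) := by rw [hP]; infer_instance
    have : IsEmpty (Fin G.L) := by rw [hL]; infer_instance
    exact isEmptyElim
  · exact normSq_of_pos hp hP hL h hc h0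

/-! ### From least norm to ground states -/

/-- A nontrivial stationary solution of least norm is an action ground state. -/
theorem IsStationary.isActionGroundState (hp : 2 < p) {V k : G.Edge → ℝ → ℝ}
    (h : G.IsStationary p V k) (hne : ∃ e, ∃ x ∈ G.interval e, V e x ≠ 0)
    (hmin : ∀ U g : G.Edge → ℝ → ℝ, G.IsStationary p U g →
      (∃ e, ∃ x ∈ G.interval e, U e x ≠ 0) → G.normSq V k ≤ G.normSq U g) :
    G.IsActionGroundState p V := by
  have hV := h.isBoundState hp hne
  refine ⟨hV, le_antisymm (le_iInf₂ fun u hu ↦ ?_) (iInf₂_le V hV)⟩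
  obtain ⟨U, g, hU, huU⟩ := IsBoundState.exists_isStationary hp hu
  rw [EReal.coe_le_coe_iff, hV.action_eq hp h (fun _ _ _ ↦ rfl),
    IsBoundState.action_eq hp hu hU huU]
  have hκ : 0 ≤ 1 / 2 - 1 / p := by
    rw [sub_nonneg]
    exact one_div_le_one_div_of_le (by norm_num) hp.le
  refine mul_le_mul_of_nonneg_left (hmin U g hU ?_) hκ
  obtain ⟨e, x, hx, hne⟩ := hu.2.1
  exact ⟨e, x, hx, by rwa [← huU e hx]⟩

end SingleKnotGraph

theorem mainTheorem3 (G : SingleKnotGraph) (ℓ : ℝ) (hℓ : 0 < ℓ) (hG : G.IsRegular ℓ)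
    (p : ℝ) (hp : 2 < p) :
    ∃ u : G.Edge → ℝ → ℝ, G.IsActionGroundState p u := by
  rcases Nat.eq_zero_or_pos (G.P + 2 * G.L) with hN | hN
  · have hP : G.P = 0 := by omega
    have hL : G.L = 0 := by omega
    have hs := SingleKnotGraph.isStationary_soliton hp hP hL
    have hne : ∃ e : G.Edge, ∃ x ∈ G.interval e, soliton p x ≠ 0 :=
      ⟨.inl ⟨0, G.one_le_H⟩, 0, (G.isEdgeInterval _).zero_mem, (soliton_pos hp 0).ne'⟩
    refine ⟨_, hs.isActionGroundState hp hne fun U g h hU ↦ ?_⟩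
    rw [SingleKnotGraph.normSq_of_no_compact_edges hp hP hL hs hne,
      SingleKnotGraph.normSq_of_no_compact_edges hp hP hL h hU]
  · obtain ⟨V, k, hV, hne, hmin⟩ := SingleKnotGraph.exists_isStationary_minimal hp hℓ hG hN
    exact ⟨V, hV.isActionGroundState hp hne hmin⟩
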